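/- Let $r,n\ge 1$ be integers, let $F_r$ be the free group of rank $r$, let $\mathbb{Z}_n\subset S^1$ be the group of $n$-th roots of unity, identified with the scalar matrices in $SU(n)$ (its center), and let $PU(n)=SU(n)/\mathbb{Z}_n$. For a compact group $K$, give $\mathrm{Hom}(F_r,K)\cong K^r$ the product topology and let $\mathrm{Hom}^{irr}(F_r,K)$ be the subspace of irreducible representations, that is, of those $\rho$ for which the centralizer of $\rho(F_r)$ in $K$ is a finite extension of the center of $K$. Put $$SU_{r,n}^*=\mathrm{Hom}^{irr}(F_r,SU(n)),\qquad PU_{r,n}^*=\mathrm{Hom}^{irr}(F_r,PU(n)),\qquad C_{r,n}=\mathrm{Hom}(F_r,\mathbb{Z}_n).$$ The finite group $C_{r,n}$ acts on $SU_{r,n}^*$ by $(\sigma\cdot\rho)(\gamma)=\sigma(\gamma)\rho(\gamma)$. Let $H_c^*$ denote cohomology with compact supports and coefficients in $\mathbb{C}$. Then $C_{r,n}$ acts trivially on $H_c^*(SU_{r,n}^*)$: for every $\sigma\in C_{r,n}$ and every $k\ge 0$, the map induced by $\rho\mapsto\sigma\cdot\rho$ on $H_c^k(SU_{r,n}^*)$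 is the identity. In particular, the natural map $\pi:SU_{r,n}^*\to PU_{r,n}^*$, induced by $SU(n)\to PU(n)$, which is proper and surjective and whose fibres are exactly the $C_{r,n}$-orbits (so that $PU_{r,n}^*=SU_{r,n}^*/C_{r,n}$), induces isomorphisms $\pi^*:H_c^k(PU_{r,n}^*)\to H_c^k(SU_{r,n}^*)$ for all $k\ge 0$. -/

import Mathlib

open CategoryTheory Topology

/-! ### Compactly supported cohomology with complex coefficients

We use the Alexander–Spanier model.  A `k`-cochain on `X` is an arbitrary function
`X ^ (k + 1) → ℂ`; cochains are taken modulo those that vanish near the diagonal, and a cochain has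
compact support if it vanishes near the diagonal point `(x, …, x)` for all `x` outside some compact
set.  On locally compact Hausdorff spaces this is the cohomology with compact supports of the
constant sheaf `ℂ`; on manifolds it also agrees with singular cohomology with compact supports. -/

namespace CompactCohomology

/-- Alexander–Spanier `k`-cochains: functions of `k + 1` points of `X`. -/
abbrev Cochain (X : Type) (k : ℕ) : Type := (Fin (k + 1) → X) → ℂ

/-- The coboundary `(δφ)(x₀, …, x_{k+1}) = ∑ᵢ (-1)ⁱ φ(x₀, …, x̂ᵢ, …, x_{k+1})`. -/
noncomputable def coboundary (X : Type) (k : ℕ) : Cochain X k →ₗ[ℂ] Cochain X (k + 1) where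
  toFun φ := fun x => ∑ i : Fin (k + 2), (-1 : ℂ) ^ (i : ℕ) * φ (fun j => x (i.succAbove j))
  map_add' φ ψ := by
    funext x
    simp [mul_add, Finset.sum_add_distrib]
  map_smul' c φ := by
    funext x
    simp only [Pi.smul_apply, smul_eq_mul, RingHom.id_apply, Finset.mul_sum]
    exact Finset.sum_congr rfl fun i _ => by ring

theorem coboundary_coboundary (X : Type) (k : ℕ) (φ : Cochain X k) :
    coboundary X (k + 1) (coboundary X k φ) = 0 := by
  funext x
  simp only [coboundary, LinearMap.coe_mk, AddHom.coe_mk, Finset.mul_sum, Pi.zero_apply]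
  rw [← Finset.sum_product']
  refine Finset.sum_involution
    (fun p _ => (p.1.succAbove p.2, p.2.predAbove p.1)) ?_ ?_ ?_ ?_
  · rintro ⟨i, j⟩ _
    simp only [Fin.succAbove_succAbove_succAbove_predAbove, ← mul_assoc, ← pow_add,
      Fin.neg_one_pow_succAbove_add_predAbove]
    ring
  · rintro ⟨i, j⟩ _ _ h
    exact Fin.succAbove_ne i j (congrArg Prod.fst h)
  · intro _ _
    exact Finset.mem_univ _
  · rintro ⟨i, j⟩ _
    refine Prod.ext (Fin.succAbove_succAbove_predAbove i j) ?_
    apply Fin.succAbove_right_injective (p := i)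
    have h := Fin.succAbove_succAbove_predAbove (i.succAbove j) (j.predAbove i)
    simpa only [Fin.succAbove_succAbove_predAbove] using h

/-- `φ` vanishes on all tuples of points sufficiently close to `x`. -/
def VanishesNear {X : Type} [TopologicalSpace X] {k : ℕ} (φ : Cochain X k) (x : X) : Prop :=
  ∃ U ∈ 𝓝 x, ∀ y : Fin (k + 1) → X, (∀ i, y i ∈ U) → φ y = 0

theorem VanishesNear.add {X : Type} [TopologicalSpace X] {k : ℕ} {φ ψ : Cochain X k} {x : X}
    (hφ : VanishesNear φ x) (hψ : VanishesNear ψ x) : VanishesNear (φ + ψ) x := by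
  obtain ⟨U, hU, h⟩ := hφ
  obtain ⟨V, hV, h'⟩ := hψ
  refine ⟨U ∩ V, Filter.inter_mem hU hV, fun y hy => ?_⟩
  simp [h y fun i => (hy i).1, h' y fun i => (hy i).2]

theorem VanishesNear.smul {X : Type} [TopologicalSpace X] {k : ℕ} {φ : Cochain X k} {x : X}
    (c : ℂ) (hφ : VanishesNear φ x) : VanishesNear (c • φ) x := by
  obtain ⟨U, hU, h⟩ := hφ
  exact ⟨U, hU, fun y hy => by simp [h y hy]⟩

theorem VanishesNear.zero {X : Type} [TopologicalSpace X] {k : ℕ} (x : X) :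
    VanishesNear (0 : Cochain X k) x :=
  ⟨Set.univ, Filter.univ_mem, fun _ _ => rfl⟩

theorem VanishesNear.coboundary {X : Type} [TopologicalSpace X] {k : ℕ} {φ : Cochain X k} {x : X}
    (hφ : VanishesNear φ x) : VanishesNear (coboundary X k φ) x := by
  obtain ⟨U, hU, h⟩ := hφ
  refine ⟨U, hU, fun y hy => ?_⟩
  change ∑ i : Fin (k + 2), (-1 : ℂ) ^ (i : ℕ) * φ (fun j => y (i.succAbove j)) = 0
  refine Finset.sum_eq_zero fun i _ => ?_
  rw [h (fun j => y (i.succAbove j)) fun j => hy _, mul_zero]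

/-- The cochains that vanish near every point of `X`. -/
def locallyZero (X : Type) [TopologicalSpace X] (k : ℕ) : Submodule ℂ (Cochain X k) where
  carrier := {φ | ∀ x, VanishesNear φ x}
  add_mem' hφ hψ x := (hφ x).add (hψ x)
  zero_mem' x := VanishesNear.zero x
  smul_mem' c _ hφ x := (hφ x).smul c

/-- The cochains that vanish near every point outside some compact set. -/
def compactlySupported (X : Type) [TopologicalSpace X] (k : ℕ) : Submodule ℂ (Cochain X k) where
  carrier := {φ | ∃ K : Set X, IsCompact K ∧ ∀ x ∉ K, VanishesNear φ x}
  add_mem' := by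
    rintro φ ψ ⟨K, hK, h⟩ ⟨L, hL, h'⟩
    exact ⟨K ∪ L, hK.union hL, fun x hx =>
      (h x fun hxK => hx (Or.inl hxK)).add (h' x fun hxL => hx (Or.inr hxL))⟩
  zero_mem' := ⟨∅, isCompact_empty, fun x _ => VanishesNear.zero x⟩
  smul_mem' := by
    rintro c φ ⟨K, hK, h⟩
    exact ⟨K, hK, fun x hx => (h x hx).smul c⟩

/-- Compactly supported Alexander–Spanier cochains modulo locally zero ones. -/
abbrev CompactCochain (X : Type) [TopologicalSpace X] (k : ℕ) : Type :=
  compactlySupported X k ⧸ (locallyZero X k).submoduleOf (compactlySupported X k)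

theorem coboundary_mem (X : Type) [TopologicalSpace X] (k : ℕ) :
    ∀ φ ∈ compactlySupported X k, coboundary X k φ ∈ compactlySupported X (k + 1) := by
  rintro φ ⟨K, hK, h⟩
  exact ⟨K, hK, fun x hx => (h x hx).coboundary⟩

/-- The coboundary on compactly supported cochains modulo locally zero ones. -/
noncomputable def compactCoboundary (X : Type) [TopologicalSpace X] (k : ℕ) :
    CompactCochain X k →ₗ[ℂ] CompactCochain X (k + 1) :=
  Submodule.mapQ _ _ ((coboundary X k).restrict (coboundary_mem X k)) fun _ hφ x =>
    (hφ x).coboundary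

theorem compactCoboundary_comp (X : Type) [TopologicalSpace X] (k : ℕ) :
    (compactCoboundary X (k + 1)).comp (compactCoboundary X k) = 0 := by
  refine Submodule.linearMap_qext _ (LinearMap.ext fun φ => ?_)
  have h : (coboundary X (k + 1)).restrict (coboundary_mem X (k + 1))
      ((coboundary X k).restrict (coboundary_mem X k) φ) = 0 :=
    Subtype.ext (coboundary_coboundary X k φ.1)
  change Submodule.Quotient.mk ((coboundary X (k + 1)).restrict (coboundary_mem X (k + 1))
      ((coboundary X k).restrict (coboundary_mem X k) φ)) = 0
  rw [h]
  rfl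

/-- The complex of compactly supported Alexander–Spanier cochains. -/
noncomputable def cochainComplex (X : Type) [TopologicalSpace X] :
    CochainComplex (ModuleCat ℂ) ℕ :=
  CochainComplex.of (fun k => ModuleCat.of ℂ (CompactCochain X k))
    (fun k => ModuleCat.ofHom (compactCoboundary X k)) fun k => by
      rw [← ModuleCat.ofHom_comp, compactCoboundary_comp]
      rfl

theorem VanishesNear.comp {X Y : Type} [TopologicalSpace X] [TopologicalSpace Y] {k : ℕ}
    {φ : Cochain Y k} {f : X → Y} (hf : Continuous f) {x : X} (hφ : VanishesNear φ (f x)) :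
    VanishesNear (fun y => φ (f ∘ y)) x := by
  obtain ⟨U, hU, h⟩ := hφ
  exact ⟨f ⁻¹' U, hf.continuousAt hU, fun y hy => h (f ∘ y) hy⟩

/-- Pull-back of cochains. -/
def pullback {X Y : Type} (f : X → Y) (k : ℕ) : Cochain Y k →ₗ[ℂ] Cochain X k where
  toFun φ := fun y => φ (f ∘ y)
  map_add' _ _ := rfl
  map_smul' _ _ := rfl

theorem pullback_mem {X Y : Type} [TopologicalSpace X] [TopologicalSpace Y] {f : X → Y}
    (hf : IsProperMap f) (k : ℕ) :
    ∀ φ ∈ compactlySupported Y k, pullback f k φ ∈ compactlySupported X k := by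
  rintro φ ⟨K, hK, h⟩
  exact ⟨f ⁻¹' K, hf.isCompact_preimage hK, fun x hx => (h (f x) hx).comp hf.continuous⟩

/-- Pull-back of compactly supported cochains, modulo locally zero ones, by a proper map. -/
noncomputable def compactPullback {X Y : Type} [TopologicalSpace X] [TopologicalSpace Y] {f : X → Y}
    (hf : IsProperMap f) (k : ℕ) : CompactCochain Y k →ₗ[ℂ] CompactCochain X k :=
  Submodule.mapQ _ _ ((pullback f k).restrict (pullback_mem hf k)) fun _ hφ x =>
    (hφ (f x)).comp hf.continuous

theorem compactPullback_coboundary {X Y : Type} [TopologicalSpace X] [TopologicalSpace Y]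
    {f : X → Y} (hf : IsProperMap f) (k : ℕ) :
    (compactCoboundary X k).comp (compactPullback hf k) =
      (compactPullback hf (k + 1)).comp (compactCoboundary Y k) := by
  refine Submodule.linearMap_qext _ (LinearMap.ext fun φ => ?_)
  rfl

/-- The morphism of complexes induced by a proper map. -/
noncomputable def cochainMap {X Y : Type} [TopologicalSpace X] [TopologicalSpace Y] {f : X → Y}
    (hf : IsProperMap f) : cochainComplex Y ⟶ cochainComplex X :=
  CochainComplex.ofHom (fun k => ModuleCat.ofHom (compactPullback hf k)) fun k => by
    simp only [cochainComplex, CochainComplex.of_d]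
    rw [← ModuleCat.ofHom_comp, ← ModuleCat.ofHom_comp, compactPullback_coboundary]

/-- `H_c^k(X) = H_c^k(X, ℂ)`. -/
noncomputable def Hc (X : Type) [TopologicalSpace X] (k : ℕ) : ModuleCat ℂ :=
  (cochainComplex X).homology k

/-- The map `f^* : H_c^k(Y) ⟶ H_c^k(X)` induced by a proper continuous map `f : X → Y`. -/
noncomputable def HcMap {X Y : Type} [TopologicalSpace X] [TopologicalSpace Y] {f : X → Y}
    (hf : IsProperMap f) (k : ℕ) : Hc Y k ⟶ Hc X k :=
  HomologicalComplex.homologyMap (cochainMap hf) k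

end CompactCohomology

/-! ### Representations of free groups -/

/-- The topology of `Hom(F_r, K) ≅ K ^ r`, the identification being evaluation at the generators. -/
instance freeRepTopology (r : ℕ) (K : Type) [Group K] [TopologicalSpace K] :
    TopologicalSpace (FreeGroup (Fin r) →* K) :=
  TopologicalSpace.induced (fun ρ i => ρ (FreeGroup.of i)) inferInstance

/-- A representation `ρ : Γ → K` in a compact group is irreducible if its centralizer `Z_ρ` is a
finite extension of the center of `K`.  (As `K` is compact, the conjugation orbit of `ρ` is closed,
so polystability is automatic.) -/
def IsIrreducibleRep {Γ K : Type} [Group Γ] [Group K] (ρ : Γ →* K) : Prop :=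
  ((Subgroup.center K).subgroupOf (Subgroup.centralizer (Set.range ρ))).FiniteIndex

/-- `Hom^irr(F_r, K)`, with the subspace topology of `Hom(F_r, K)`. -/
abbrev IrrRep (r : ℕ) (K : Type) [Group K] : Type :=
  {ρ : FreeGroup (Fin r) →* K // IsIrreducibleRep ρ}

/-- Pointwise multiplication of a representation by a representation with central values. -/
def twistRep {Γ K : Type} [Group Γ] [Group K] (σ ρ : Γ →* K)
    (hσ : ∀ γ, σ γ ∈ Subgroup.center K) : Γ →* K where
  toFun γ := σ γ * ρ γ
  map_one' := by simp
  map_mul' a b := by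
    have h := Subgroup.mem_center_iff.mp (hσ b) (ρ a)
    simp only [map_mul, mul_assoc]
    rw [← mul_assoc (σ b), ← h, mul_assoc]

theorem centralizer_twistRep {Γ K : Type} [Group Γ] [Group K] (σ ρ : Γ →* K)
    (hσ : ∀ γ, σ γ ∈ Subgroup.center K) :
    Subgroup.centralizer (Set.range (twistRep σ ρ hσ)) = Subgroup.centralizer (Set.range ρ) := by
  ext g
  simp only [Subgroup.mem_centralizer_iff, Set.forall_mem_range]
  refine forall_congr' fun γ => ?_
  have h := Subgroup.mem_center_iff.mp (hσ γ) g
  change σ γ * ρ γ * g = g * (σ γ * ρ γ) ↔ _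
  rw [← mul_assoc g, h, mul_assoc, mul_assoc, mul_right_inj]

theorem IsIrreducibleRep.twist {Γ K : Type} [Group Γ] [Group K] {σ ρ : Γ →* K}
    (hσ : ∀ γ, σ γ ∈ Subgroup.center K) (hρ : IsIrreducibleRep ρ) :
    IsIrreducibleRep (twistRep σ ρ hσ) := by
  unfold IsIrreducibleRep at *
  rwa [centralizer_twistRep]

/-- Irreducibility passes to the quotient by a finite central subgroup. -/
theorem IsIrreducibleRep.mk {r : ℕ} {K : Type} [Group K] (N : Subgroup K) [N.Normal] [Finite N]
    (hN : N ≤ Subgroup.center K) {ρ : FreeGroup (Fin r) →* K} (hρ : IsIrreducibleRep ρ) :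
    IsIrreducibleRep ((QuotientGroup.mk' N).comp ρ) := by
  set q := QuotientGroup.mk' N
  set Zb := Subgroup.centralizer (Set.range (q.comp ρ))
  have hcomm : ∀ (g : Zb.comap q) (i : Fin r),
      (g : K) * ρ (FreeGroup.of i) * (g : K)⁻¹ * (ρ (FreeGroup.of i))⁻¹ ∈ N := by
    intro g i
    rw [← QuotientGroup.eq_one_iff]
    have h : q (ρ (FreeGroup.of i)) * q g = q g * q (ρ (FreeGroup.of i)) :=
      Subgroup.mem_centralizer_iff.mp g.2 _ ⟨FreeGroup.of i, rfl⟩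
    change q g * q (ρ (FreeGroup.of i)) * (q g)⁻¹ * (q (ρ (FreeGroup.of i)))⁻¹ = 1
    rw [← h, mul_inv_cancel_right, mul_inv_cancel]
  let f : Zb.comap q →* (Fin r → N) :=
    { toFun := fun g i => ⟨_, hcomm g i⟩
      map_one' := by
        funext i
        exact Subtype.ext (by simp)
      map_mul' := by
        intro g h
        funext i
        refine Subtype.ext ?_
        have hc := Subgroup.mem_center_iff.mp (hN (hcomm h i)) (g : K)
        have hc' := Subgroup.mem_center_iff.mp (hN (hcomm h i))
          ((g : K) * ρ (FreeGroup.of i) * (g : K)⁻¹ * (ρ (FreeGroup.of i))⁻¹)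
        change (g : K) * h * ρ (FreeGroup.of i) * ((g : K) * h)⁻¹ * (ρ (FreeGroup.of i))⁻¹ =
          ((g : K) * ρ (FreeGroup.of i) * (g : K)⁻¹ * (ρ (FreeGroup.of i))⁻¹) *
          ((h : K) * ρ (FreeGroup.of i) * (h : K)⁻¹ * (ρ (FreeGroup.of i))⁻¹)
        rw [hc']
        calc (g : K) * h * ρ (FreeGroup.of i) * ((g : K) * h)⁻¹ * (ρ (FreeGroup.of i))⁻¹
            = ((g : K) * ((h : K) * ρ (FreeGroup.of i) * (h : K)⁻¹ * (ρ (FreeGroup.of i))⁻¹)) *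
              (ρ (FreeGroup.of i) * (g : K)⁻¹ * (ρ (FreeGroup.of i))⁻¹) := by group
          _ = _ := by rw [hc]; group }
  have h1 : (Subgroup.centralizer (Set.range ρ)).relIndex (Zb.comap q) ≠ 0 := by
    have hker : f.ker ≤ (Subgroup.centralizer (Set.range ρ)).subgroupOf (Zb.comap q) := by
      intro g hg
      have hconj : (MulAut.conj (g : K)).toMonoidHom.comp ρ = ρ := by
        refine FreeGroup.ext_hom _ _ fun i => ?_
        have h := congrArg Subtype.val (congrFun (MonoidHom.mem_ker.mp hg) i)
        exact mul_inv_eq_one.mp h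
      refine Subgroup.mem_subgroupOf.mpr (Subgroup.mem_centralizer_iff.mpr ?_)
      rintro _ ⟨γ, rfl⟩
      have h : (g : K) * ρ γ * (g : K)⁻¹ = ρ γ := DFunLike.congr_fun hconj γ
      exact (mul_inv_eq_iff_eq_mul.mp h).symm
    have hfin := Subgroup.finiteIndex_of_le hker
    exact hfin.index_ne_zero
  have h2 : (Subgroup.center K).relIndex (Zb.comap q) ≠ 0 :=
    Subgroup.relIndex_ne_zero_trans hρ.index_ne_zero h1
  have h3 : Subgroup.center K ≤ (Subgroup.center (K ⧸ N)).comap q := by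
    intro g hg
    refine Subgroup.mem_center_iff.mpr fun x => ?_
    obtain ⟨y, rfl⟩ := QuotientGroup.mk'_surjective N x
    have h := congrArg q (Subgroup.mem_center_iff.mp hg y)
    simpa only [map_mul] using h
  have h4 : (Subgroup.center (K ⧸ N)).relIndex Zb ≠ 0 := by
    have h := Subgroup.relIndex_comap (Subgroup.center (K ⧸ N)) q (Zb.comap q)
    rw [Subgroup.map_comap_eq_self_of_surjective (QuotientGroup.mk'_surjective N)] at h
    rw [← h]
    exact fun h0 => h2 (Nat.eq_zero_of_zero_dvd (h0 ▸ Subgroup.relIndex_dvd_of_le_left _ h3))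
  exact ⟨h4⟩

/-! ### The groups `SU(n)`, `ℤ_n` and `PU(n)` -/

/-- The compact group `SU(n)`. -/
abbrev SU (n : ℕ) : Type := Matrix.specialUnitaryGroup (Fin n) ℂ

theorem scalar_mem_SU (n : ℕ) (ζ : rootsOfUnity n ℂ) :
    (((ζ : ℂˣ) : ℂ) • (1 : Matrix (Fin n) (Fin n) ℂ)) ∈ Matrix.specialUnitaryGroup (Fin n) ℂ := by
  rcases Nat.eq_zero_or_pos n with rfl | hn
  · have h : (((ζ : ℂˣ) : ℂ) • (1 : Matrix (Fin 0) (Fin 0) ℂ)) = 1 := Subsingleton.elim _ _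
    rw [h]
    exact one_mem _
  · have hζ : ((ζ : ℂˣ) : ℂ) ^ n = 1 := by
      have h := (mem_rootsOfUnity n (ζ : ℂˣ)).mp ζ.2
      simpa using congrArg Units.val h
    have hnorm : ‖((ζ : ℂˣ) : ℂ)‖ = 1 := Complex.norm_eq_one_of_pow_eq_one hζ hn.ne'
    rw [Matrix.mem_specialUnitaryGroup_iff, Matrix.mem_unitaryGroup_iff]
    refine ⟨?_, by simp [hζ]⟩
    rw [star_smul, star_one, smul_mul_smul_comm, one_mul]
    have : ((ζ : ℂˣ) : ℂ) * star ((ζ : ℂˣ) : ℂ) = 1 := by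
      rw [Complex.star_def, Complex.mul_conj, Complex.normSq_eq_norm_sq, hnorm]
      simp
    rw [this, one_smul]

/-- The embedding `ζ ↦ ζ • 1` of the group `ℤ_n` of `n`-th roots of unity in `SU(n)`; its image is
the center of `SU(n)`. -/
def scalarSU (n : ℕ) : rootsOfUnity n ℂ →* SU n where
  toFun ζ := ⟨((ζ : ℂˣ) : ℂ) • 1, scalar_mem_SU n ζ⟩
  map_one' := Subtype.ext (by simp)
  map_mul' a b := Subtype.ext (by simp [smul_smul, mul_comm])

theorem scalarSU_mem_center (n : ℕ) (ζ : rootsOfUnity n ℂ) :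
    scalarSU n ζ ∈ Subgroup.center (SU n) := by
  rw [Subgroup.mem_center_iff]
  intro g
  exact Subtype.ext (by simp [scalarSU])

instance scalarSU_range_normal (n : ℕ) : (scalarSU n).range.Normal where
  conj_mem := by
    rintro _ ⟨ζ, rfl⟩ g
    have h := Subgroup.mem_center_iff.mp (scalarSU_mem_center n ζ) g
    exact ⟨ζ, by rw [h, mul_inv_cancel_right]⟩

instance scalarSU_range_finite (n : ℕ) : Finite (scalarSU n).range := by
  rcases Nat.eq_zero_or_pos n with rfl | hn
  · infer_instance
  · have : NeZero n := ⟨hn.ne'⟩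
    exact Finite.of_surjective _ (scalarSU n).rangeRestrict_surjective

/-- `PU(n) = SU(n) / ℤ_n`, with the quotient topology. -/
abbrev PU (n : ℕ) : Type := SU n ⧸ (scalarSU n).range

/-- `SU_{r,n}^* = Hom^irr(F_r, SU(n))`. -/
abbrev IrrSU (r n : ℕ) : Type := IrrRep r (SU n)

/-- `PU_{r,n}^* = Hom^irr(F_r, PU(n))`. -/
abbrev IrrPU (r n : ℕ) : Type := IrrRep r (PU n)

/-- `C_{r,n} = Hom(F_r, ℤ_n)`, with pointwise multiplication. -/
abbrev CGroup (r n : ℕ) : Type := FreeGroup (Fin r) →* rootsOfUnity n ℂ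

/-- The action of `C_{r,n}` on `SU_{r,n}^*`: `(σ • ρ)(γ) = σ(γ) ρ(γ)`. -/
instance CGroup.mulAction (r n : ℕ) : MulAction (CGroup r n) (IrrSU r n) where
  smul σ ρ := ⟨twistRep ((scalarSU n).comp σ) ρ.1 fun _ => scalarSU_mem_center n _, ρ.2.twist _⟩
  one_smul ρ := Subtype.ext (MonoidHom.ext fun γ => by
    change scalarSU n 1 * ρ.1 γ = ρ.1 γ
    rw [map_one, one_mul])
  mul_smul σ τ ρ := Subtype.ext (MonoidHom.ext fun γ => by
    change scalarSU n (σ γ * τ γ) * ρ.1 γ = scalarSU n (σ γ) * (scalarSU n (τ γ) * ρ.1 γ)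
    rw [map_mul, mul_assoc])

instance CGroup.continuousConstSMul (r n : ℕ) :
    ContinuousConstSMul (CGroup r n) (IrrSU r n) where
  continuous_const_smul σ := by
    refine Continuous.subtype_mk (continuous_induced_rng.mpr (continuous_pi fun i => ?_)) _
    change Continuous fun ρ : IrrSU r n => scalarSU n (σ (FreeGroup.of i)) * ρ.1 (FreeGroup.of i)
    have h : Continuous fun ρ : IrrSU r n => ρ.1 (FreeGroup.of i) :=
      (continuous_pi_iff.mp (continuous_induced_dom (f := fun (ρ : FreeGroup (Fin r) →* SU n) i =>
        ρ (FreeGroup.of i))) i).comp continuous_subtype_val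
    exact continuous_const.mul h

/-- Each `σ ∈ C_{r,n}` acts on `SU_{r,n}^*` by a homeomorphism, in particular by a proper map. -/
theorem CGroup.isProperMap_smul {r n : ℕ} (σ : CGroup r n) :
    IsProperMap fun ρ : IrrSU r n => σ • ρ :=
  (Homeomorph.smul σ).isProperMap

/-- The natural map `SU_{r,n}^* → PU_{r,n}^*`, composition with `SU(n) → PU(n)`. -/
def projIrr (r n : ℕ) (ρ : IrrSU r n) : IrrPU r n :=
  ⟨(QuotientGroup.mk' (scalarSU n).range).comp ρ.1, ρ.2.mk _ <| by
    rintro _ ⟨ζ, rfl⟩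
    exact scalarSU_mem_center n ζ⟩

/-! ### Alexander–Spanier cochains of tuples of points -/

/-! A scalar root of unity lies in the connected group `SU(n)`, so on all of `SU(n)^r` the twist is
homotopic to the identity; such a homotopy, however, leaves the irreducible locus. The remedy is to
reach this locus from compact spaces on which a homotopy does exist. Let `P_t` (`pairSpace`) consist
of the pairs `(A, Q)` of a tuple `A` in `SU(n)^r` and an ordered orthogonal decomposition `Q` of
`ℂⁿ` into `t` nonzero `A`-invariant subspaces. For fixed `Q`, choose a rank one projection `e`
commuting with `Q`; multiplying the entries of `A` by `exp (i s θᵢ (1 - n e))` joins the identity to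
the twist inside the fibre over `Q`. So the twist is trivial on the cohomology of the fibres of `(A,
Q) ↦ Q` and, being of finite order, on that of `P_t` (`trivOn_pairSpace`).

The irreducible tuples form the open part of `P_1` where the decomposition is maximal. The open
parts of maximal decompositions of all `P_t` are treated by descending induction on `t`
(`trivOn_pairsGE_diff`). The complement is filtered by the number `v > t` of irreducible summands of
`A`. The stratum of `v` is the image of the triples `(A, R, f)`, where `R` is a maximal
decomposition into `v` parts and the surjection `f` groups these parts into `Q`. On the triples the
twist is trivial by induction; this descends to the stratum, and long exact sequences give the open
part.

The descent needs the fibres to look like points to permutation-invariant cochains. That is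
`acyclicOn_decomps`, an analogue of the rational acyclicity of `G / N(T)`: for a *-algebra `Z` of
matrices, the space of maximal decompositions is acyclic for invariant cochains. By induction on
`dim Z`, consider the pairs `(u, R)`, with `u` a special unitary in a noncommutative block of `Z`
and `R` a maximal decomposition commuting with `u`, as a space over the `u`. The fibres over
noncentral `u` are acyclic by induction. Some central `μ ≠ 1` acts trivially on the cohomology of
base and total space but carries the fibre over `1` to the one over `μ`; this forces classes of the
total space to vanish on the fibre over `1` (`FibreAction.exists_primitive_on_fibre`). This fibre is
the space of all maximal decompositions, and each of its classes extends by pull-back along `(u, R)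
↦ R`.

The common tool is a Leray or Vietoris–Begle principle
(`LocalComplex.exists_primitive_compact_support`): a complex over `X` with supports and cut-offs
which is exact on germs is exact with compact supports. It is applied to cochains without invariant
part and to cones of pull-backs. Coefficients in `ℂ` allow averaging over finite groups throughout.
The statement on `π` follows from the same principle, since its fibres are finite orbits and
`C_{r,n}` acts trivially upstairs. -/

namespace AlexanderSpanier

/-- Functions of `m` points of `X`. -/
abbrev Coch (X : Type) (m : ℕ) : Type := (Fin m → X) → ℂ

/-- The (augmented) Alexander–Spanier coboundary. -/
noncomputable def cobd {X : Type} {m : ℕ} : Coch X m →ₗ[ℂ] Coch X (m + 1) where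
  toFun φ := fun x => ∑ i : Fin (m + 1), (-1 : ℂ) ^ (i : ℕ) * φ (fun j => x (i.succAbove j))
  map_add' φ ψ := by
    funext x
    simp [mul_add, Finset.sum_add_distrib]
  map_smul' c φ := by
    funext x
    simp only [Pi.smul_apply, smul_eq_mul, RingHom.id_apply, Finset.mul_sum]
    exact Finset.sum_congr rfl fun i _ => by ring

theorem cobd_apply {X : Type} {m : ℕ} (φ : Coch X m) (x : Fin (m + 1) → X) :
    cobd φ x = ∑ i : Fin (m + 1), (-1 : ℂ) ^ (i : ℕ) * φ (fun j => x (i.succAbove j)) := rfl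

/-- Freezing the first point of a cochain. -/
def freeze {X : Type} {m : ℕ} (a : X) : Coch X (m + 1) →ₗ[ℂ] Coch X m where
  toFun φ := fun x => φ (Fin.cons a x)
  map_add' _ _ := rfl
  map_smul' _ _ := rfl

theorem freeze_apply {X : Type} {m : ℕ} (a : X) (φ : Coch X (m + 1)) (x : Fin m → X) :
    freeze a φ x = φ (Fin.cons a x) := rfl

/-- Pull-back of cochains. -/
def pull {X Y : Type} (f : X → Y) {m : ℕ} : Coch Y m →ₗ[ℂ] Coch X m where
  toFun φ := fun x => φ (f ∘ x)
  map_add' _ _ := rfl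
  map_smul' _ _ := rfl

theorem pull_apply {X Y : Type} (f : X → Y) {m : ℕ} (φ : Coch Y m) (x : Fin m → X) :
    pull f φ x = φ (f ∘ x) := rfl

theorem pull_pull {X Y Z : Type} (f : X → Y) (g : Y → Z) {m : ℕ} (φ : Coch Z m) :
    pull f (pull g φ) = pull (g ∘ f) φ := rfl

theorem pull_id {X : Type} {m : ℕ} (φ : Coch X m) : pull id φ = φ := rfl

theorem cobd_pull {X Y : Type} (f : X → Y) {m : ℕ} (φ : Coch Y m) :
    cobd (pull f φ) = pull f (cobd φ) := rfl

/-- The term omitting `a` is `φ x`; the others keep `a` in front, with the sign shifted by one. This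
recursion replaces the handling of signs in the later inductions on the number of points. -/
theorem cobd_cons {X : Type} {m : ℕ} (φ : Coch X (m + 1)) (a : X) (x : Fin (m + 1) → X) :
    cobd φ (Fin.cons a x) = φ x - cobd (freeze a φ) x := by
  rw [cobd_apply, Fin.sum_univ_succ, cobd_apply, sub_eq_add_neg, ← Finset.sum_neg_distrib]
  congr 1
  · simp
  · refine Finset.sum_congr rfl fun i _ => ?_
    have : (fun j => (Fin.cons a x : Fin (m + 2) → X) (i.succ.succAbove j)) =
        Fin.cons a (fun j => x (i.succAbove j)) := by
      funext j
      refine Fin.cases ?_ (fun j => ?_) j <;> simp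
    rw [this, freeze_apply, Fin.val_succ, pow_succ]
    ring

/-- Freezing a point is a contracting homotopy of the complex of all cochains. It respects vanishing
near `a`, hence also contracts germs at `a`. -/
theorem freeze_cobd {X : Type} {m : ℕ} (φ : Coch X (m + 1)) (a : X) :
    freeze a (cobd φ) = φ - cobd (freeze a φ) :=
  funext fun x => cobd_cons φ a x

theorem cobd_cobd {X : Type} {m : ℕ} (φ : Coch X m) : cobd (cobd φ) = 0 := by
  induction m with
  | zero =>
    funext x
    simp [cobd_apply, Fin.sum_univ_succ]
  | succ m ih =>
    funext x
    rw [← Fin.cons_self_tail x, cobd_cons, freeze_cobd, map_sub, ih]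
    simp

/-- The prism operator between the pull-backs by two functions. -/
def prism {X Y : Type} (g f : X → Y) : ∀ {m : ℕ}, Coch Y (m + 1) → Coch X m
  -- Unfolded, this is `∑ᵢ (-1)ⁱ ψ (g x₀, …, g xᵢ, f xᵢ, …, f x_m)`; the recursion splits off the
  -- term `i = 0`.
  | 0, _ => 0
  | _ + 1, ψ => fun x =>
      ψ (Fin.cons (g (x 0)) (Fin.cons (f (x 0)) (f ∘ Fin.tail x))) -
        prism g f (freeze (g (x 0)) ψ) (Fin.tail x)

theorem prism_cons {X Y : Type} (g f : X → Y) {m : ℕ} (ψ : Coch Y (m + 2)) (a : X)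
    (x : Fin m → X) : prism g f ψ (Fin.cons a x) =
      ψ (Fin.cons (g a) (Fin.cons (f a) (f ∘ x))) - prism g f (freeze (g a) ψ) x := rfl

theorem freeze_prism {X Y : Type} (g f : X → Y) {m : ℕ} (ψ : Coch Y (m + 2)) (a : X) :
    freeze a (prism g f ψ) =
      pull f (freeze (f a) (freeze (g a) ψ)) - prism g f (freeze (g a) ψ) := rfl

theorem prism_sub {X Y : Type} (g f : X → Y) {m : ℕ} (φ ψ : Coch Y (m + 1)) :
    prism g f (φ - ψ) = prism g f φ - prism g f ψ := by
  induction m with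
  | zero => simp [prism]
  | succ m ih =>
    funext x
    simp only [prism, map_sub, ih, Pi.sub_apply]
    ring

theorem comp_cons {X Y : Type} (f : X → Y) {m : ℕ} (a : X) (x : Fin m → X) :
    f ∘ (Fin.cons a x : Fin (m + 1) → X) = Fin.cons (f a) (f ∘ x) := by
  funext j
  refine Fin.cases ?_ (fun j => ?_) j <;> simp

/-- The chain homotopy formula, by induction through freezing the first point at `g a`. Neither
function has to be continuous, which is essential for nearest-point maps. -/
theorem cobd_prism_add {X Y : Type} (g f : X → Y) {m : ℕ} (ψ : Coch Y (m + 1)) :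
    cobd (prism g f ψ) + prism g f (cobd ψ) = pull f ψ - pull g ψ := by
  induction m with
  | zero =>
    funext x
    obtain ⟨a, y, rfl⟩ : ∃ a y, x = Fin.cons a y := ⟨x 0, Fin.tail x, (Fin.cons_self_tail x).symm⟩
    have h0 : cobd (prism g f ψ) = 0 := by
      change cobd (0 : Coch X 0) = 0
      simp
    rw [h0, zero_add, prism_cons]
    change cobd ψ _ - 0 = ψ _ - ψ _
    rw [sub_zero, cobd_cons, comp_cons, comp_cons]
    congr 1
    have h1 : (freeze (g a) ψ : Coch Y 0) = fun _ => ψ (Fin.cons (g a) (g ∘ y)) := by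
      funext z
      rw [freeze_apply]
      congr 2
      exact Subsingleton.elim _ _
    rw [h1, cobd_apply]
    simp
  | succ m ih =>
    funext x
    obtain ⟨a, y, rfl⟩ : ∃ a y, x = Fin.cons a y := ⟨x 0, Fin.tail x, (Fin.cons_self_tail x).symm⟩
    have key := congrFun (ih (freeze (g a) ψ)) y
    simp only [Pi.add_apply, Pi.sub_apply, pull_apply, freeze_apply] at key
    simp only [Pi.add_apply, Pi.sub_apply, pull_apply, comp_cons]
    rw [cobd_cons, freeze_prism, prism_cons, map_sub, freeze_cobd, prism_sub, cobd_pull]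
    simp only [cobd_cons, freeze_apply, Pi.sub_apply, pull_apply]
    linear_combination key

/-! ### Vanishing along a filter and cut-offs -/

/-- `φ` vanishes on the tuples of points of some member of `l`. -/
def Van {X : Type} {m : ℕ} (l : Filter X) (φ : Coch X m) : Prop :=
  ∃ U ∈ l, ∀ y : Fin m → X, (∀ i, y i ∈ U) → φ y = 0

section Van

variable {X Y : Type} {m : ℕ} {l l' : Filter X}

theorem Van.zero : Van l (0 : Coch X m) := ⟨Set.univ, Filter.univ_mem, fun _ _ => rfl⟩

theorem Van.add {φ ψ : Coch X m} (hφ : Van l φ) (hψ : Van l ψ) : Van l (φ + ψ) := by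
  obtain ⟨U, hU, h⟩ := hφ
  obtain ⟨V, hV, h'⟩ := hψ
  exact ⟨U ∩ V, Filter.inter_mem hU hV, fun y hy => by
    simp [h y fun i => (hy i).1, h' y fun i => (hy i).2]⟩

theorem Van.smul {φ : Coch X m} (c : ℂ) (hφ : Van l φ) : Van l (c • φ) := by
  obtain ⟨U, hU, h⟩ := hφ
  exact ⟨U, hU, fun y hy => by simp [h y hy]⟩

theorem Van.neg {φ : Coch X m} (hφ : Van l φ) : Van l (-φ) := by
  simpa using hφ.smul (-1)

theorem Van.sub {φ ψ : Coch X m} (hφ : Van l φ) (hψ : Van l ψ) : Van l (φ - ψ) := by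
  simpa [sub_eq_add_neg] using hφ.add hψ.neg

theorem Van.sum {ι : Type*} {s : Finset ι} {φ : ι → Coch X m} (h : ∀ i ∈ s, Van l (φ i)) :
    Van l (∑ i ∈ s, φ i) :=
  Finset.sum_induction _ (Van l) (fun _ _ => Van.add) Van.zero h

theorem Van.mono {φ : Coch X m} (hφ : Van l φ) (hl : l' ≤ l) : Van l' φ := by
  obtain ⟨U, hU, h⟩ := hφ
  exact ⟨U, hl hU, h⟩

theorem Van.cobd {φ : Coch X m} (hφ : Van l φ) : Van l (cobd φ) := by
  obtain ⟨U, hU, h⟩ := hφ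
  refine ⟨U, hU, fun y hy => ?_⟩
  rw [cobd_apply]
  exact Finset.sum_eq_zero fun i _ => by rw [h _ fun j => hy _, mul_zero]

theorem Van.pull {l' : Filter Y} {φ : Coch X m} (hφ : Van l φ) {f : Y → X}
    (hf : Filter.Tendsto f l' l) : Van l' (pull f φ) := by
  obtain ⟨U, hU, h⟩ := hφ
  exact ⟨f ⁻¹' U, hf hU, fun y hy => h _ hy⟩

theorem Van.freeze {a : X} {φ : Coch X (m + 1)} (hφ : Van l φ) (ha : ∀ U ∈ l, a ∈ U) :
    Van l (freeze a φ) := by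
  obtain ⟨U, hU, h⟩ := hφ
  refine ⟨U, hU, fun y hy => h _ fun i => ?_⟩
  refine Fin.cases ?_ (fun j => ?_) i
  · exact ha U hU
  · simpa using hy j

/-- The prism evaluates `ψ` only at tuples of points `g xᵢ` and `f xᵢ`, so it suffices that both
functions send `U` into one set on which `ψ` vanishes. -/
theorem prism_eq_zero {g f : X → Y} {U : Set X} {V : Set Y} (hg : Set.MapsTo g U V)
    (hf : Set.MapsTo f U V) {ψ : Coch Y (m + 1)} (hψ : ∀ y, (∀ i, y i ∈ V) → ψ y = 0)
    {x : Fin m → X} (hx : ∀ i, x i ∈ U) : prism g f ψ x = 0 := by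
  induction m with
  | zero => rfl
  | succ m ih =>
    obtain ⟨a, y, rfl⟩ : ∃ a y, x = Fin.cons a y := ⟨x 0, Fin.tail x, (Fin.cons_self_tail x).symm⟩
    have ha : a ∈ U := by simpa using hx 0
    have hy : ∀ i, y i ∈ U := fun i => by simpa using hx i.succ
    rw [prism_cons, ih _ hy, sub_zero]
    · refine hψ _ fun i => ?_
      refine Fin.cases (hg ha) (fun j => ?_) i
      refine Fin.cases (hf ha) (fun j => ?_) j
      simpa using hf (hy j)
    · intro z hz
      refine hψ _ fun i => ?_
      refine Fin.cases (hg ha) (fun j => ?_) i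
      simpa using hz j

end Van

open scoped Classical in
/-- Restricting a cochain to the tuples of points of `A`. -/
noncomputable def cut {X : Type} {m : ℕ} (A : Set X) : Coch X m →ₗ[ℂ] Coch X m where
  toFun φ := fun x => if ∀ i, x i ∈ A then φ x else 0
  map_add' φ ψ := by
    funext x
    by_cases h : ∀ i, x i ∈ A <;> simp [h]
  map_smul' c φ := by
    funext x
    by_cases h : ∀ i, x i ∈ A <;> simp [h]

theorem cut_of_mem {X : Type} {m : ℕ} {A : Set X} (φ : Coch X m) {x : Fin m → X}
    (h : ∀ i, x i ∈ A) : cut A φ x = φ x := if_pos h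

theorem cut_of_notMem {X : Type} {m : ℕ} {A : Set X} (φ : Coch X m) {x : Fin m → X}
    (h : ¬ ∀ i, x i ∈ A) : cut A φ x = 0 := if_neg h

theorem van_cut_sub {X : Type} {m : ℕ} {l : Filter X} {A : Set X} (hA : A ∈ l) (φ : Coch X m) :
    Van l (cut A φ - φ) :=
  ⟨A, hA, fun y hy => by rw [Pi.sub_apply, cut_of_mem φ hy, sub_self]⟩

/-- At least one point is needed: the empty tuple satisfies every membership condition, so `cut A`
is the identity on `Coch X 0`. -/
theorem van_cut {X : Type} {m : ℕ} {l : Filter X} {A : Set X} (hA : Aᶜ ∈ l)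
    (φ : Coch X (m + 1)) : Van l (cut A φ) :=
  ⟨Aᶜ, hA, fun _ hy => cut_of_notMem φ fun h => hy 0 (h 0)⟩

theorem Van.cut {X : Type} {m : ℕ} {l : Filter X} {φ : Coch X m} (hφ : Van l φ) (A : Set X) :
    Van l (cut A φ) := by
  obtain ⟨U, hU, h⟩ := hφ
  refine ⟨U, hU, fun y hy => ?_⟩
  by_cases hA : ∀ i, y i ∈ A
  · rw [cut_of_mem φ hA, h y hy]
  · exact cut_of_notMem φ hA

theorem pull_cut {X Y : Type} {m : ℕ} (f : X → Y) (A : Set Y) (φ : Coch Y m) :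
    pull f (cut A φ) = cut (f ⁻¹' A) (pull f φ) := rfl

end AlexanderSpanier

/-! ### From exact germs to primitives with compact support -/

namespace AlexanderSpanier

/-- A complex of abelian groups localized over a topological space: every element has a closed
support, and elements can be cut off along arbitrary subsets. -/
structure LocalComplex (X : Type) [TopologicalSpace X] where
  C : ℕ → Type
  [grp : ∀ k, AddCommGroup (C k)]
  d : ∀ {k}, C k →+ C (k + 1)
  van : ∀ {k}, C k → X → Prop
  cut : ∀ {k}, Set X → C k → C k
  van_zero : ∀ {k} x, van (0 : C k) x
  van_sub : ∀ {k} {b c : C k} {x}, van b x → van c x → van (b - c) x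
  van_open : ∀ {k} (c : C k), IsOpen {x | van c x}
  van_d : ∀ {k} {c : C k} {x}, van c x → van (d c) x
  van_d_d : ∀ {k} (c : C k) x, van (d (d c)) x
  van_cut : ∀ {k} {c : C k} {x} A, van c x → van (cut A c) x
  van_cut_sub : ∀ {k} (c : C k) {x A}, A ∈ 𝓝 x → van (cut A c - c) x
  van_cut_of_compl : ∀ {k} (c : C k) {x A}, Aᶜ ∈ 𝓝 x → van (cut A c) x
  -- Degree `k` stands for functions of `k` points, so the true complex starts at `k = 1`. Declaring
  -- degree `0` locally zero excludes the augmentation.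
  van_of_zero : ∀ (c : C 0) x, van c x

attribute [instance] LocalComplex.grp

namespace LocalComplex

variable {X : Type} [TopologicalSpace X] (S : LocalComplex X)

theorem van_neg {k} {c : S.C k} {x} (h : S.van c x) : S.van (-c) x := by
  simpa using S.van_sub (S.van_zero x) h

theorem van_add {k} {b c : S.C k} {x} (hb : S.van b x) (hc : S.van c x) : S.van (b + c) x := by
  simpa using S.van_sub hb (S.van_neg hc)

/-- Exactness of the complex of germs at `x`. -/
def ExactAt (x : X) : Prop :=
  ∀ k (c : S.C (k + 1)), S.van (S.d c) x → ∃ b : S.C k, S.van (c - S.d b) x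

variable {S}

theorem van_sub_d_congr {k} {c : S.C (k + 1)} {b b' : S.C k} {x} (h : S.van (b - b') x)
    (hb : S.van (c - S.d b) x) : S.van (c - S.d b') x := by
  have := S.van_add hb (S.van_d h)
  simpa using this

/-- Mayer–Vietoris gluing. The loci of `K₁` and `K₂` where `e = b₁ - b₂` does not vanish are
disjoint compact sets. Cutting `e` along a neighbourhood `U` of the first one makes `b₂ + cut U e`
agree with `b₁` near `K₁` and with `b₂` near `K₂`. -/
theorem exists_primitive_union [T2Space X] {k} {c : S.C (k + 1)} {K₁ K₂ : Set X}
    (hK₁ : IsCompact K₁) (hK₂ : IsCompact K₂) {b₁ b₂ : S.C k}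
    (h₁ : ∀ x ∈ K₁, S.van (c - S.d b₁) x) (h₂ : ∀ x ∈ K₂, S.van (c - S.d b₂) x)
    (h : ∀ x ∈ K₁ ∩ K₂, S.van (b₁ - b₂) x) :
    ∃ b : S.C k, ∀ x ∈ K₁ ∪ K₂, S.van (c - S.d b) x := by
  set N := {x | S.van (b₁ - b₂) x} with hNdef
  have hN : IsOpen N := S.van_open _
  have hdisj : Disjoint (K₁ \ N) (K₂ \ N) :=
    Set.disjoint_left.mpr fun x hx hx' => hx.2 (h x ⟨hx.1, hx'.1⟩)
  obtain ⟨U, V, hU, hV, hKU, hKV, hUV⟩ :=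
    SeparatedNhds.of_isCompact_isCompact (hK₁.diff hN) (hK₂.diff hN) hdisj
  set e := b₁ - b₂
  have hb₁ : ∀ x, S.van (S.cut U e - e) x → S.van (b₁ - (b₂ + S.cut U e)) x := fun x hx => by
    have := S.van_neg hx
    rwa [show b₁ - (b₂ + S.cut U e) = -(S.cut U e - e) by simp only [e]; abel]
  have hb₂ : ∀ x, S.van (S.cut U e) x → S.van (b₂ - (b₂ + S.cut U e)) x := fun x hx => by
    have := S.van_neg hx
    rwa [show b₂ - (b₂ + S.cut U e) = -S.cut U e by abel]
  refine ⟨b₂ + S.cut U e, fun x hx => ?_⟩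
  by_cases hxN : x ∈ N
  · have hcut : S.van (S.cut U e) x := S.van_cut U hxN
    rcases hx with hx | hx
    · exact van_sub_d_congr (hb₁ x (S.van_sub hcut hxN)) (h₁ x hx)
    · exact van_sub_d_congr (hb₂ x hcut) (h₂ x hx)
  · rcases hx with hx | hx
    · exact van_sub_d_congr (hb₁ x (S.van_cut_sub e (hU.mem_nhds (hKU ⟨hx, hxN⟩)))) (h₁ x hx)
    · refine van_sub_d_congr (hb₂ x (S.van_cut_of_compl e ?_)) (h₂ x hx)
      exact Filter.mem_of_superset (hV.mem_nhds (hKV ⟨hx, hxN⟩))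
        (Set.disjoint_left.mp hUV.symm)

/-- A local complex that is exact at the points of an open set is exact near its compact subsets. -/
theorem exists_primitive_near_isCompact [T2Space X] [LocallyCompactSpace X] {O : Set X}
    (hO : ∀ x ∈ O, S.ExactAt x) {k} (c : S.C (k + 1)) {K : Set X} (hK : IsCompact K)
    (hKO : K ⊆ O) (hc : ∀ x ∈ K, S.van (S.d c) x) : ∃ b : S.C k, ∀ x ∈ K, S.van (c - S.d b) x := by
  induction k generalizing K with
  | zero =>
    -- Compact induction on `s` is run with `K ∩ closure s`, so that the pieces to be glued are
    -- compact.
    suffices h : ∃ b : S.C 0, ∀ x ∈ K ∩ closure K, S.van (c - S.d b) x by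
      simpa [Set.inter_eq_left.mpr subset_closure] using h
    refine hK.induction_on (p := fun s => ∃ b : S.C 0, ∀ x ∈ K ∩ closure s, S.van (c - S.d b) x)
      ⟨0, by simp⟩ (fun s t hst ⟨b, hb⟩ => ⟨b, fun x hx => hb x ⟨hx.1, closure_mono hst hx.2⟩⟩) ?_ ?_
    · rintro s t ⟨b₁, h₁⟩ ⟨b₂, h₂⟩
      rw [closure_union, Set.inter_union_distrib_left]
      exact exists_primitive_union (hK.inter_right isClosed_closure)
        (hK.inter_right isClosed_closure) h₁ h₂ fun x _ => S.van_of_zero _ x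
    · intro x hx
      obtain ⟨b, hb⟩ := hO x (hKO hx) 0 c (hc x hx)
      obtain ⟨t, ht, htc, hts⟩ := exists_mem_nhds_isClosed_subset ((S.van_open _).mem_nhds hb)
      exact ⟨t, mem_nhdsWithin_of_mem_nhds ht, b, fun y hy => hts (htc.closure_eq ▸ hy.2)⟩
  | succ k ih =>
    suffices h : ∃ b : S.C (k + 1), ∀ x ∈ K ∩ closure K, S.van (c - S.d b) x by
      simpa [Set.inter_eq_left.mpr subset_closure] using h
    refine hK.induction_on
      (p := fun s => ∃ b : S.C (k + 1), ∀ x ∈ K ∩ closure s, S.van (c - S.d b) x)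
      ⟨0, by simp⟩ (fun s t hst ⟨b, hb⟩ => ⟨b, fun x hx => hb x ⟨hx.1, closure_mono hst hx.2⟩⟩) ?_ ?_
    · rintro s t ⟨b₁, h₁⟩ ⟨b₂, h₂⟩
      rw [closure_union, Set.inter_union_distrib_left]
      have hs := hK.inter_right (isClosed_closure (s := s))
      have ht := hK.inter_right (isClosed_closure (s := t))
      -- The two primitives differ by a cocycle near the overlap. One degree lower it is `d a`
      -- there, and `b₂ + d a` agrees with `b₁` near the overlap.
      obtain ⟨a, ha⟩ := ih (b₁ - b₂) (hs.inter ht) (fun x hx => hKO hx.1.1) (fun x hx => by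
        have := S.van_sub (h₂ x hx.2) (h₁ x hx.1)
        rwa [sub_sub_sub_cancel_left, ← map_sub] at this)
      refine exists_primitive_union (b₂ := b₂ + S.d a) hs ht h₁ (fun x hx => ?_) fun x hx => ?_
      · have := S.van_sub (h₂ x hx) (S.van_d_d a x)
        rwa [map_add, ← sub_sub]
      · have := ha x hx
        rwa [sub_add_eq_sub_sub]
    · intro x hx
      obtain ⟨b, hb⟩ := hO x (hKO hx) (k + 1) c (hc x hx)
      obtain ⟨t, ht, htc, hts⟩ := exists_mem_nhds_isClosed_subset ((S.van_open _).mem_nhds hb)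
      exact ⟨t, mem_nhdsWithin_of_mem_nhds ht, b, fun y hy => hts (htc.closure_eq ▸ hy.2)⟩

/-- A cocycle with compact support in an open set on which the complex is locally exact has a
primitive with compact support in this open set. -/
theorem exists_primitive_compact_support [T2Space X] [LocallyCompactSpace X] {O : Set X}
    (hOo : IsOpen O) (hO : ∀ x ∈ O, S.ExactAt x) {k} (c : S.C (k + 1)) {K : Set X}
    (hK : IsCompact K) (hKO : K ⊆ O) (hcK : ∀ x ∉ K, S.van c x) (hc : ∀ x ∈ O, S.van (S.d c) x) :
    ∃ b : S.C k, (∃ L ⊆ O, IsCompact L ∧ ∀ x ∉ L, S.van b x) ∧ ∀ x, S.van (c - S.d b) x := by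
  obtain ⟨L, hL, hKL, hLO⟩ := exists_compact_between hK hOo hKO
  obtain ⟨b, hb⟩ := exists_primitive_near_isCompact hO c hL hLO fun x hx => hc x (hLO hx)
  -- The primitive is made to vanish near the frontier of `L`: there `c` vanishes, so `b` is a
  -- cocycle, hence of the form `d a`, and `d a` is subtracted. Then cutting along `L` creates no
  -- new boundary term.
  obtain ⟨b', hb', hfr⟩ : ∃ b' : S.C k, (∀ x ∈ L, S.van (c - S.d b') x) ∧
      ∀ x ∈ frontier L, S.van b' x := by
    cases k with
    | zero => exact ⟨b, hb, fun x _ => S.van_of_zero _ x⟩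
    | succ k =>
      have hfL : frontier L ⊆ L := hL.isClosed.frontier_subset
      obtain ⟨a, ha⟩ := exists_primitive_near_isCompact hO b (hL.of_isClosed_subset
        isClosed_frontier hfL) (hfL.trans hLO) fun x hx => by
          have h := S.van_sub (hcK x fun hxK => hx.2 (hKL hxK)) (hb x (hfL hx))
          rwa [sub_sub_cancel] at h
      refine ⟨b - S.d a, fun x hx => ?_, ha⟩
      have h := S.van_add (hb x hx) (S.van_d_d a x)
      rwa [map_sub, ← sub_add]
  refine ⟨S.cut L b', ⟨L, hLO, hL, fun x hx =>
    S.van_cut_of_compl _ (hL.isClosed.isOpen_compl.mem_nhds hx)⟩, fun x => ?_⟩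
  by_cases hxL : x ∈ L
  · by_cases hxi : x ∈ interior L
    · refine van_sub_d_congr ?_ (hb' x hxL)
      have h := S.van_neg (S.van_cut_sub b' (mem_interior_iff_mem_nhds.mp hxi))
      rwa [neg_sub] at h
    · have hx : x ∈ frontier L := ⟨subset_closure hxL, hxi⟩
      exact S.van_sub (hcK x fun hxK => hxi (hKL hxK)) (S.van_d (S.van_cut L (hfr x hx)))
  · exact S.van_sub (hcK x fun hxK => hxL (interior_subset (hKL hxK)))
      (S.van_d (S.van_cut_of_compl _ (hL.isClosed.isOpen_compl.mem_nhds hxL)))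

end LocalComplex
end AlexanderSpanier

/-! ### Cohomology with compact supports of subspaces -/

namespace AlexanderSpanier

variable {X Y : Type} [TopologicalSpace X] [TopologicalSpace Y]

/-- The cochain vanishes near the diagonal of `S`. -/
def LocZero {m : ℕ} (S : Set Y) (c : Coch Y m) : Prop := ∀ y ∈ S, Van (𝓝[S] y) c

/-- The cochain has compact support in `S`. -/
def CSupp {m : ℕ} (S : Set Y) (c : Coch Y m) : Prop :=
  ∃ K ⊆ S, IsCompact K ∧ ∀ y ∈ S, y ∉ K → Van (𝓝[S] y) c

/-- The cochain is, up to cochains vanishing near the diagonal, the coboundary of a cochain with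
compact support in `S`. -/
def ExactOn {m : ℕ} (S : Set Y) (c : Coch Y (m + 1)) : Prop :=
  -- The clause for `m = 0` removes the augmentation: a cochain of one point is exact only if it is
  -- locally zero.
  ∃ b : Coch Y m, (m = 0 → b = 0) ∧ CSupp S b ∧ LocZero S (c - cobd b)

/-- `σ` acts trivially on the cohomology with compact supports of `S`. -/
def TrivOn (σ : Y → Y) (S : Set Y) : Prop :=
  ∀ (m : ℕ) (c : Coch Y (m + 1)), LocZero S (cobd c) → CSupp S c → ExactOn S (c - pull σ c)

section Basic

variable {m : ℕ} {S : Set Y}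

theorem LocZero.zero : LocZero S (0 : Coch Y m) := fun _ _ => Van.zero

theorem LocZero.add {φ ψ : Coch Y m} (hφ : LocZero S φ) (hψ : LocZero S ψ) : LocZero S (φ + ψ) :=
  fun y hy => (hφ y hy).add (hψ y hy)

theorem LocZero.sub {φ ψ : Coch Y m} (hφ : LocZero S φ) (hψ : LocZero S ψ) : LocZero S (φ - ψ) :=
  fun y hy => (hφ y hy).sub (hψ y hy)

theorem LocZero.smul {φ : Coch Y m} (a : ℂ) (hφ : LocZero S φ) : LocZero S (a • φ) :=
  fun y hy => (hφ y hy).smul a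

theorem LocZero.cobd {φ : Coch Y m} (hφ : LocZero S φ) : LocZero S (cobd φ) :=
  fun y hy => (hφ y hy).cobd

theorem LocZero.mono {φ : Coch Y m} {T : Set Y} (hφ : LocZero S φ) (hT : T ⊆ S) : LocZero T φ :=
  fun y hy => (hφ y (hT hy)).mono (nhdsWithin_mono y hT)

theorem tendsto_nhdsWithin_of_mapsTo {f : X → Y} {A : Set X} {B : Set Y} (hf : ContinuousOn f A)
    (hAB : Set.MapsTo f A B) {x : X} (hx : x ∈ A) : Filter.Tendsto f (𝓝[A] x) (𝓝[B] (f x)) :=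
  (hf x hx).tendsto_nhdsWithin hAB

theorem LocZero.pull {φ : Coch Y m} (hφ : LocZero S φ) {f : X → Y} {A : Set X}
    (hf : ContinuousOn f A) (hAS : Set.MapsTo f A S) : LocZero A (pull f φ) :=
  fun x hx => (hφ (f x) (hAS hx)).pull (tendsto_nhdsWithin_of_mapsTo hf hAS hx)

theorem CSupp.zero : CSupp S (0 : Coch Y m) :=
  ⟨∅, Set.empty_subset _, isCompact_empty, fun _ _ _ => Van.zero⟩

theorem CSupp.add {φ ψ : Coch Y m} (hφ : CSupp S φ) (hψ : CSupp S ψ) : CSupp S (φ + ψ) := by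
  obtain ⟨K, hKS, hK, h⟩ := hφ
  obtain ⟨L, hLS, hL, h'⟩ := hψ
  exact ⟨K ∪ L, Set.union_subset hKS hLS, hK.union hL, fun y hy hyKL =>
    (h y hy fun hyK => hyKL (Or.inl hyK)).add (h' y hy fun hyL => hyKL (Or.inr hyL))⟩

theorem CSupp.smul {φ : Coch Y m} (a : ℂ) (hφ : CSupp S φ) : CSupp S (a • φ) := by
  obtain ⟨K, hKS, hK, h⟩ := hφ
  exact ⟨K, hKS, hK, fun y hy hyK => (h y hy hyK).smul a⟩

theorem CSupp.sub {φ ψ : Coch Y m} (hφ : CSupp S φ) (hψ : CSupp S ψ) : CSupp S (φ - ψ) := by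
  simpa [sub_eq_add_neg] using hφ.add (hψ.smul (-1))

theorem CSupp.sum {ι : Type*} {s : Finset ι} {φ : ι → Coch Y m} (h : ∀ i ∈ s, CSupp S (φ i)) :
    CSupp S (∑ i ∈ s, φ i) :=
  Finset.sum_induction _ (CSupp S) (fun _ _ => CSupp.add) CSupp.zero h

theorem CSupp.of_isCompact (hS : IsCompact S) (φ : Coch Y m) : CSupp S φ :=
  ⟨S, subset_rfl, hS, fun _ hy hy' => absurd hy hy'⟩

theorem CSupp.pull {φ : Coch Y m} (hφ : CSupp S φ) {f : X → Y} {A : Set X}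
    (hf : ContinuousOn f A) (hAS : Set.MapsTo f A S)
    (hproper : ∀ K ⊆ S, IsCompact K → IsCompact (A ∩ f ⁻¹' K)) : CSupp A (pull f φ) := by
  obtain ⟨K, hKS, hK, h⟩ := hφ
  exact ⟨A ∩ f ⁻¹' K, Set.inter_subset_left, hproper K hKS hK, fun x hx hxK =>
    (h (f x) (hAS hx) fun hfx => hxK ⟨hx, hfx⟩).pull (tendsto_nhdsWithin_of_mapsTo hf hAS hx)⟩

theorem ExactOn.zero : ExactOn S (0 : Coch Y (m + 1)) :=
  ⟨0, fun _ => rfl, CSupp.zero, by simpa using LocZero.zero⟩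

theorem ExactOn.of_locZero {φ : Coch Y (m + 1)} (hφ : LocZero S φ) : ExactOn S φ :=
  ⟨0, fun _ => rfl, CSupp.zero, by simpa using hφ⟩

theorem ExactOn.add {φ ψ : Coch Y (m + 1)} (hφ : ExactOn S φ) (hψ : ExactOn S ψ) :
    ExactOn S (φ + ψ) := by
  obtain ⟨a, ha, ha', h⟩ := hφ
  obtain ⟨b, hb, hb', h'⟩ := hψ
  refine ⟨a + b, fun hm => by rw [ha hm, hb hm, add_zero], ha'.add hb', ?_⟩
  rw [map_add, add_sub_add_comm]
  exact h.add h'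

theorem ExactOn.smul {φ : Coch Y (m + 1)} (a : ℂ) (hφ : ExactOn S φ) : ExactOn S (a • φ) := by
  obtain ⟨b, hb, hb', h⟩ := hφ
  refine ⟨a • b, fun hm => by rw [hb hm, smul_zero], hb'.smul a, ?_⟩
  rw [map_smul, ← smul_sub]
  exact h.smul a

theorem ExactOn.sum {ι : Type*} {s : Finset ι} {φ : ι → Coch Y (m + 1)}
    (h : ∀ i ∈ s, ExactOn S (φ i)) : ExactOn S (∑ i ∈ s, φ i) :=
  Finset.sum_induction _ (ExactOn S) (fun _ _ => ExactOn.add) ExactOn.zero h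

end Basic

/-! ### Averaging over a cyclic group -/

section Cyclic

variable {m N : ℕ} {σ : Y → Y} {S : Set Y}

/-- The sum of the pull-backs by the first `N` iterates of `σ`. -/
noncomputable def cycSum (σ : Y → Y) (N : ℕ) : Coch Y m →ₗ[ℂ] Coch Y m :=
  ∑ j ∈ Finset.range N, pull (σ^[j])

omit [TopologicalSpace Y] in
theorem cycSum_apply (c : Coch Y m) : cycSum σ N c = ∑ j ∈ Finset.range N, pull (σ^[j]) c := by
  simp [cycSum]

omit [TopologicalSpace Y] in
theorem cobd_cycSum (c : Coch Y m) : cobd (cycSum σ N c) = cycSum σ N (cobd c) := by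
  simp [cycSum_apply, cobd_pull]

omit [TopologicalSpace Y] in
theorem cycSum_pull (hσN : σ^[N] = id) (c : Coch Y m) : cycSum σ N (pull σ c) = cycSum σ N c := by
  rw [cycSum_apply, cycSum_apply]
  simp only [pull_pull, ← Function.iterate_succ']
  have h := Finset.sum_range_succ' (fun j => pull (σ^[j]) c) N
  rw [Finset.sum_range_succ, hσN] at h
  exact (add_right_cancel h).symm

omit [TopologicalSpace Y] in
theorem pull_cycSum (hσN : σ^[N] = id) (c : Coch Y m) : pull σ (cycSum σ N c) = cycSum σ N c := by
  conv_rhs => rw [← cycSum_pull hσN c]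
  rw [cycSum_apply, cycSum_apply, map_sum]
  refine Finset.sum_congr rfl fun j _ => ?_
  rw [pull_pull, pull_pull, ← Function.iterate_succ, ← Function.iterate_succ']

omit [TopologicalSpace Y] in
theorem cycSum_cycSum (hσN : σ^[N] = id) (c : Coch Y m) :
    cycSum σ N (cycSum σ N c) = (N : ℂ) • cycSum σ N c := by
  have h : ∀ j : ℕ, pull (σ^[j]) (cycSum σ N c) = cycSum σ N c := by
    intro j
    induction j with
    | zero => rfl
    | succ j ih => rw [Function.iterate_succ, ← pull_pull, ih, pull_cycSum hσN]
  rw [cycSum_apply (cycSum σ N c)]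
  simp [h, Nat.cast_smul_eq_nsmul]

/-- The complement of the invariant part of a cochain. -/
noncomputable def cycProj (σ : Y → Y) (N : ℕ) : Coch Y m →ₗ[ℂ] Coch Y m :=
  LinearMap.id - (N : ℂ)⁻¹ • cycSum σ N

omit [TopologicalSpace Y] in
theorem cycProj_apply (c : Coch Y m) : cycProj σ N c = c - (N : ℂ)⁻¹ • cycSum σ N c := rfl

omit [TopologicalSpace Y] in
theorem cobd_cycProj (c : Coch Y m) : cobd (cycProj σ N c) = cycProj σ N (cobd c) := by
  simp [cycProj_apply, cobd_cycSum]

omit [TopologicalSpace Y] in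
theorem cycSum_cycProj (hN : N ≠ 0) (hσN : σ^[N] = id) (c : Coch Y m) :
    cycSum σ N (cycProj σ N c) = 0 := by
  rw [cycProj_apply, map_sub, map_smul, cycSum_cycSum hσN, smul_smul,
    inv_mul_cancel₀ (Nat.cast_ne_zero.mpr hN), one_smul, sub_self]

omit [TopologicalSpace Y] in
theorem cycProj_of_cycSum_eq_zero {c : Coch Y m} (hc : cycSum σ N c = 0) : cycProj σ N c = c := by
  rw [cycProj_apply, hc, smul_zero, sub_zero]

theorem CSupp.pull_iterate {c : Coch Y m} (hc : CSupp S c) (hσ : Continuous σ) (hN : N ≠ 0)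
    (hσN : σ^[N] = id) (hS : Set.MapsTo σ S S) : CSupp S (AlexanderSpanier.pull σ c) := by
  refine hc.pull hσ.continuousOn hS fun K hKS hK => ?_
  have hinv : Function.RightInverse (σ^[N - 1]) σ ∧ Function.LeftInverse (σ^[N - 1]) σ := by
    constructor
    · intro x
      rw [← Function.iterate_succ_apply' σ (N - 1) x, Nat.succ_eq_add_one, Nat.sub_add_cancel
        (Nat.one_le_iff_ne_zero.mpr hN), hσN, id]
    · intro x
      rw [← Function.iterate_succ_apply σ (N - 1) x, Nat.succ_eq_add_one, Nat.sub_add_cancel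
        (Nat.one_le_iff_ne_zero.mpr hN), hσN, id]
  have hpre : S ∩ σ ⁻¹' K = σ^[N - 1] '' K := by
    ext x
    constructor
    · rintro ⟨-, hx⟩
      exact ⟨σ x, hx, hinv.2 x⟩
    · rintro ⟨y, hy, rfl⟩
      refine ⟨hS.iterate _ (hKS hy), ?_⟩
      change σ (σ^[N - 1] y) ∈ K
      rwa [hinv.1 y]
  rw [hpre]
  exact hK.image (hσ.iterate _)

theorem TrivOn.exactOn_sub_iterate (h : TrivOn σ S) (hσ : Continuous σ) (hN : N ≠ 0)
    (hσN : σ^[N] = id) (hS : Set.MapsTo σ S S) {c : Coch Y (m + 1)} (hc : LocZero S (cobd c))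
    (hcs : CSupp S c) (j : ℕ) : ExactOn S (c - pull (σ^[j]) c) ∧ CSupp S (pull (σ^[j]) c) := by
  induction j with
  | zero => exact ⟨by simpa [pull_id] using ExactOn.zero, hcs⟩
  | succ j ih =>
    have hcj : LocZero S (cobd (pull (σ^[j]) c)) := by
      rw [cobd_pull]
      exact hc.pull (hσ.iterate j).continuousOn (hS.iterate j)
    have heq : pull (σ^[j + 1]) c = pull σ (pull (σ^[j]) c) := by
      rw [pull_pull, Function.iterate_succ]
    refine ⟨?_, heq ▸ ih.2.pull_iterate hσ hN hσN hS⟩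
    have := ih.1.add (h m _ hcj ih.2)
    rwa [sub_add_sub_cancel, ← heq] at this

/-- If `σ` acts trivially on cohomology, cocycles without invariant part are exact. -/
theorem TrivOn.exactOn (h : TrivOn σ S) (hσ : Continuous σ) (hN : N ≠ 0) (hσN : σ^[N] = id)
    (hS : Set.MapsTo σ S S) {c : Coch Y (m + 1)} (hc : LocZero S (cobd c)) (hcs : CSupp S c)
    (hc0 : cycSum σ N c = 0) : ExactOn S c := by
  have hsum : ExactOn S (∑ j ∈ Finset.range N, (c - pull (σ^[j]) c)) :=
    ExactOn.sum fun j _ => (h.exactOn_sub_iterate hσ hN hσN hS hc hcs j).1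
  -- As the cyclic sum of `c` vanishes, `c` is the mean of the differences `c - (σ^j)^* c`, each of
  -- which is exact.
  have heq : (N : ℂ)⁻¹ • ∑ j ∈ Finset.range N, (c - pull (σ^[j]) c) = c := by
    rw [Finset.sum_sub_distrib, ← cycSum_apply, hc0, sub_zero, Finset.sum_const, Finset.card_range,
      ← Nat.cast_smul_eq_nsmul ℂ, smul_smul, inv_mul_cancel₀ (Nat.cast_ne_zero.mpr hN), one_smul]
  exact heq ▸ hsum.smul _

theorem Van.cycProj {c : Coch Y m} (hσ : Continuous σ) (hS : Set.MapsTo σ S S) {y : Y} (hy : y ∈ S)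
    (hc : ∀ j : ℕ, Van (𝓝[S] (σ^[j] y)) c) : Van (𝓝[S] y) (cycProj σ N c) := by
  rw [cycProj_apply, cycSum_apply]
  refine (hc 0).sub (Van.smul _ (Van.sum fun j _ => ?_))
  exact (hc j).pull (tendsto_nhdsWithin_of_mapsTo (hσ.iterate j).continuousOn (hS.iterate j) hy)

end Cyclic

/-! ### Tautness of compact subsets -/

section Taut

open Set

/-- A cocycle near a compact set is exact near it if its restriction is exact. -/
theorem exists_primitive_near [TopologicalSpace.MetrizableSpace Y] {B F : Set Y} (hF : IsCompact F)
    (hFB : F ⊆ B) {m : ℕ} {ψ : Coch Y (m + 1)} (hψ : ∀ y ∈ F, Van (𝓝[B] y) (cobd ψ))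
    {θ : Coch Y m} (hθ : LocZero F (ψ - cobd θ)) :
    ∃ θ' : Coch Y m, (m = 0 → θ = 0 → θ' = 0) ∧ ∀ y ∈ F, Van (𝓝[B] y) (ψ - cobd θ') := by
  rcases F.eq_empty_or_nonempty with rfl | hne
  · exact ⟨0, fun _ _ => rfl, fun y hy => absurd hy (notMem_empty y)⟩
  let := TopologicalSpace.metrizableSpaceMetric Y
  -- A nearest-point map onto `F`. It need not be continuous, but `dist (f y) y₀ ≤ 2 * dist y y₀`
  -- for `y₀ ∈ F` makes it continuous at the points of `F`, which is all that germs along `F` see.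
  choose f hfF hf using fun y : Y => hF.exists_infDist_eq_dist hne y
  have hdist : ∀ y₀ ∈ F, ∀ y, dist (f y) y₀ ≤ 2 * dist y y₀ := fun y₀ hy₀ y => by
    have h1 := Metric.infDist_le_dist_of_mem (x := y) hy₀
    have h2 := dist_triangle (f y) y y₀
    rw [dist_comm (f y) y, ← hf y] at h2
    linarith
  have hfix : ∀ y₀ ∈ F, f y₀ = y₀ := fun y₀ hy₀ => by
    have := hdist y₀ hy₀ y₀
    rw [dist_self, mul_zero] at this
    exact dist_le_zero.mp this
  have hball : ∀ y₀ ∈ F, ∀ ε, ∀ y ∈ Metric.ball y₀ (ε / 2), f y ∈ Metric.ball y₀ ε :=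
    fun y₀ hy₀ ε y hy => by
      have := hdist y₀ hy₀ y
      rw [Metric.mem_ball] at hy ⊢
      linarith
  -- The prism compares `ψ` with `f^* ψ`, and the latter only depends on the restriction of `ψ` to
  -- `F`, where `θ` is a primitive.
  refine ⟨pull f θ - prism id f ψ, ?_, fun y₀ hy₀ => ?_⟩
  · rintro rfl rfl
    rw [map_zero, zero_sub, neg_eq_zero]
    rfl
  have heq : ψ - cobd (pull f θ - prism id f ψ) =
      pull f (ψ - cobd θ) - prism id f (cobd ψ) := by
    have := cobd_prism_add id f ψ
    rw [pull_id] at this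
    rw [map_sub, cobd_pull, map_sub, ← sub_eq_iff_eq_add.mpr (this.symm.trans (add_comm _ _))]
    abel
  rw [heq]
  refine Van.sub ((hθ y₀ hy₀).pull ?_) ?_
  · refine tendsto_nhdsWithin_iff.mpr ⟨?_, Filter.Eventually.of_forall hfF⟩
    refine (Metric.tendsto_nhds.mpr fun ε hε => ?_).mono_left nhdsWithin_le_nhds
    filter_upwards [Metric.ball_mem_nhds y₀ (half_pos hε)] with y hy using hball y₀ hy₀ ε y hy
  · obtain ⟨U, hU, h⟩ := hψ y₀ hy₀
    obtain ⟨ε, hε, hεU⟩ := Metric.mem_nhdsWithin_iff.mp hU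
    refine ⟨Metric.ball y₀ (ε / 2) ∩ B, ?_, fun x hx => ?_⟩
    · exact Filter.inter_mem (mem_nhdsWithin_of_mem_nhds (Metric.ball_mem_nhds y₀ (half_pos hε)))
        self_mem_nhdsWithin
    · refine prism_eq_zero (fun y hy => ?_) (fun y hy => ?_) h hx
      · exact hεU ⟨Metric.ball_subset_ball (half_le_self hε.le) hy.1, hy.2⟩
      · exact hεU ⟨hball y₀ hy₀ ε y hy.1, hFB (hfF y)⟩

end Taut

/-! ### Homotopy invariance -/

section Homotopy

open Set

/-- A map of a compact set that is homotopic to the identity acts trivially on cohomology. -/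
theorem TrivOn.of_homotopy {F : Set Y} (hF : IsCompact F) {σ : Y → Y} (H : ℝ → Y → Y)
    (hH : Continuous fun p : ℝ × Y => H p.1 p.2) (hHF : ∀ s, MapsTo (H s) F F)
    (h0 : ∀ y, H 0 y = y) (h1 : ∀ y, H 1 y = σ y) : TrivOn σ F := by
  intro m c hc _
  have hloc : ∀ s, ∀ᶠ t in 𝓝 s, ExactOn F (pull (H s) c - pull (H t) c) := by
    intro s
    -- For `t` near `s`, both `H s` and `H t` send small tuples into one small set, where `cobd c`
    -- vanishes. Compactness of `F` makes the range of `t` uniform.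
    have key : ∀ᶠ t in 𝓝 s, ∀ y ∈ F, y ∈ F → Van (𝓝[F] y) (prism (H t) (H s) (cobd c)) := by
      refine hF.eventually_forall_of_forall_eventually fun y hy => ?_
      obtain ⟨V, hV, h⟩ := hc (H s y) (hHF s hy)
      obtain ⟨V', hV'o, hyV', hV'V⟩ := mem_nhdsWithin.mp hV
      have hpre : (fun p : ℝ × Y => H p.1 p.2) ⁻¹' V' ∈ 𝓝 (s, y) :=
        hH.continuousAt.preimage_mem_nhds (hV'o.mem_nhds hyV')
      obtain ⟨N, hN, U, hU, hNU⟩ := mem_nhds_prod_iff.mp hpre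
      obtain ⟨U', hU'U, hU'o, hyU'⟩ := mem_nhds_iff.mp hU
      filter_upwards [prod_mem_nhds hN (hU'o.mem_nhds hyU')] with p hp hpF
      refine ⟨U' ∩ F, Filter.inter_mem (mem_nhdsWithin_of_mem_nhds (hU'o.mem_nhds hp.2))
        self_mem_nhdsWithin, fun x hx => ?_⟩
      refine prism_eq_zero (U := U' ∩ F) (V := V' ∩ F) (fun z hz => ?_) (fun z hz => ?_)
        (fun z hz => h z fun i => hV'V (hz i)) hx
      · exact ⟨hNU (mk_mem_prod hp.1 (hU'U hz.1)), hHF _ hz.2⟩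
      · exact ⟨hNU (mk_mem_prod (mem_of_mem_nhds hN) (hU'U hz.1)), hHF _ hz.2⟩
    filter_upwards [key] with t ht
    refine ⟨prism (H t) (H s) c, ?_, CSupp.of_isCompact hF _, fun y hy => ?_⟩
    · rintro rfl
      rfl
    · rw [← cobd_prism_add, add_sub_cancel_left]
      exact ht y hy hy
  have hneg : ∀ s t, ExactOn F (pull (H s) c - pull (H t) c) →
      ExactOn F (pull (H t) c - pull (H s) c) := fun s t h => by
    simpa using h.smul (-1)
  have htrans : ∀ s t u, ExactOn F (pull (H s) c - pull (H t) c) →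
      ExactOn F (pull (H t) c - pull (H u) c) → ExactOn F (pull (H s) c - pull (H u) c) :=
    fun s t u h h' => by simpa using h.add h'
  -- Being cohomologous to `c` after pull-back by `H t` is an open and closed condition on `t`, and
  -- `ℝ` is connected.
  have hclopen : IsClopen {t | ExactOn F (pull (H 0) c - pull (H t) c)} := by
    refine ⟨⟨isOpen_iff_mem_nhds.mpr fun s hs => ?_⟩, isOpen_iff_mem_nhds.mpr fun s hs => ?_⟩
    · filter_upwards [hloc s] with t ht ht'
      exact hs (htrans _ _ _ ht' (hneg _ _ ht))
    · filter_upwards [hloc s] with t ht using htrans _ _ _ hs ht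
  have huniv := hclopen.eq_univ ⟨0, by simpa using ExactOn.zero⟩
  have h := eq_univ_iff_forall.mp huniv 1
  have e0 : H 0 = id := funext h0
  have e1 : H 1 = σ := funext h1
  rwa [Set.mem_ofPred_eq, e0, e1, pull_id] at h

end Homotopy

end AlexanderSpanier

/-! ### Localization along proper maps, and trivial action on fibres -/

namespace AlexanderSpanier

open Set

variable {X Y : Type} [TopologicalSpace X] [TopologicalSpace Y]

theorem isOpen_setOf_van {m : ℕ} (B : Set Y) (c : Coch Y m) :
    IsOpen {y : B | Van (𝓝[B] (y : Y)) c} := by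
  refine isOpen_iff_mem_nhds.mpr ?_
  rintro ⟨y, hy⟩ ⟨U, hU, h⟩
  rw [nhds_subtype_eq_comap_nhdsWithin]
  refine ⟨{z | U ∈ 𝓝[B] z}, eventually_eventually_nhdsWithin.mpr hU, fun z hz => ⟨U, hz, h⟩⟩

theorem isCompact_setOf_not_van {m : ℕ} {B : Set Y} (hB : IsCompact B) (c : Coch Y m) :
    IsCompact {y | y ∈ B ∧ ¬ Van (𝓝[B] y) c} := by
  have := isCompact_iff_compactSpace.mp hB
  have h := ((isOpen_setOf_van B c).isClosed_compl.isCompact).image continuous_subtype_val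
  convert h using 1
  ext y
  simp only [mem_ofPred_eq, mem_image, mem_compl_iff, Subtype.exists, exists_and_right,
    exists_eq_right]
  exact ⟨fun h => ⟨h.1, h.2⟩, fun ⟨h, h'⟩ => ⟨h, h'⟩⟩

/-- The complex of cochains on `B ⊆ Y`, localized over `X` along a proper map `B → X`. -/
noncomputable def asComplex (q : Y → X) (B : Set Y) (hq : IsProperMap (fun y : B => q y))
    (P : ∀ m, AddSubgroup (Coch Y m)) (hP0 : ∀ c ∈ P 0, c = 0)
    (hPd : ∀ {m} (c : Coch Y m), c ∈ P m → cobd c ∈ P (m + 1))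
    (hPcut : ∀ {m} (A : Set X) (c : Coch Y m), c ∈ P m → cut (q ⁻¹' A) c ∈ P m) :
    LocalComplex X where
  C m := P m
  d := { toFun := fun c => ⟨cobd c.1, hPd _ c.2⟩
         map_zero' := Subtype.ext (map_zero cobd)
         map_add' := fun a b => Subtype.ext (map_add cobd a.1 b.1) }
  van c x := ∀ y ∈ B, q y = x → Van (𝓝[B] y) c.1
  cut A c := ⟨cut (q ⁻¹' A) c.1, hPcut A _ c.2⟩
  van_zero x y _ _ := Van.zero
  van_sub hb hc y hy hyx := (hb y hy hyx).sub (hc y hy hyx)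
  van_open c := by
    have h := hq.isClosedMap _ (isOpen_setOf_van B c.1).isClosed_compl
    rw [← isClosed_compl_iff]
    convert h using 1
    ext x
    simp only [mem_compl_iff, mem_ofPred_eq, not_forall, mem_image, Subtype.exists]
    exact ⟨fun ⟨y, hy, hyx, h⟩ => ⟨y, hy, h, hyx⟩, fun ⟨y, hy, h, hyx⟩ => ⟨y, hy, hyx, h⟩⟩
  van_d hc y hy hyx := (hc y hy hyx).cobd
  van_d_d c x y _ _ := by
    change Van _ (cobd (cobd c.1))
    rw [cobd_cobd]
    exact Van.zero
  van_cut A hc y hy hyx := (hc y hy hyx).cut _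
  van_cut_sub c x A hA y hy hyx := by
    refine van_cut_sub ?_ c.1
    have hcont := (continuousOn_iff_continuous_domRestrict.mpr hq.continuous) y hy
    exact hcont (hyx ▸ hA)
  van_cut_of_compl {k} c x A hA y hy hyx := by
    cases k with
    | zero =>
      change Van _ (cut (q ⁻¹' A) c.1)
      rw [hP0 c.1 c.2, map_zero]
      exact Van.zero
    | succ k =>
      refine van_cut ?_ c.1
      have hcont := (continuousOn_iff_continuous_domRestrict.mpr hq.continuous) y hy
      exact hcont (hyx ▸ hA)
  van_of_zero c x y _ _ := by
    rw [hP0 c.1 c.2]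
    exact Van.zero

theorem isCompact_inter_preimage {q : Y → X} {B : Set Y} (hq : IsProperMap (fun y : B => q y))
    {L : Set X} (hL : IsCompact L) : IsCompact (B ∩ q ⁻¹' L) := by
  have h := (hq.isCompact_preimage hL).image continuous_subtype_val
  convert h using 1
  ext y
  simp [and_comm]

theorem isProperMap_restrict [T2Space X] {q : Y → X} {B : Set Y} (hB : IsCompact B)
    (hq : ContinuousOn q B) : IsProperMap (fun y : B => q y) := by
  have := isCompact_iff_compactSpace.mp hB
  exact (continuousOn_iff_continuous_domRestrict.mp hq).isProperMap

/-- The cochains without invariant part; the only such cochain of no points is zero. -/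
noncomputable def cycKer (σ : Y → Y) (N m : ℕ) : AddSubgroup (Coch Y m) where
  carrier := {c | (m = 0 → c = 0) ∧ cycSum σ N c = 0}
  zero_mem' := ⟨fun _ => rfl, map_zero _⟩
  add_mem' ha hb := ⟨fun h => by rw [ha.1 h, hb.1 h, add_zero], by rw [map_add, ha.2, hb.2, add_zero]⟩
  neg_mem' ha := ⟨fun h => by rw [ha.1 h, neg_zero], by rw [map_neg, ha.2, neg_zero]⟩

omit [TopologicalSpace X] [TopologicalSpace Y] in
theorem cycSum_cut {σ : Y → Y} {q : Y → X} (hσq : ∀ y, q (σ y) = q y) {N m : ℕ} (A : Set X)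
    (c : Coch Y m) : cycSum σ N (cut (q ⁻¹' A) c) = cut (q ⁻¹' A) (cycSum σ N c) := by
  rw [cycSum_apply, cycSum_apply, map_sum]
  have hqj : ∀ (j : ℕ) y, q (σ^[j] y) = q y := fun j y => by
    induction j with
    | zero => rfl
    | succ j ih => rw [Function.iterate_succ_apply', hσq, ih]
  refine Finset.sum_congr rfl fun j _ => ?_
  rw [pull_cut, ← preimage_comp]
  congr 2
  exact congrArg (· ⁻¹' A) (funext (hqj j))

/-- A fibrewise map that acts trivially on the cohomology of the fibres acts trivially on the
cohomology of the total space. -/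
theorem TrivOn.of_fibres [T2Space X] [LocallyCompactSpace X] [TopologicalSpace.MetrizableSpace Y]
    {σ : Y → Y} {N : ℕ} (hσ : Continuous σ) (hN : N ≠ 0) (hσN : σ^[N] = id) {B : Set Y}
    (hB : MapsTo σ B B) (q : Y → X) (hσq : ∀ y, q (σ y) = q y) (hq : IsProperMap (fun y : B => q y))
    (hfib : ∀ x, TrivOn σ (B ∩ q ⁻¹' {x})) : TrivOn σ B := by
  have hqj : ∀ (j : ℕ) y, q (σ^[j] y) = q y := fun j y => by
    induction j with
    | zero => rfl
    | succ j ih => rw [Function.iterate_succ_apply', hσq, ih]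
  -- Only cochains without invariant part are localized over `X`. The action is trivial on
  -- cohomology as soon as this subcomplex is exact, which can be checked on germs at the points of
  -- `X`.
  let S := asComplex q B hq (cycKer σ N) (fun c hc => hc.1 rfl)
    (fun c hc => ⟨fun h => absurd h (Nat.succ_ne_zero _), by rw [← cobd_cycSum, hc.2, map_zero]⟩)
    (fun A c hc => ⟨fun h => by rw [hc.1 h, map_zero], by rw [cycSum_cut hσq, hc.2, map_zero]⟩)
  have hexact : ∀ x, S.ExactAt x := by
    intro x k c hc
    have hF : IsCompact (B ∩ q ⁻¹' {x}) := isCompact_inter_preimage hq isCompact_singleton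
    have hFσ : MapsTo σ (B ∩ q ⁻¹' {x}) (B ∩ q ⁻¹' {x}) := fun y hy =>
      ⟨hB hy.1, (hσq y).trans hy.2⟩
    have hcF : ∀ y ∈ B ∩ q ⁻¹' {x}, Van (𝓝[B] y) (cobd c.1) := fun y hy => hc y hy.1 hy.2
    obtain ⟨b, hb0, -, hb⟩ := (hfib x).exactOn hσ hN hσN hFσ
      (fun y hy => (hcF y hy).mono (nhdsWithin_mono y inter_subset_left))
      (CSupp.of_isCompact hF c.1) c.2.2
    -- A primitive on the fibre extends to a neighbourhood by tautness. Projecting with `cycProj`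
    -- returns it to the subcomplex without spoiling the equation, because `c` already has no
    -- invariant part.
    obtain ⟨θ, hθ0, hθ⟩ := exists_primitive_near hF inter_subset_left hcF hb
    refine ⟨⟨cycProj σ N θ, fun h => by rw [hθ0 h (hb0 h), map_zero],
      cycSum_cycProj hN hσN θ⟩, fun y hy hyx => ?_⟩
    have heq : c.1 - cobd (cycProj σ N θ) = cycProj σ N (c.1 - cobd θ) := by
      rw [map_sub, cycProj_of_cycSum_eq_zero c.2.2, cobd_cycProj]
    change Van _ (c.1 - cobd (cycProj σ N θ))
    rw [heq]
    exact Van.cycProj hσ hB hy fun j => hθ _ ⟨hB.iterate j hy, (hqj j y).trans hyx⟩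
  intro m c hc hcs
  have hcs' : CSupp B (c - pull σ c) := hcs.sub (hcs.pull_iterate hσ hN hσN hB)
  obtain ⟨K, hKB, hK, hvan⟩ := hcs'
  let c₁ : S.C (m + 1) := ⟨c - pull σ c, fun h => absurd h (Nat.succ_ne_zero _), by
    rw [map_sub, cycSum_pull hσN, sub_self]⟩
  obtain ⟨b, ⟨L, -, hL, hbL⟩, hb⟩ := LocalComplex.exists_primitive_compact_support
    (S := S) isOpen_univ (fun x _ => hexact x) c₁
    (hK.image_of_continuousOn ((continuousOn_iff_continuous_domRestrict.mpr hq.continuous).mono hKB))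
    (subset_univ _) (fun x hx y hy hyx => hvan y hy fun hyK => hx ⟨y, hyK, hyx⟩)
    (fun x _ y hy hyx => by
      change Van _ (cobd (c - pull σ c))
      rw [map_sub, cobd_pull]
      exact (hc y hy).sub ((hc.pull hσ.continuousOn hB) y hy))
  exact ⟨b.1, b.2.1, ⟨B ∩ q ⁻¹' L, inter_subset_left, isCompact_inter_preimage hq hL,
    fun y hy hyL => hbL (q y) (fun h => hyL ⟨hy, h⟩) y hy rfl⟩, fun y hy => hb (q y) y hy rfl⟩

/-- Extension by zero from an open subset. -/
theorem exists_extension [T2Space Y] [RegularSpace Y] {B O : Set Y} (hO : IsOpen O) {m : ℕ}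
    {c : Coch Y m} (hc0 : m = 0 → c = 0) (hc : CSupp (B ∩ O) c) :
    ∃ c' : Coch Y m, (m = 0 → c' = 0) ∧ LocZero (B ∩ O) (c - c') ∧
      ∃ K ⊆ B ∩ O, IsCompact K ∧ ∀ y ∈ B, y ∉ K → Van (𝓝[B] y) c' := by
  obtain ⟨K, hKB, hK, h⟩ := hc
  obtain ⟨U, V, hU, hV, hKU, hOV, hUV⟩ := SeparatedNhds.of_isCompact_isClosed hK hO.isClosed_compl
    (disjoint_compl_right_iff_subset.mpr fun y hy => (hKB hy).2)
  have hnhds : ∀ y ∈ O, 𝓝[B ∩ O] y = 𝓝[B] y := fun y hy =>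
    nhdsWithin_inter_of_mem' (mem_nhdsWithin_of_mem_nhds (hO.mem_nhds hy))
  -- `U` contains the support `K` and is separated from the complement of `O`, so the cut cochain
  -- equals `c` near `K` and vanishes near the points outside `O`.
  refine ⟨cut U c, fun hm => by rw [hc0 hm, map_zero], fun y hy => ?_, K, hKB, hK,
    fun y hy hyK => ?_⟩
  · by_cases hyK : y ∈ K
    · have := (van_cut_sub (mem_nhdsWithin_of_mem_nhds (t := B ∩ O) (hU.mem_nhds (hKU hyK))) c).neg
      rwa [neg_sub] at this
    · exact (h y hy hyK).sub ((h y hy hyK).cut U)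
  · by_cases hyO : y ∈ O
    · exact ((hnhds y hyO) ▸ h y ⟨hy, hyO⟩ hyK).cut U
    · cases m with
      | zero =>
        rw [hc0 rfl, map_zero]
        exact Van.zero
      | succ m =>
        refine van_cut (mem_nhdsWithin_of_mem_nhds ?_) c
        exact Filter.mem_of_superset (hV.mem_nhds (hOV hyO)) (disjoint_left.mp hUV.symm)

/-! ### Trivial actions and closed-open decompositions -/

section LongExact

variable [TopologicalSpace.MetrizableSpace Y] {σ : Y → Y} {N : ℕ} {A B : Set Y}

/-- The long exact sequence alone makes the action unipotent; finite order makes it trivial.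
Concretely, `c₁ = c - σ^* c` has no invariant part and is exact near `A`. Subtracting the coboundary
of a primitive without invariant part moves its support into `B \ A`, where it is exact, again for
lack of an invariant part. -/
theorem TrivOn.of_closed_of_open (hσ : Continuous σ) (hN : N ≠ 0) (hσN : σ^[N] = id)
    (hA : IsCompact A) (hB : IsCompact B) (hAB : A ⊆ B) (hσA : MapsTo σ A A) (hσB : MapsTo σ B B)
    (h₁ : TrivOn σ A) (h₂ : TrivOn σ (B \ A)) : TrivOn σ B := by
  intro m c hc _
  have hσBA : MapsTo σ (B \ A) (B \ A) := fun y hy => ⟨hσB hy.1, fun hyA => hy.2 (by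
    have h := hσA.iterate (N - 1) hyA
    rwa [← Function.iterate_succ_apply, Nat.succ_eq_add_one, Nat.sub_add_cancel
        (Nat.one_le_iff_ne_zero.mpr hN), hσN] at h)⟩
  set c₁ := c - pull σ c
  have hc₁ : LocZero B (cobd c₁) := by
    rw [map_sub, cobd_pull]
    exact hc.sub (hc.pull hσ.continuousOn hσB)
  have hc₁0 : cycSum σ N c₁ = 0 := by rw [map_sub, cycSum_pull hσN, sub_self]
  obtain ⟨b, hb0, -, hb⟩ := h₁.exactOn hσ hN hσN hσA (hc₁.mono hAB) (CSupp.of_isCompact hA _) hc₁0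
  obtain ⟨θ, hθ0, hθ⟩ := exists_primitive_near hA hAB (fun y hy => hc₁ y (hAB hy)) hb
  set c₂ := c₁ - cobd (cycProj σ N θ) with hc₂
  have hc₂A : ∀ y ∈ A, Van (𝓝[B] y) c₂ := fun y hy => by
    have heq : c₂ = cycProj σ N (c₁ - cobd θ) := by
      rw [map_sub, cycProj_of_cycSum_eq_zero hc₁0, hc₂, cobd_cycProj]
    rw [heq]
    exact Van.cycProj hσ hσB (hAB hy) fun j => hθ _ (hσA.iterate j hy)
  have hc₂B : LocZero B (cobd c₂) := by
    rw [hc₂, map_sub, cobd_cobd, sub_zero]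
    exact hc₁
  obtain ⟨b', hb'0, hb's, hb'⟩ := h₂.exactOn hσ hN hσN hσBA (hc₂B.mono sdiff_subset)
    ⟨{y | y ∈ B ∧ ¬ Van (𝓝[B] y) c₂}, fun y hy => ⟨hy.1, fun hyA => hy.2 (hc₂A y hyA)⟩,
      isCompact_setOf_not_van hB c₂, fun y hy hyK =>
        (not_not.mp fun h => hyK ⟨hy.1, h⟩).mono (nhdsWithin_mono y sdiff_subset)⟩
    (by rw [hc₂, map_sub, hc₁0, ← cobd_cycSum, cycSum_cycProj hN hσN, map_zero, sub_zero])
  obtain ⟨b'', hb''0, hdiff, K, hK, -, hb''K⟩ :=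
    exists_extension (B := B) hA.isClosed.isOpen_compl hb'0 hb's
  refine ⟨cycProj σ N θ + b'', fun hm => ?_, CSupp.of_isCompact hB _, fun y hy => ?_⟩
  · rw [hθ0 hm (hb0 hm), hb''0 hm, map_zero, add_zero]
  · rw [map_add, ← sub_sub]
    by_cases hyA : y ∈ A
    · exact (hc₂A y hyA).sub (hb''K y hy fun hyK => (hK hyK).2 hyA).cobd
    · have h := (hb' y ⟨hy, hyA⟩).add (hdiff y ⟨hy, hyA⟩).cobd
      rw [map_sub, sub_add_sub_cancel, sdiff_eq,
        nhdsWithin_inter_of_mem' (mem_nhdsWithin_of_mem_nhds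
          (hA.isClosed.isOpen_compl.mem_nhds hyA))] at h
      exact h

/-- Extend a class on `B \ A` by zero. Its difference with its translate has a primitive `b` on `B`,
chosen without invariant part. Near `A` this `b` is a cocycle, so triviality on `A` makes it a
coboundary there; subtracting that coboundary moves the support of `b` into `B \ A`. -/
theorem TrivOn.diff (hσ : Continuous σ) (hN : N ≠ 0) (hσN : σ^[N] = id)
    (hA : IsCompact A) (hB : IsCompact B) (hAB : A ⊆ B) (hσA : MapsTo σ A A) (hσB : MapsTo σ B B)
    (h₁ : TrivOn σ A) (h₂ : TrivOn σ B) : TrivOn σ (B \ A) := by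
  intro m c hc hcs
  have hσBA : MapsTo σ (B \ A) (B \ A) := fun y hy => ⟨hσB hy.1, fun hyA => hy.2 (by
    have h := hσA.iterate (N - 1) hyA
    rwa [← Function.iterate_succ_apply, Nat.succ_eq_add_one, Nat.sub_add_cancel
        (Nat.one_le_iff_ne_zero.mpr hN), hσN] at h)⟩
  have hnhds : ∀ y, y ∉ A → 𝓝[B \ A] y = 𝓝[B] y := fun y hy => by
    rw [sdiff_eq]
    exact nhdsWithin_inter_of_mem' (mem_nhdsWithin_of_mem_nhds
      (hA.isClosed.isOpen_compl.mem_nhds hy))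
  obtain ⟨c', -, hdiff, K, hK, -, hc'K⟩ :=
    exists_extension (B := B) hA.isClosed.isOpen_compl (fun h => absurd h (Nat.succ_ne_zero m)) hcs
  have hc'A : ∀ y ∈ A, Van (𝓝[B] y) c' := fun y hy => hc'K y (hAB hy) fun h => (hK h).2 hy
  have hc' : LocZero B (cobd c') := fun y hy => by
    by_cases hyA : y ∈ A
    · exact (hc'A y hyA).cobd
    · have h := (hc y ⟨hy, hyA⟩).sub (hdiff y ⟨hy, hyA⟩).cobd
      rwa [map_sub, sub_sub_cancel, hnhds y hyA] at h
  suffices h : ExactOn (B \ A) (c' - pull σ c') by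
    have h' := h.add (ExactOn.of_locZero ((LocZero.sub hdiff
      (hdiff.pull hσ.continuousOn hσBA))))
    rwa [map_sub, show c' - pull σ c' + (c - c' - (pull σ c - pull σ c')) = c - pull σ c by abel]
      at h'
  set c₁ := c' - pull σ c' with hc₁
  have hc₁0 : cycSum σ N c₁ = 0 := by rw [map_sub, cycSum_pull hσN, sub_self]
  have hc₁A : ∀ y ∈ A, Van (𝓝[B] y) c₁ := fun y hy => (hc'A y hy).sub
    ((hc'A _ (hσA hy)).pull (tendsto_nhdsWithin_of_mapsTo hσ.continuousOn hσB (hAB hy)))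
  obtain ⟨b₀, hb₀0, -, hb₀⟩ := h₂ m c' hc' (CSupp.of_isCompact hB _)
  have hb : LocZero B (c₁ - cobd (cycProj σ N b₀)) := fun y hy => by
    have heq : c₁ - cobd (cycProj σ N b₀) = cycProj σ N (c₁ - cobd b₀) := by
      rw [map_sub, cycProj_of_cycSum_eq_zero hc₁0, cobd_cycProj]
    rw [heq]
    exact Van.cycProj hσ hσB hy fun j => hb₀ _ (hσB.iterate j hy)
  -- For `m = 0` the primitive is zero and the difference is already locally zero, so there is no
  -- support to correct.
  cases m with
  | zero =>
    rw [hb₀0 rfl, map_zero, map_zero, sub_zero] at hb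
    exact ExactOn.of_locZero (hb.mono sdiff_subset)
  | succ m =>
    set b := cycProj σ N b₀
    have hbA : ∀ y ∈ A, Van (𝓝[B] y) (cobd b) := fun y hy => by
      have h := (hc₁A y hy).sub (hb y (hAB hy))
      rwa [sub_sub_cancel] at h
    obtain ⟨a, -, -, ha⟩ := h₁.exactOn hσ hN hσN hσA
      (fun y hy => (hbA y hy).mono (nhdsWithin_mono y hAB)) (CSupp.of_isCompact hA b)
      (cycSum_cycProj hN hσN b₀)
    obtain ⟨θ, -, hθ⟩ := exists_primitive_near hA hAB hbA ha
    refine ⟨b - cobd θ, fun h => absurd h (Nat.succ_ne_zero m),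
      ⟨{y | y ∈ B ∧ ¬ Van (𝓝[B] y) (b - cobd θ)}, fun y hy => ⟨hy.1, fun hyA => hy.2 (hθ y hyA)⟩,
        isCompact_setOf_not_van hB _, fun y hy hyK =>
          (not_not.mp fun h => hyK ⟨hy.1, h⟩).mono (nhdsWithin_mono y sdiff_subset)⟩, ?_⟩
    rw [map_sub, cobd_cobd, sub_zero]
    exact hb.mono sdiff_subset

end LongExact

end AlexanderSpanier

/-! ### Mapping cones and finite group actions on fibres -/

namespace AlexanderSpanier

open Set

/-- The mapping cone of a morphism of local complexes. -/
noncomputable def LocalComplex.cone {X : Type} [TopologicalSpace X] (S T : LocalComplex X)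
    (f : ∀ k, S.C k →+ T.C k) (hf : ∀ {k} (c : S.C k), f _ (S.d c) = T.d (f _ c))
    (hvan : ∀ {k} {c : S.C k} {x}, S.van c x → T.van (f _ c) x) : LocalComplex X where
  -- Truncated subtraction puts `T.C 0` in place of degree `-1`. This is harmless, since degree `0`
  -- is locally zero in both complexes and the differential leaving degree `0` is set to zero.
  C m := S.C m × T.C (m - 1)
  d {k} := match k with
    | 0 => 0
    | k + 1 => AddMonoidHom.prod (S.d.comp (AddMonoidHom.fst _ _))
        ((f (k + 1)).comp (AddMonoidHom.fst _ _) - (T.d (k := k)).comp (AddMonoidHom.snd _ _))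
  van c x := S.van c.1 x ∧ T.van c.2 x
  cut A c := (S.cut A c.1, T.cut A c.2)
  van_zero x := ⟨S.van_zero x, T.van_zero x⟩
  van_sub hb hc := ⟨S.van_sub hb.1 hc.1, T.van_sub hb.2 hc.2⟩
  van_open c := (S.van_open c.1).inter (T.van_open c.2)
  van_d {k} c x hc := by
    cases k with
    | zero => exact ⟨S.van_zero x, T.van_zero x⟩
    | succ k => exact ⟨S.van_d hc.1, T.van_sub (hvan hc.1) (T.van_d hc.2)⟩
  van_d_d {k} c x := by
    cases k with
    | zero =>
      refine ⟨?_, ?_⟩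
      · change S.van (S.d 0) x
        rw [map_zero]
        exact S.van_zero x
      · change T.van (f _ 0 - T.d 0) x
        rw [map_zero, map_zero, sub_zero]
        exact T.van_zero x
    | succ k =>
      refine ⟨S.van_d_d _ x, ?_⟩
      change T.van (f _ (S.d c.1) - T.d (f _ c.1 - T.d (k := k) c.2)) x
      rw [hf, map_sub, sub_sub_cancel]
      exact T.van_d_d _ x
  van_cut A hc := ⟨S.van_cut A hc.1, T.van_cut A hc.2⟩
  van_cut_sub c x A hA := ⟨S.van_cut_sub c.1 hA, T.van_cut_sub c.2 hA⟩
  van_cut_of_compl c x A hA := ⟨S.van_cut_of_compl c.1 hA, T.van_cut_of_compl c.2 hA⟩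
  van_of_zero c x := ⟨S.van_of_zero c.1 x, T.van_of_zero c.2 x⟩

/-- The augmented complex of invariant cochains on `F` is exact. -/
def AcyclicOn {Γ Y : Type} [TopologicalSpace Y] (act : Γ → Y → Y) (F : Set Y) : Prop :=
  -- Unlike in `ExactOn`, a primitive of no points, that is a constant, may be nonzero. The
  -- primitive need not be invariant; averaging takes care of that when it is used.
  F.Nonempty ∧ ∀ (m : ℕ) (ψ : Coch Y (m + 1)), (∀ γ, pull (act γ) ψ = ψ) → LocZero F (cobd ψ) →
    ∃ θ : Coch Y m, LocZero F (ψ - cobd θ)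

/-- A proper map `q : B → C` together with a finite group acting on its fibres. -/
structure FibreAction (Γ : Type) [Group Γ] [Fintype Γ] {X Y : Type} [TopologicalSpace X]
    [TopologicalSpace Y] (q : Y → X) (B : Set Y) (C : Set X) where
  act : Γ → Y → Y
  act_mul : ∀ γ γ' y, act (γ * γ') y = act γ (act γ' y)
  continuous_act : ∀ γ, Continuous (act γ)
  mapsTo_act : ∀ γ, MapsTo (act γ) B B
  q_act : ∀ γ y, q (act γ y) = q y
  continuous_q : Continuous q
  isProperMap : IsProperMap (fun y : B => q y)
  mapsTo : MapsTo q B C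
  isClosed : IsClosed C

namespace FibreAction

variable {Γ : Type} [Group Γ] [Fintype Γ] {X Y : Type} [TopologicalSpace X] [TopologicalSpace Y]
  {q : Y → X} {B : Set Y} {C : Set X} (D : FibreAction Γ q B C)

/-- The average of a cochain over the group. -/
noncomputable def avg {m : ℕ} : Coch Y m →ₗ[ℂ] Coch Y m :=
  (Fintype.card Γ : ℂ)⁻¹ • ∑ γ, pull (D.act γ)

theorem avg_apply {m : ℕ} (c : Coch Y m) :
    D.avg c = (Fintype.card Γ : ℂ)⁻¹ • ∑ γ, pull (D.act γ) c := by
  simp [avg]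

theorem cobd_avg {m : ℕ} (c : Coch Y m) : cobd (D.avg c) = D.avg (cobd c) := by
  simp [avg_apply, cobd_pull]

theorem pull_act_avg {m : ℕ} (c : Coch Y m) (γ : Γ) : pull (D.act γ) (D.avg c) = D.avg c := by
  rw [avg_apply, map_smul, map_sum]
  congr 1
  refine Fintype.sum_equiv (Equiv.mulRight γ) _ _ fun γ' => ?_
  rw [pull_pull, show D.act γ' ∘ D.act γ = D.act (γ' * γ) from
    funext fun y => (D.act_mul γ' γ y).symm]
  rfl

theorem avg_of_invariant {m : ℕ} {c : Coch Y m} (hc : ∀ γ, pull (D.act γ) c = c) :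
    D.avg c = c := by
  have : (Fintype.card Γ : ℂ) ≠ 0 := Nat.cast_ne_zero.mpr Fintype.card_ne_zero
  rw [avg_apply, Finset.sum_congr rfl fun γ _ => hc γ, Finset.sum_const, Finset.card_univ,
    ← Nat.cast_smul_eq_nsmul ℂ, smul_smul, inv_mul_cancel₀ this, one_smul]

theorem van_avg {m : ℕ} {c : Coch Y m} {y : Y} (hy : y ∈ B)
    (hc : ∀ γ, Van (𝓝[B] (D.act γ y)) c) : Van (𝓝[B] y) (D.avg c) := by
  rw [avg_apply]
  exact Van.smul _ (Van.sum fun γ _ => (hc γ).pull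
    (tendsto_nhdsWithin_of_mapsTo (D.continuous_act γ).continuousOn (D.mapsTo_act γ) hy))

/-- The cochains of `C`. -/
noncomputable def baseComplex : LocalComplex X :=
  asComplex id C D.isClosed.isClosedEmbedding_subtypeVal.isProperMap
    (fun m =>
      { carrier := {c | m = 0 → c = 0}
        zero_mem' := fun _ => rfl
        add_mem' := fun ha hb h => by rw [ha h, hb h, add_zero]
        neg_mem' := fun ha h => by rw [ha h, neg_zero] })
    (fun c hc => hc rfl) (fun c _ h => absurd h (Nat.succ_ne_zero _))
    (fun A c hc h => by rw [hc h, map_zero])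

/-- The invariant cochains of `B`. -/
noncomputable def totalComplex : LocalComplex X :=
  asComplex q B D.isProperMap
    (fun m =>
      { carrier := {c | (m = 0 → c = 0) ∧ ∀ γ, pull (D.act γ) c = c}
        zero_mem' := ⟨fun _ => rfl, fun γ => map_zero _⟩
        add_mem' := fun ha hb => ⟨fun h => by rw [ha.1 h, hb.1 h, add_zero], fun γ => by
          rw [map_add, ha.2, hb.2]⟩
        neg_mem' := fun ha => ⟨fun h => by rw [ha.1 h, neg_zero], fun γ => by
          rw [map_neg, ha.2]⟩ })
    (fun c hc => hc.1 rfl)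
    (fun c hc => ⟨fun h => absurd h (Nat.succ_ne_zero _), fun γ => by rw [← cobd_pull, hc.2]⟩)
    (fun A c hc => ⟨fun h => by rw [hc.1 h, map_zero], fun γ => by
      rw [pull_cut, hc.2, ← preimage_comp]
      congr 2
      exact congrArg (· ⁻¹' A) (funext (D.q_act γ))⟩)

theorem tendsto_q (D : FibreAction Γ q B C) {y : Y} (hy : y ∈ B) : Filter.Tendsto q (𝓝[B] y) (𝓝[C] (q y)) :=
  tendsto_nhdsWithin_of_mapsTo D.continuous_q.continuousOn D.mapsTo hy

/-- The cone of the pull-back of cochains from `C` to invariant cochains of `B`. -/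
noncomputable def cone : LocalComplex X :=
  D.baseComplex.cone D.totalComplex
    (fun k =>
      { toFun := fun c => ⟨pull q c.1, fun h => by rw [c.2 h, map_zero], fun γ => by
          rw [pull_pull, show q ∘ D.act γ = q from funext (D.q_act γ)]⟩
        map_zero' := Subtype.ext (map_zero (pull q))
        map_add' := fun a b => Subtype.ext (map_add (pull q) a.1 b.1) })
    (fun c => Subtype.ext (cobd_pull q c.1).symm)
    (fun {k} {c} {x} hc y hy hyx => (hc (q y) (D.mapsTo hy) hyx).pull (D.tendsto_q hy))

/-- The component of an element of the cone on the base. -/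
def base {m : ℕ} (c : D.cone.C (m + 1)) : Coch X (m + 1) := c.1.1

/-- The component of an element of the cone on the total space. -/
def top {m : ℕ} (c : D.cone.C (m + 1)) : Coch Y m := c.2.1

theorem top_eq_zero (c : D.cone.C 1) : D.top c = 0 := c.2.2.1 rfl

theorem pull_act_top {m : ℕ} (c : D.cone.C (m + 1)) (γ : Γ) :
    pull (D.act γ) (D.top c) = D.top c := c.2.2.2 γ

/-- An element of the cone. -/
def elt {m : ℕ} (φ : Coch X (m + 1)) (ψ : Coch Y m) (h0 : m = 0 → ψ = 0)
    (hψ : ∀ γ, pull (D.act γ) ψ = ψ) : D.cone.C (m + 1) :=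
  (⟨φ, fun h => absurd h (Nat.succ_ne_zero m)⟩, ⟨ψ, h0, hψ⟩)

theorem van_iff {m : ℕ} (c : D.cone.C (m + 1)) (x : X) : D.cone.van c x ↔
    (x ∈ C → Van (𝓝[C] x) (D.base c)) ∧ ∀ y ∈ B, q y = x → Van (𝓝[B] y) (D.top c) :=
  ⟨fun h => ⟨fun hx => h.1 x hx rfl, h.2⟩, fun h => ⟨fun y hy hyx => by
    obtain rfl : y = x := hyx
    exact h.1 hy, h.2⟩⟩

theorem van_d_iff {m : ℕ} (c : D.cone.C (m + 1)) (x : X) : D.cone.van (D.cone.d c) x ↔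
    (x ∈ C → Van (𝓝[C] x) (cobd (D.base c))) ∧
      ∀ y ∈ B, q y = x → Van (𝓝[B] y) (pull q (D.base c) - cobd (D.top c)) :=
  D.van_iff _ x

theorem van_sub_d_iff {m : ℕ} (c : D.cone.C (m + 2)) (b : D.cone.C (m + 1)) (x : X) :
    D.cone.van (c - D.cone.d b) x ↔
    (x ∈ C → Van (𝓝[C] x) (D.base c - cobd (D.base b))) ∧
      ∀ y ∈ B, q y = x → Van (𝓝[B] y) (D.top c - (pull q (D.base b) - cobd (D.top b))) :=
  D.van_iff _ x

variable [TopologicalSpace.MetrizableSpace Y]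

/-- The local form of the Vietoris–Begle theorem. Freezing at `x` gives a primitive `b₀` of the base
component near `x`. What remains, `q^* b₀` minus the top component, is an invariant cocycle near the
fibre: it is exact on the fibre by acyclicity, near it by tautness, and invariantly so after
averaging. -/
theorem exactAt_cone {x : X} (hx : x ∈ C) (hac : AcyclicOn D.act (B ∩ q ⁻¹' {x})) :
    D.cone.ExactAt x := by
  intro k c hc
  obtain ⟨hφ, hψ⟩ := (D.van_d_iff c x).mp hc
  obtain ⟨⟨y₀, hy₀B, hy₀⟩, hac⟩ := hac
  set b₀ : Coch X k := freeze x (D.base c)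
  have hb₀ : Van (𝓝[C] x) ((D.base c) - cobd b₀) := by
    rw [← freeze_cobd]
    exact (hφ hx).freeze fun U hU => mem_of_mem_nhdsWithin hx hU
  cases k with
  | zero =>
    refine ⟨0, ?_⟩
    rw [map_zero, sub_zero, van_iff]
    refine ⟨fun _ => ?_, fun y hy hyx => ?_⟩
    · have h0 : D.top c = 0 := D.top_eq_zero c
      -- In the lowest degree `b₀` is the value of the base component at `x`. It vanishes because
      -- the pull-back vanishes at a point `y₀` of the fibre, which is nonempty.
      obtain ⟨U, hU, h⟩ := hψ y₀ hy₀B hy₀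
      rw [h0, map_zero, sub_zero] at h
      have hbz : b₀ = 0 := by
        funext z
        have := h (fun _ => y₀) fun _ => mem_of_mem_nhdsWithin hy₀B hU
        rw [pull_apply] at this
        rw [Pi.zero_apply, ← this]
        refine congrArg (D.base c) (funext fun i => ?_)
        rw [Fin.fin_one_eq_zero i]
        exact hy₀.symm
      rwa [hbz, map_zero, sub_zero] at hb₀
    · have h0 : D.top c = 0 := D.top_eq_zero c
      exact h0 ▸ Van.zero
  | succ k =>
    have hF : IsCompact (B ∩ q ⁻¹' {x}) := isCompact_inter_preimage D.isProperMap isCompact_singleton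
    have hFγ : ∀ γ, ∀ y ∈ B ∩ q ⁻¹' {x}, D.act γ y ∈ B ∩ q ⁻¹' {x} := fun γ y hy =>
      ⟨D.mapsTo_act γ hy.1, (D.q_act γ y).trans hy.2⟩
    set ψ₁ : Coch Y (k + 1) := pull q b₀ - D.top c
    have hψ₁ : ∀ γ, pull (D.act γ) ψ₁ = ψ₁ := fun γ => by
      rw [map_sub, D.pull_act_top c γ, pull_pull, show q ∘ D.act γ = q from funext (D.q_act γ)]
    have hψ₁c : ∀ y ∈ B ∩ q ⁻¹' {x}, Van (𝓝[B] y) (cobd ψ₁) := fun y hy => by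
      have h1 := hψ y hy.1 hy.2
      have h2 := Van.pull (f := q) (l' := 𝓝[B] y) hb₀ (by
        have := D.tendsto_q hy.1
        rwa [show q y = x from hy.2] at this)
      have h3 := h1.sub h2
      rw [map_sub, cobd_pull]
      rwa [map_sub, sub_sub_sub_cancel_left] at h3
    obtain ⟨θ, hθ⟩ := hac k ψ₁ hψ₁ fun y hy =>
      (hψ₁c y hy).mono (nhdsWithin_mono y inter_subset_left)
    obtain ⟨θ', -, hθ'⟩ := exists_primitive_near hF inter_subset_left hψ₁c hθ
    have havg : ∀ y ∈ B ∩ q ⁻¹' {x}, Van (𝓝[B] y) (ψ₁ - cobd (D.avg θ')) := fun y hy => by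
      have heq : ψ₁ - cobd (D.avg θ') = D.avg (ψ₁ - cobd θ') := by
        rw [map_sub, D.avg_of_invariant hψ₁, cobd_avg]
      rw [heq]
      exact D.van_avg hy.1 fun γ => hθ' _ (hFγ γ y hy)
    cases k with
    | zero =>
      -- Here the primitive on the fibre is a constant, which is not admitted as a top component. It
      -- is transferred to the base, where it modifies `b₀` by a coboundary.
      set lam : Coch X 0 := fun _ => D.avg θ' Fin.elim0
      have hlam : cobd (pull q lam) = cobd (D.avg θ') := by
        congr 1
        funext z
        exact congrArg (D.avg θ') (Subsingleton.elim _ _)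
      refine ⟨D.elt (b₀ - cobd lam) 0 (fun _ => rfl) (fun γ => map_zero _), ?_⟩
      rw [van_sub_d_iff]
      refine ⟨fun _ => ?_, fun y hy hyx => ?_⟩
      · change Van _ ((D.base c) - cobd (b₀ - cobd lam))
        rwa [map_sub, cobd_cobd, sub_zero]
      · change Van _ (D.top c - (pull q (b₀ - cobd lam) - cobd 0))
        have h := (havg y ⟨hy, hyx⟩).neg
        have heq : -(ψ₁ - cobd (D.avg θ')) =
            D.top c - (pull q (b₀ - cobd lam) - cobd 0) := by
          rw [map_sub, map_zero, ← hlam, cobd_pull]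
          simp only [ψ₁]
          abel
        rwa [heq] at h
    | succ k =>
      refine ⟨D.elt b₀ (D.avg θ') (fun h => absurd h (Nat.succ_ne_zero k)) (D.pull_act_avg θ'), ?_⟩
      rw [van_sub_d_iff]
      refine ⟨fun _ => hb₀, fun y hy hyx => ?_⟩
      change Van _ (D.top c - (pull q b₀ - cobd (D.avg θ')))
      have h := (havg y ⟨hy, hyx⟩).neg
      have heq : -(ψ₁ - cobd (D.avg θ')) =
          D.top c - (pull q b₀ - cobd (D.avg θ')) := by
        simp only [ψ₁]
        abel
      rwa [heq] at h

end FibreAction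

end AlexanderSpanier

/-! ### Descent along maps with acyclic fibres -/

namespace AlexanderSpanier

open Set

namespace FibreAction

variable {Γ : Type} [Group Γ] [Fintype Γ] {X Y : Type} [TopologicalSpace X] [TopologicalSpace Y]
  {q : Y → X} {B : Set Y} {C : Set X} (D : FibreAction Γ q B C)

theorem exactAt_cone_of_notMem {x : X} (hx : x ∉ C) : D.cone.ExactAt x := fun k c _ => by
  refine ⟨0, ?_⟩
  rw [map_zero, sub_zero, van_iff]
  exact ⟨fun h => absurd h hx, fun y hy hyx => absurd (hyx ▸ D.mapsTo hy) hx⟩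

theorem exactAt_cone_of_acyclicOn [TopologicalSpace.MetrizableSpace Y] {O : Set X}
    (hac : ∀ x ∈ C ∩ O, AcyclicOn D.act (B ∩ q ⁻¹' {x})) {x : X} (hx : x ∈ O) :
    D.cone.ExactAt x := by
  by_cases hxC : x ∈ C
  · exact D.exactAt_cone hxC (hac x ⟨hxC, hx⟩)
  · exact D.exactAt_cone_of_notMem hxC

theorem csupp_pull (D : FibreAction Γ q B C) {O : Set X} {m : ℕ} {c : Coch X m}
    (hcs : CSupp (C ∩ O) c) : CSupp (B ∩ q ⁻¹' O) (pull q c) := by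
  refine hcs.pull D.continuous_q.continuousOn (fun y hy => ⟨D.mapsTo hy.1, hy.2⟩) fun K hK hKc => ?_
  rw [inter_assoc, ← preimage_inter, inter_eq_right.mpr fun x hx => (hK hx).2]
  exact isCompact_inter_preimage D.isProperMap hKc

variable [TopologicalSpace.MetrizableSpace Y] [T2Space X] [LocallyCompactSpace X]

/-- If the fibres over `C ∩ O` are acyclic, the pull-back to the total space is injective on
cohomology with compact supports. -/
theorem exactOn_of_exactOn_pull {O : Set X} (hO : IsOpen O)
    (hac : ∀ x ∈ C ∩ O, AcyclicOn D.act (B ∩ q ⁻¹' {x})) {m : ℕ} {c : Coch X (m + 1)}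
    (hc : LocZero (C ∩ O) (cobd c)) (hcs : CSupp (C ∩ O) c)
    (h : ExactOn (B ∩ q ⁻¹' O) (pull q c)) : ExactOn (C ∩ O) c := by
  have hXO : ∀ x ∈ O, 𝓝[C ∩ O] x = 𝓝[C] x := fun x hx =>
    nhdsWithin_inter_of_mem' (mem_nhdsWithin_of_mem_nhds (hO.mem_nhds hx))
  have hYO : ∀ y ∈ q ⁻¹' O, 𝓝[B ∩ q ⁻¹' O] y = 𝓝[B] y := fun y hy =>
    nhdsWithin_inter_of_mem' (mem_nhdsWithin_of_mem_nhds
      ((hO.preimage D.continuous_q).mem_nhds hy))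
  obtain ⟨ψ, hψ0, hψs, hψ⟩ := h
  obtain ⟨c', -, hcc', K, hKC, hK, hc'K⟩ := exists_extension hO (fun h => absurd h
    (Nat.succ_ne_zero m)) hcs
  obtain ⟨ψ', hψ'0, hψψ', L, hLB, hL, hψ'L⟩ :=
    exists_extension (hO.preimage D.continuous_q) hψ0 hψs
  -- A primitive of `q^* c`, once averaged, completes `c` to a cocycle of the cone over `O`. The
  -- base component of a primitive of this cocycle is a primitive of `c`.
  let e : D.cone.C (m + 1) := D.elt c' (D.avg ψ') (fun h => by rw [hψ'0 h, map_zero])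
    (D.pull_act_avg ψ')
  have hinv : D.avg (pull q c') = pull q c' := D.avg_of_invariant fun γ => by
    rw [pull_pull, show q ∘ D.act γ = q from funext (D.q_act γ)]
  obtain ⟨b, ⟨M, hMO, hM, hbM⟩, hb⟩ := LocalComplex.exists_primitive_compact_support hO
    (fun x hx => D.exactAt_cone_of_acyclicOn hac hx) e (hK.union (hL.image D.continuous_q))
    (union_subset (fun x hx => (hKC hx).2) (image_subset_iff.mpr fun y hy => (hLB hy).2))
    (fun x hx => (D.van_iff e x).mpr ⟨fun hxC => hc'K x hxC fun h => hx (Or.inl h),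
      fun y hy hyx => D.van_avg hy fun γ => hψ'L _ (D.mapsTo_act γ hy) fun h => hx (Or.inr
        ⟨_, h, (D.q_act γ y).trans hyx⟩)⟩)
    (fun x hx => (D.van_d_iff e x).mpr ⟨fun hxC => by
      have h := (hc x ⟨hxC, hx⟩).sub (hcc' x ⟨hxC, hx⟩).cobd
      rwa [map_sub, sub_sub_cancel, hXO x hx] at h, fun y hy hyx => by
      change Van _ (pull q c' - cobd (D.avg ψ'))
      rw [cobd_avg, ← hinv, ← map_sub]
      refine D.van_avg hy fun γ => ?_
      have hγB := D.mapsTo_act γ hy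
      have hγO : D.act γ y ∈ q ⁻¹' O := by
        rw [mem_preimage, D.q_act, hyx]
        exact hx
      have h1 := hψ _ ⟨hγB, hγO⟩
      have h2 := (hψψ' _ ⟨hγB, hγO⟩).cobd
      have h3 := (hcc'.pull D.continuous_q.continuousOn
        (fun y (hy : y ∈ B ∩ q ⁻¹' O) => ⟨D.mapsTo hy.1, hy.2⟩)) _ ⟨hγB, hγO⟩
      have h4 := (h1.add h2).sub h3
      rw [hYO _ hγO] at h4
      convert h4 using 1
      rw [map_sub, map_sub]
      abel⟩)
  cases m with
  | zero =>
    refine ExactOn.of_locZero fun x hx => ?_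
    have h := hb x
    have hb0 : D.cone.d b = 0 := rfl
    rw [hb0, sub_zero, van_iff] at h
    have h' := (hcc' x hx).add ((hXO x hx.2).symm ▸ h.1 hx.1)
    rwa [show c - c' + D.base e = c from sub_add_cancel c c'] at h'
  | succ m =>
    refine ⟨D.base b, fun h => absurd h (Nat.succ_ne_zero m), ⟨C ∩ M, inter_subset_inter_right C hMO,
      hM.inter_left D.isClosed, fun x hx hxM => ?_⟩, fun x hx => ?_⟩
    · rw [hXO x hx.2]
      exact ((D.van_iff b x).mp (hbM x fun h => hxM ⟨hx.1, h⟩)).1 hx.1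
    · have h := ((D.van_sub_d_iff e b x).mp (hb x)).1 hx.1
      rw [← hXO x hx.2] at h
      have h' := (hcc' x hx).add h
      rwa [show D.base e = c' from rfl, sub_add_sub_cancel] at h'

/-- Trivial actions descend along maps with acyclic fibres. -/
theorem trivOn_of_total {O : Set X} (hO : IsOpen O)
    (hac : ∀ x ∈ C ∩ O, AcyclicOn D.act (B ∩ q ⁻¹' {x})) {σ : X → X} {σ' : Y → Y} {N : ℕ}
    (hσ : Continuous σ) (hN : N ≠ 0) (hσN : σ^[N] = id) (hσC : MapsTo σ (C ∩ O) (C ∩ O))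
    (hqσ : q ∘ σ' = σ ∘ q) (h : TrivOn σ' (B ∩ q ⁻¹' O)) : TrivOn σ (C ∩ O) := by
  intro m c hc hcs
  have hmaps : MapsTo q (B ∩ q ⁻¹' O) (C ∩ O) := fun y hy => ⟨D.mapsTo hy.1, hy.2⟩
  refine D.exactOn_of_exactOn_pull hO hac ?_ (hcs.sub (hcs.pull_iterate hσ hN hσN hσC)) ?_
  · rw [map_sub, cobd_pull]
    exact hc.sub (hc.pull hσ.continuousOn hσC)
  · have h' := h m (pull q c) (by
      rw [cobd_pull]
      exact hc.pull D.continuous_q.continuousOn hmaps) (D.csupp_pull hcs)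
    rwa [pull_pull, hqσ, ← pull_pull, ← map_sub] at h'

/-- If the fibres are acyclic, invariant cocycles come from the base up to coboundaries. -/
theorem exists_cocycle_of_invariant (hac : ∀ x ∈ C, AcyclicOn D.act (B ∩ q ⁻¹' {x})) {m : ℕ}
    {ψ : Coch Y (m + 1)} (hinv : ∀ γ, pull (D.act γ) ψ = ψ) (hψ : LocZero B (cobd ψ))
    (hψs : CSupp B ψ) :
    ∃ c : Coch X (m + 1), LocZero C (cobd c) ∧ CSupp C c ∧ ExactOn B (ψ - pull q c) := by
  obtain ⟨K, -, hK, hψK⟩ := hψs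
  -- A primitive of the cone cocycle `(0, ψ)` has a base component that is a cocycle pulling back to
  -- `ψ` up to the coboundary of its top component.
  let e : D.cone.C (m + 2) := D.elt 0 ψ (fun h => absurd h (Nat.succ_ne_zero m)) hinv
  obtain ⟨b, ⟨M, -, hM, hbM⟩, hb⟩ := LocalComplex.exists_primitive_compact_support isOpen_univ
    (fun x _ => D.exactAt_cone_of_acyclicOn (O := univ) (fun x hx => hac x hx.1) (mem_univ x)) e
    (hK.image D.continuous_q) (subset_univ _)
    (fun x hx => (D.van_iff e x).mpr ⟨fun _ => Van.zero, fun y hy hyx =>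
      hψK y hy fun h => hx ⟨y, h, hyx⟩⟩)
    (fun x _ => (D.van_d_iff e x).mpr ⟨fun _ => Van.zero.cobd, fun y hy _ => by
      change Van _ (pull q 0 - cobd ψ)
      rw [map_zero]
      exact Van.zero.sub (hψ y hy)⟩)
  refine ⟨D.base b, fun x hx => ?_, ⟨C ∩ M, inter_subset_left, hM.inter_left D.isClosed,
    fun x hx hxM => ((D.van_iff b x).mp (hbM x fun h => hxM ⟨hx, h⟩)).1 hx⟩, -D.top b,
    fun h => ?_, ⟨B ∩ q ⁻¹' M, inter_subset_left, isCompact_inter_preimage D.isProperMap hM,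
    fun y hy hyM => (((D.van_iff b _).mp (hbM (q y) fun h => hyM ⟨hy, h⟩)).2 y hy rfl).neg⟩,
    fun y hy => ?_⟩
  · have h := (((D.van_sub_d_iff e b x).mp (hb x)).1 hx).neg
    rwa [neg_sub, show D.base e = 0 from rfl, sub_zero] at h
  · subst h
    rw [D.top_eq_zero, neg_zero]
  · have h := ((D.van_sub_d_iff e b (q y)).mp (hb _)).2 y hy rfl
    rw [map_neg, sub_neg_eq_add]
    rwa [← sub_add, show D.top e = ψ from rfl] at h

end FibreAction

/-! ### Transfer along retractions, embeddings and finite products -/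

section Transfer

theorem van_map_iff {X Y : Type} {m : ℕ} {l : Filter X} (f : X → Y) (c : Coch Y m) :
    Van (l.map f) c ↔ Van l (pull f c) := by
  refine ⟨fun h => h.pull Filter.tendsto_map, fun ⟨U, hU, h⟩ =>
    ⟨f '' U, Filter.image_mem_map hU, fun y hy => ?_⟩⟩
  choose z hz hzy using hy
  rw [← h z hz, pull_apply]
  exact congrArg c (funext fun i => (hzy i).symm)

variable {X Y : Type} [TopologicalSpace X] [TopologicalSpace Y]

/-- Cochains are pulled back to `F` by `g` and primitives return by `f`. Only `g` has to be
equivariant, since primitives are not required to be invariant. -/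
theorem AcyclicOn.of_retract {Γ : Type} {a : Γ → X → X} {a' : Γ → Y → Y} {F : Set X} {F' : Set Y}
    (h : AcyclicOn a F) {f : Y → X} {g : X → Y} (hf : ContinuousOn f F') (hg : ContinuousOn g F)
    (hfF : MapsTo f F' F) (hgF : MapsTo g F F') (hgf : ∀ y ∈ F', g (f y) = y)
    (hga : ∀ γ x, g (a γ x) = a' γ (g x)) : AcyclicOn a' F' := by
  refine ⟨h.1.image g |>.mono (image_subset_iff.mpr hgF), fun m ψ hψ hψc => ?_⟩
  obtain ⟨θ, hθ⟩ := h.2 m (pull g ψ) (fun γ => by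
    rw [pull_pull, show g ∘ a γ = a' γ ∘ g from funext (hga γ), ← pull_pull, hψ]) (by
    rw [cobd_pull]
    exact hψc.pull hg hgF)
  refine ⟨pull f θ, fun y hy => ?_⟩
  have h1 := (hθ.pull hf hfF) y hy
  rw [map_sub, pull_pull] at h1
  have h2 : Van (𝓝[F'] y) (ψ - pull (g ∘ f) ψ) :=
    ⟨F', self_mem_nhdsWithin, fun z hz => by
      rw [Pi.sub_apply, pull_apply, sub_eq_zero]
      exact congrArg ψ (funext fun i => (hgf _ (hz i)).symm)⟩
  have h3 := h2.add h1
  rwa [sub_add_sub_cancel, ← cobd_pull] at h3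

/-- Trivial actions on the image of an embedding are trivial on the source. -/
theorem TrivOn.of_isEmbedding {f : X → Y} (hf : IsEmbedding f) {σ : X → X} {σ' : Y → Y}
    (hσ : f ∘ σ = σ' ∘ f) (h : TrivOn σ' (range f)) : TrivOn σ univ := by
  intro m c hc ⟨K, _, hK, hcK⟩
  have hinj : Function.Injective fun x : Fin (m + 1) → X => f ∘ x :=
    hf.injective.comp_left
  set c' : Coch Y (m + 1) := Function.extend (fun x => f ∘ x) c 0
  have hc' : pull f c' = c := funext fun x => hinj.extend_apply c 0 x
  have hvan : ∀ {k} (x : X) (φ : Coch Y k), Van (𝓝[range f] (f x)) φ ↔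
      Van (𝓝[univ] x) (pull f φ) := fun x φ => by
    rw [← hf.map_nhds_eq, van_map_iff, nhdsWithin_univ]
  obtain ⟨b, hb0, ⟨L, hL, hLc, hbL⟩, hb⟩ := h m c' (by
    rintro _ ⟨x, rfl⟩
    rw [hvan, ← cobd_pull, hc']
    exact hc x (mem_univ x)) ⟨f '' K, image_subset_range f K, hK.image hf.continuous, by
      rintro _ ⟨x, rfl⟩ hx
      rw [hvan, hc']
      exact hcK x (mem_univ x) fun h => hx ⟨x, h, rfl⟩⟩
  refine ⟨pull f b, fun hm => by rw [hb0 hm, map_zero], ⟨f ⁻¹' L, subset_univ _, ?_,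
    fun x _ hx => (hvan x b).mp (hbL (f x) ⟨x, rfl⟩ hx)⟩, fun x _ => ?_⟩
  · rw [hf.isInducing.isCompact_iff, image_preimage_eq_of_subset hL]
    exact hLc
  · have h := (hvan x _).mp (hb (f x) ⟨x, rfl⟩)
    rwa [map_sub, map_sub, hc', pull_pull, ← hσ, ← pull_pull, hc', ← cobd_pull] at h

/-- Trivial actions on finite disjoint unions. -/
theorem TrivOn.prod {ι : Type} [Fintype ι] [TopologicalSpace ι] [DiscreteTopology ι] {S : Set X}
    {σ : X → X} (h : TrivOn σ S) (V : Set ι) : TrivOn (Prod.map σ id) (S ×ˢ V) := by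
  classical
  intro m c hc hcs
  have hmaps : ∀ i ∈ V, MapsTo (fun x => (x, i)) S (S ×ˢ V) := fun i hi x hx => ⟨hx, hi⟩
  have hcont : ∀ i : ι, Continuous fun x : X => (x, i) := fun i => by fun_prop
  have hex : ∀ i ∈ V, ExactOn S (pull (fun x => (x, i)) c - pull σ (pull (fun x => (x, i)) c)) := by
    intro i hi
    refine h m _ ?_ (hcs.pull (hcont i).continuousOn (hmaps i hi) fun K hK hKc => ?_)
    · rw [cobd_pull]
      exact hc.pull (hcont i).continuousOn (hmaps i hi)
    · have : S ∩ (fun x => (x, i)) ⁻¹' K = Prod.fst '' (K ∩ Prod.snd ⁻¹' {i}) := by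
        ext x
        constructor
        · rintro ⟨-, hx⟩
          exact ⟨(x, i), ⟨hx, rfl⟩, rfl⟩
        · rintro ⟨⟨x, j⟩, ⟨hx, rfl⟩, rfl⟩
          exact ⟨(hK hx).1, hx⟩
      rw [this]
      exact (hKc.inter_right ((isClosed_discrete {i}).preimage continuous_snd)).image continuous_fst
  choose b hb0 hbs hb using hex
  set b' : ι → Coch X m := fun i => if hi : i ∈ V then b i hi else 0
  have hb' : ∀ i (hi : i ∈ V), b' i = b i hi := fun i hi => dif_pos hi
  have hb'0 : m = 0 → ∀ i, b' i = 0 := fun hm i => by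
    by_cases hi : i ∈ V
    · rw [hb' i hi, hb0 i hi hm]
    · exact dif_neg hi
  set β : Coch (X × ι) m := ∑ i, cut (Prod.snd ⁻¹' {i}) (pull Prod.fst (b' i)) with hβ
  have hnhds : ∀ p : X × ι, Prod.snd ⁻¹' {p.2} ∈ 𝓝[S ×ˢ V] p := fun p =>
    mem_nhdsWithin_of_mem_nhds (((isOpen_discrete {p.2}).preimage continuous_snd).mem_nhds rfl)
  have hfst : ∀ p ∈ S ×ˢ V, Filter.Tendsto Prod.fst (𝓝[S ×ˢ V] p) (𝓝[S] p.1) := fun p hp =>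
    tendsto_nhdsWithin_of_mapsTo continuous_fst.continuousOn (fun q hq => hq.1) hp
  have hβ' : ∀ p : X × ι, Van (𝓝[S ×ˢ V] p) (β - pull Prod.fst (b' p.2)) := fun p => by
    have h1 : β - pull Prod.fst (b' p.2) =
        (cut (Prod.snd ⁻¹' {p.2}) (pull Prod.fst (b' p.2)) - pull Prod.fst (b' p.2)) +
        ∑ i ∈ Finset.univ.erase p.2, cut (Prod.snd ⁻¹' {i}) (pull Prod.fst (b' i)) := by
      rw [hβ, ← Finset.add_sum_erase _ _ (Finset.mem_univ p.2)]
      abel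
    rw [h1]
    refine (van_cut_sub (hnhds p) _).add (Van.sum fun i hi => ?_)
    cases m with
    | zero =>
      rw [hb'0 rfl, map_zero, map_zero]
      exact Van.zero
    | succ m =>
      refine van_cut (Filter.mem_of_superset (hnhds p) fun z hz => ?_) _
      intro hzi
      exact Finset.ne_of_mem_erase hi (hzi.symm.trans hz)
  refine ⟨β, fun hm => ?_, ?_, fun p hp => ?_⟩
  · simp [hβ, hb'0 hm]
  · choose K hKS hK hKb using hbs
    refine ⟨⋃ i, ⋃ hi : i ∈ V, K i hi ×ˢ {i}, ?_, ?_, fun p hp hpK => ?_⟩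
    · refine iUnion_subset fun i => iUnion_subset fun hi => prod_mono (hKS i hi) ?_
      exact singleton_subset_iff.mpr hi
    · exact isCompact_iUnion fun i => isCompact_iUnion fun hi => (hK i hi).prod isCompact_singleton
    · have h1 : Van (𝓝[S] p.1) (b' p.2) := by
        rw [hb' p.2 hp.2]
        refine hKb p.2 hp.2 p.1 hp.1 fun h => hpK ?_
        exact mem_iUnion.mpr ⟨p.2, mem_iUnion.mpr ⟨hp.2, h, rfl⟩⟩
      have h2 := (hβ' p).add (h1.pull (hfst p hp))
      rwa [sub_add_cancel] at h2
  · have h1 := (hb p.2 hp.2 p.1 hp.1).pull (hfst p hp)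
    rw [← hb' p.2 hp.2, map_sub, map_sub, ← cobd_pull] at h1
    have h2 : Van (𝓝[S ×ˢ V] p) (c - pull Prod.fst (pull (fun x => (x, p.2)) c)) :=
      ⟨_, hnhds p, fun z hz => by
        rw [Pi.sub_apply, sub_eq_zero]
        exact congrArg c (funext fun i => Prod.ext rfl (hz i))⟩
    have h3 : Van (𝓝[S ×ˢ V] p) (pull (Prod.map σ id) c -
        pull Prod.fst (pull σ (pull (fun x => (x, p.2)) c))) :=
      ⟨_, hnhds p, fun z hz => by
        rw [Pi.sub_apply, sub_eq_zero]
        exact congrArg c (funext fun i => Prod.ext rfl (hz i))⟩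
    have h4 := ((h2.sub h3).add h1).sub (hβ' p).cobd
    convert h4 using 1
    rw [map_sub]
    abel

end Transfer

end AlexanderSpanier


/-! ### Maximal decompositions in *-algebras of matrices -/

namespace StarSubalgebra

open Matrix
open scoped ComplexOrder

/-- A family of `t` nonzero pairwise orthogonal projections with sum `1`. -/
structure IsDecomp {n t : ℕ} (Q : Fin t → Matrix (Fin n) (Fin n) ℂ) : Prop where
  star_eq : ∀ i, star (Q i) = Q i
  mul_self : ∀ i, Q i * Q i = Q i
  mul_of_ne : ∀ i j, i ≠ j → Q i * Q j = 0
  sum_eq : ∑ i, Q i = 1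
  ne_zero : ∀ i, Q i ≠ 0

variable {n : ℕ}

/-- The families of `t` nonzero orthogonal projections in `Z` with sum `1`. -/
def decomps (Z : StarSubalgebra ℂ (Matrix (Fin n) (Fin n) ℂ)) (t : ℕ) :
    Set (Fin t → Matrix (Fin n) (Fin n) ℂ) :=
  {Q | IsDecomp Q ∧ ∀ i, Q i ∈ Z}

/-- `t` is the largest number of nonzero orthogonal projections in `Z` with sum `1`. -/
def HasLength (Z : StarSubalgebra ℂ (Matrix (Fin n) (Fin n) ℂ)) (t : ℕ) : Prop :=
  (decomps Z t).Nonempty ∧ ∀ u, t < u → decomps Z u = ∅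

/-- A minimal projection of `Z`. -/
structure IsMinProj (Z : StarSubalgebra ℂ (Matrix (Fin n) (Fin n) ℂ))
    (p : Matrix (Fin n) (Fin n) ℂ) : Prop where
  mem : p ∈ Z
  star_eq : star p = p
  mul_self : p * p = p
  ne_zero : p ≠ 0
  corner : ∀ a ∈ Z, ∃ c : ℂ, p * a * p = c • p

variable {Z : StarSubalgebra ℂ (Matrix (Fin n) (Fin n) ℂ)} {t u : ℕ}

theorem IsDecomp.linearIndependent {Q : Fin t → Matrix (Fin n) (Fin n) ℂ} (hQ : IsDecomp Q) :
    LinearIndependent ℂ Q := by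
  rw [Fintype.linearIndependent_iff]
  intro g hg i
  have h := congrArg (· * Q i) hg
  simp only [Finset.sum_mul, smul_mul_assoc, zero_mul] at h
  rw [Finset.sum_eq_single i, hQ.mul_self] at h
  · exact (smul_eq_zero.mp h).resolve_right (hQ.ne_zero i)
  · intro j _ hj
    rw [hQ.mul_of_ne j i hj, smul_zero]
  · intro h
    exact absurd (Finset.mem_univ i) h

theorem IsDecomp.le {Q : Fin t → Matrix (Fin n) (Fin n) ℂ} (hQ : IsDecomp Q) : t ≤ n * n := by
  simpa [Module.finrank_matrix] using hQ.linearIndependent.fintype_card_le_finrank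

theorem exists_hasLength (Z : StarSubalgebra ℂ (Matrix (Fin n) (Fin n) ℂ)) :
    ∃ t, HasLength Z t := by
  have h0 : ∃ t, (decomps Z t).Nonempty := by
    by_cases h : (1 : Matrix (Fin n) (Fin n) ℂ) = 0
    · refine ⟨0, fun i => i.elim0, ⟨fun i => i.elim0, fun i => i.elim0, fun i => i.elim0, ?_,
        fun i => i.elim0⟩, fun i => i.elim0⟩
      simp [h]
    · refine ⟨1, fun _ => 1, ⟨fun _ => star_one _, fun _ => one_mul _, fun i j hij => ?_, by simp,
        fun _ => h⟩, fun _ => one_mem Z⟩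
      exact absurd (Subsingleton.elim i j) hij
  classical
  let P : ℕ → Prop := fun t => (decomps Z t).Nonempty
  have hb : ∀ t, P t → t ≤ n * n := fun t ⟨Q, hQ⟩ => hQ.1.le
  obtain ⟨t, ht⟩ := h0
  refine ⟨Nat.findGreatest P (n * n), Nat.findGreatest_spec (P := P) (hb t ht) ht, fun u hu => ?_⟩
  by_contra hne
  have hPu : P u := Set.nonempty_iff_ne_empty.mpr hne
  exact absurd (Nat.le_findGreatest (hb u hPu) hPu) (by omega)

theorem HasLength.eq (ht : HasLength Z t) (hu : HasLength Z u) : t = u := by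
  rcases lt_trichotomy t u with h | h | h
  · exact absurd hu.1 (Set.not_nonempty_iff_eq_empty.mpr (ht.2 u h))
  · exact h
  · exact absurd ht.1 (Set.not_nonempty_iff_eq_empty.mpr (hu.2 t h))

/-- Splitting a projection of a decomposition. -/
theorem decomps_nonempty_succ {Q : Fin t → Matrix (Fin n) (Fin n) ℂ} (hQ : Q ∈ decomps Z t)
    (i : Fin t) {e : Matrix (Fin n) (Fin n) ℂ} (he : e ∈ Z) (hs : star e = e) (hee : e * e = e)
    (h0 : e ≠ 0) (h1 : e ≠ Q i) (hie : Q i * e = e) : (decomps Z (t + 1)).Nonempty := by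
  have hei : e * Q i = e := by
    have h := congrArg star hie
    rwa [star_mul, hs, hQ.1.star_eq] at h
  have hej : ∀ j, j ≠ i → e * Q j = 0 := fun j hj => by
    rw [← hei, mul_assoc, hQ.1.mul_of_ne i j hj.symm, mul_zero]
  have hje : ∀ j, j ≠ i → Q j * e = 0 := fun j hj => by
    rw [← hie, ← mul_assoc, hQ.1.mul_of_ne j i hj, zero_mul]
  refine ⟨Fin.cons e (Function.update Q i (Q i - e)), ⟨?_, ?_, ?_, ?_, ?_⟩, ?_⟩
  · refine Fin.cases hs fun j => ?_
    rw [Fin.cons_succ]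
    by_cases hj : j = i
    · subst hj
      rw [Function.update_self, star_sub, hs, hQ.1.star_eq]
    · rw [Function.update_of_ne hj, hQ.1.star_eq]
  · refine Fin.cases hee fun j => ?_
    rw [Fin.cons_succ]
    by_cases hj : j = i
    · subst hj
      rw [Function.update_self, sub_mul, mul_sub, mul_sub, hie, hei, hee, hQ.1.mul_self, sub_self,
        sub_zero]
    · rw [Function.update_of_ne hj, hQ.1.mul_self]
  · refine Fin.cases (Fin.cases (fun h => absurd rfl h) fun k _ => ?_) fun j =>
      Fin.cases (fun _ => ?_) fun k hjk => ?_
    · rw [Fin.cons_succ, Fin.cons_zero]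
      by_cases hk : k = i
      · subst hk
        rw [Function.update_self, mul_sub, hei, hee, sub_self]
      · rw [Function.update_of_ne hk, hej k hk]
    · rw [Fin.cons_succ, Fin.cons_zero]
      by_cases hj : j = i
      · subst hj
        rw [Function.update_self, sub_mul, hie, hee, sub_self]
      · rw [Function.update_of_ne hj, hje j hj]
    · rw [Fin.cons_succ, Fin.cons_succ]
      have hjk' : j ≠ k := fun h => hjk (congrArg Fin.succ h)
      by_cases hj : j = i
      · subst hj
        rw [Function.update_self, Function.update_of_ne hjk'.symm, sub_mul, hej k hjk'.symm,
          hQ.1.mul_of_ne j k hjk', sub_zero]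
      · by_cases hk : k = i
        · subst hk
          rw [Function.update_self, Function.update_of_ne hj, mul_sub, hje j hj,
            hQ.1.mul_of_ne j k hjk', sub_zero]
        · rw [Function.update_of_ne hj, Function.update_of_ne hk, hQ.1.mul_of_ne j k hjk']
  · rw [Fin.sum_univ_succ, Fin.cons_zero]
    simp only [Fin.cons_succ]
    rw [Finset.sum_update_of_mem (Finset.mem_univ i), ← hQ.1.sum_eq,
      ← Finset.add_sum_erase _ _ (Finset.mem_univ i), Finset.sdiff_singleton_eq_erase]
    abel
  · refine Fin.cases h0 fun j => ?_
    rw [Fin.cons_succ]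
    by_cases hj : j = i
    · subst hj
      rw [Function.update_self]
      exact sub_ne_zero.mpr h1.symm
    · rw [Function.update_of_ne hj]
      exact hQ.1.ne_zero j
  · refine Fin.cases he fun j => ?_
    rw [Fin.cons_succ]
    by_cases hj : j = i
    · subst hj
      rw [Function.update_self]
      exact sub_mem (hQ.2 j) he
    · rw [Function.update_of_ne hj]
      exact hQ.2 j

/-- Either a selfadjoint element of a corner `p Z p` is a multiple of `p`, or it has a spectral
projection strictly below `p`. -/
theorem exists_spectral_projection {p b : Matrix (Fin n) (Fin n) ℂ} (hb : b ∈ Z)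
    (hs : IsSelfAdjoint b) (hpb : p * b = b) (hne : ∀ c : ℂ, b ≠ c • p) :
    ∃ e ∈ Z, star e = e ∧ e * e = e ∧ e ≠ 0 ∧ e ≠ p ∧ p * e = e := by
  classical
  -- On a finite spectrum every function is continuous and agrees with an interpolating polynomial,
  -- so the functional calculus of `b` stays in `Z`.
  have hfin : (spectrum ℝ b).Finite := Matrix.finite_real_spectrum
  have hcont : ∀ f : ℝ → ℝ, ContinuousOn f (spectrum ℝ b) := fun f => hfin.continuousOn f
  have hmem : ∀ f : ℝ → ℝ, cfc f b ∈ Z := by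
    intro f
    let P := Lagrange.interpolate hfin.toFinset id f
    have hP : Set.EqOn f P.eval (spectrum ℝ b) := fun x hx => by
      have h := Lagrange.eval_interpolate_at_node (s := hfin.toFinset) (v := id) f
        (Function.injective_id.injOn) (hfin.mem_toFinset.mpr hx)
      exact h.symm
    rw [cfc_congr hP, cfc_polynomial P b]
    induction P using Polynomial.induction_on' with
    | add p q hp hq => rw [map_add]; exact add_mem hp hq
    | monomial k a =>
      rw [Polynomial.aeval_monomial, ← Algebra.smul_def, ← Complex.coe_smul]
      exact Z.smul_mem (pow_mem hb k) _
  obtain ⟨l, hl, hl0⟩ : ∃ l ∈ spectrum ℝ b, l ≠ 0 := by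
    by_contra! h
    refine hne 0 ?_
    rw [zero_smul, ← cfc_id' ℝ b hs, cfc_congr (g := fun _ => 0) fun x hx => h x hx, cfc_const_zero]
  -- The spectral projection is taken at a nonzero eigenvalue `l`, so that `e = l⁻¹ • (b * e)` lies
  -- below `p`.
  let f : ℝ → ℝ := fun x => if x = l then 1 else 0
  have hbe : b * cfc f b = l • cfc f b := by
    rw [← cfc_const_mul l f b (hcont _)]
    nth_rw 1 [← cfc_id' ℝ b hs]
    rw [← cfc_mul _ _ b (hcont _) (hcont _)]
    refine cfc_congr fun x _ => ?_
    by_cases hx : x = l <;> simp [f, hx]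
  refine ⟨cfc f b, hmem f, cfc_predicate f b, ?_, ?_, ?_, ?_⟩
  · rw [← cfc_mul f f b (hcont _) (hcont _)]
    refine cfc_congr fun x _ => ?_
    simp [f]
  · intro h
    have h1 : (1 : ℝ) ∈ spectrum ℝ (cfc f b) := by
      rw [cfc_map_spectrum f b hs (hcont _)]
      exact ⟨l, hl, if_pos rfl⟩
    rw [h, spectrum.mem_iff, sub_zero, map_one] at h1
    exact h1 isUnit_one
  · intro h
    refine hne l ?_
    have hbp := congrArg star hpb
    rw [star_mul, hs.star_eq, ← h, (cfc_predicate f b : IsSelfAdjoint _).star_eq, hbe] at hbp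
    rw [← hbp, h, Complex.coe_smul]
  · rw [← inv_smul_smul₀ hl0 (cfc f b), ← hbe, mul_smul_comm, ← mul_assoc, hpb]

/-- A nonscalar selfadjoint element of the corner would have a spectral projection strictly below `Q
i`, and splitting `Q i` by it would give `t + 1` projections. A general element is a combination of
two selfadjoint ones. -/
theorem IsMinProj.of_hasLength (h : HasLength Z t) {Q : Fin t → Matrix (Fin n) (Fin n) ℂ}
    (hQ : Q ∈ decomps Z t) (i : Fin t) : IsMinProj Z (Q i) := by
  refine ⟨hQ.2 i, hQ.1.star_eq i, hQ.1.mul_self i, hQ.1.ne_zero i, ?_⟩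
  have key : ∀ b ∈ Z, IsSelfAdjoint b → ∃ c : ℂ, Q i * b * Q i = c • Q i := by
    intro b hb hs
    by_contra! hne
    obtain ⟨e, he, hse, hee, h0, h1, hie⟩ := exists_spectral_projection (p := Q i)
      (b := Q i * b * Q i) (mul_mem (mul_mem (hQ.2 i) hb) (hQ.2 i))
      (by rw [isSelfAdjoint_iff, star_mul, star_mul, hs.star_eq, hQ.1.star_eq, mul_assoc])
      (by rw [← mul_assoc, ← mul_assoc, hQ.1.mul_self]) hne
    exact (decomps_nonempty_succ hQ i he hse hee h0 h1 hie).ne_empty (h.2 _ t.lt_succ_self)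
  intro a ha
  obtain ⟨c, hc⟩ := key (a + star a) (add_mem ha (star_mem ha)) (IsSelfAdjoint.add_star_self a)
  obtain ⟨d, hd⟩ := key (Complex.I • (a - star a))
    (Z.smul_mem (sub_mem ha (star_mem ha)) _) (by
      rw [isSelfAdjoint_iff, star_smul, star_sub, star_star, Complex.star_def, Complex.conj_I,
        neg_smul, ← smul_neg, neg_sub])
  refine ⟨(1 / 2) * c - (Complex.I / 2) * d, ?_⟩
  rw [sub_smul, mul_smul, mul_smul, ← hc, ← hd]
  simp only [mul_add, add_mul, mul_sub, sub_mul, mul_smul_comm, smul_mul_assoc, smul_add, smul_sub,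
    smul_smul]
  have hI : Complex.I / 2 * Complex.I = -(1 / 2) := by
    rw [div_mul_eq_mul_div, Complex.I_mul_I]
    ring
  rw [hI]
  module

/-- Two minimal projections of `Z` linked by an element of `Z` are equivalent. -/
theorem IsMinProj.exists_mul_star {p q a : Matrix (Fin n) (Fin n) ℂ} (hp : IsMinProj Z p)
    (hq : IsMinProj Z q) (ha : a ∈ Z) :
    ∃ c : ℂ, p * a * q * star a * p = c • p ∧ q * star a * p * a * q = c • q := by
  by_cases h0 : p * a * q = 0
  · refine ⟨0, by rw [h0]; simp, ?_⟩
    have h := congrArg star h0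
    rw [star_mul, star_mul, hp.star_eq, hq.star_eq, star_zero, ← mul_assoc] at h
    rw [h]
    simp
  · obtain ⟨c, hc⟩ := hp.corner (a * q * star a) (mul_mem (mul_mem ha hq.mem) (star_mem ha))
    obtain ⟨d, hd⟩ := hq.corner (star a * p * a) (mul_mem (mul_mem (star_mem ha) hp.mem) ha)
    simp only [← mul_assoc] at hc hd
    refine ⟨c, hc, ?_⟩
    have h1 : p * a * q * (star a * p * a * q) = c • (p * a * q) := by
      simp only [← mul_assoc]
      rw [hc, smul_mul_assoc, smul_mul_assoc]
    have h2 : p * a * q * (star a * p * a * q) = d • (p * a * q) := by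
      rw [mul_assoc (p * a), ← mul_assoc q, ← mul_assoc q, ← mul_assoc q, hd, mul_smul_comm]
    rw [h1] at h2
    rw [hd, smul_left_injective ℂ h0 h2]

theorem IsMinProj.exists_mul_star_ne_zero {p q a : Matrix (Fin n) (Fin n) ℂ} (hp : IsMinProj Z p)
    (hq : IsMinProj Z q) (ha : a ∈ Z) (h0 : p * a * q ≠ 0) :
    ∃ c : ℂ, c ≠ 0 ∧ p * a * q * star a * p = c • p ∧ q * star a * p * a * q = c • q := by
  obtain ⟨c, hc, hd⟩ := hp.exists_mul_star hq ha
  refine ⟨c, fun h => h0 ?_, hc, hd⟩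
  rw [← Matrix.self_mul_conjTranspose_eq_zero, ← Matrix.star_eq_conjTranspose, star_mul, star_mul,
    hp.star_eq, hq.star_eq, ← mul_assoc, ← mul_assoc, mul_assoc (p * a) q q, hq.mul_self, hc, h,
    zero_smul]

/-- With `v = p a q`, both `v v* = c • p` and `v* v = c • q` hold for the same `c ≠ 0`, and `v v*`
and `v* v` have equal traces. -/
theorem IsMinProj.trace_eq {p q a : Matrix (Fin n) (Fin n) ℂ} (hp : IsMinProj Z p)
    (hq : IsMinProj Z q) (ha : a ∈ Z) (h0 : p * a * q ≠ 0) : p.trace = q.trace := by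
  obtain ⟨c, h, hc, hd⟩ := hp.exists_mul_star_ne_zero hq ha h0
  have h1 := congrArg Matrix.trace hc
  have h2 := congrArg Matrix.trace hd
  rw [Matrix.trace_smul] at h1 h2
  have e1 : (p * a * q * star a * p).trace = (p * a * (q * star a * p)).trace := by
    simp only [mul_assoc]
  have e2 : (p * a * (q * star a * p)).trace = (q * star a * p * a * q).trace := by
    rw [Matrix.trace_mul_comm]
    have : q * star a * p * (p * a) = q * star a * p * a * q + q * star a * p * a * (1 - q) := by
      rw [← mul_add, add_sub_cancel, mul_one, mul_assoc (q * star a), ← mul_assoc p p,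
        hp.mul_self, ← mul_assoc]
    rw [this, Matrix.trace_add, Matrix.trace_mul_comm (q * star a * p * a) (1 - q)]
    simp only [← mul_assoc]
    rw [sub_mul, one_mul, hq.mul_self, sub_self]
    simp
  refine mul_left_cancel₀ h ?_
  rw [← smul_eq_mul, ← smul_eq_mul, ← h1, ← h2, e1, e2]

/-- Double counting. The scalars in `Q i * R j * Q i = c i j • Q i` and `R j * Q i * R j = c i j • R
j` coincide, and all row and column sums of `c` are `1`. -/
theorem card_eq_of_minimal {Q : Fin t → Matrix (Fin n) (Fin n) ℂ}
    {R : Fin u → Matrix (Fin n) (Fin n) ℂ} (hQ : IsDecomp Q) (hR : IsDecomp R)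
    (hQm : ∀ i, IsMinProj Z (Q i)) (hRm : ∀ j, IsMinProj Z (R j)) : t = u := by
  choose c hc using fun i j => (hQm i).exists_mul_star (hRm j) (one_mem Z)
  simp only [mul_one, star_one] at hc
  have h1 : ∀ i, ∑ j, c i j = 1 := fun i => by
    refine smul_left_injective ℂ (hQ.ne_zero i) ?_
    change (∑ j, c i j) • Q i = (1 : ℂ) • Q i
    rw [one_smul, Finset.sum_smul, ← Finset.sum_congr rfl fun j _ => (hc i j).1, ← Finset.sum_mul,
      ← Finset.mul_sum, hR.sum_eq, mul_one, hQ.mul_self]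
  have h2 : ∀ j, ∑ i, c i j = 1 := fun j => by
    refine smul_left_injective ℂ (hR.ne_zero j) ?_
    change (∑ i, c i j) • R j = (1 : ℂ) • R j
    rw [one_smul, Finset.sum_smul, ← Finset.sum_congr rfl fun i _ => (hc i j).2, ← Finset.sum_mul,
      ← Finset.mul_sum, hQ.sum_eq, mul_one, hR.mul_self]
  have h := Finset.sum_comm (s := Finset.univ) (t := Finset.univ) (f := c)
  simpa [h1, h2] using h

theorem HasLength.of_minimal {Q : Fin t → Matrix (Fin n) (Fin n) ℂ} (hQ : IsDecomp Q)
    (hQm : ∀ i, IsMinProj Z (Q i)) : HasLength Z t := by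
  obtain ⟨u, hu⟩ := exists_hasLength Z
  obtain ⟨R, hR⟩ := hu.1
  rwa [card_eq_of_minimal hQ hR.1 hQm fun j => IsMinProj.of_hasLength hu hR j]

theorem decomps_mono {Z' : StarSubalgebra ℂ (Matrix (Fin n) (Fin n) ℂ)} (h : Z' ≤ Z) (t : ℕ) :
    decomps Z' t ⊆ decomps Z t :=
  fun _ hQ => ⟨hQ.1, fun i => h (hQ.2 i)⟩

/-- Passing to the commutant of commuting normal elements does not change the length. -/
theorem hasLength_inf_centralizer_iff {C : Set (Matrix (Fin n) (Fin n) ℂ)} (hC : C ⊆ Z)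
    (hcomm : ∀ a ∈ C, ∀ b ∈ C, Commute a b ∧ Commute a (star b)) :
    HasLength (Z ⊓ centralizer ℂ C) t ↔ HasLength Z t := by
  have key : ∀ u, HasLength (Z ⊓ centralizer ℂ C) u → HasLength Z u := by
    intro u hu
    obtain ⟨Q, hQ⟩ := hu.1
    have hmin := fun i => IsMinProj.of_hasLength hu hQ i
    refine HasLength.of_minimal hQ.1 fun i =>
      ⟨(hQ.2 i).1, hQ.1.star_eq i, hQ.1.mul_self i, hQ.1.ne_zero i, fun a ha => ?_⟩
    have hQc : ∀ c ∈ C, c * Q i = Q i * c ∧ star c * Q i = Q i * star c :=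
      (mem_centralizer_iff ℂ).mp (hQ.2 i).2
    have hcC : ∀ c ∈ C, c ∈ Z ⊓ centralizer ℂ C := fun c hc => ⟨hC hc,
      (mem_centralizer_iff ℂ).mpr fun g hg => ⟨hcomm g hg c hc |>.1, (hcomm c hc g hg).2.symm⟩⟩
    -- Elements of `C` act on the range of `Q i` by scalars, so the whole corner of `Z` at `Q i`
    -- commutes with `C`. Hence a projection minimal in the commutant remains minimal in `Z`.
    have hscalar : ∀ c ∈ Z ⊓ centralizer ℂ C, c * Q i = Q i * c →
        c * (Q i * a * Q i) = Q i * a * Q i * c := by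
      intro c hc hcQ
      obtain ⟨l, hl⟩ := (hmin i).corner c hc
      have h1 : Q i * c = l • Q i := by rw [← hl, mul_assoc, hcQ, ← mul_assoc, hQ.1.mul_self]
      rw [← mul_assoc, ← mul_assoc, hcQ, h1, mul_assoc _ _ c, h1, smul_mul_assoc, smul_mul_assoc,
        mul_smul_comm]
    obtain ⟨l, hl⟩ := (hmin i).corner (Q i * a * Q i)
      ⟨mul_mem (mul_mem (hQ.2 i).1 ha) (hQ.2 i).1, (mem_centralizer_iff ℂ).mpr fun c hc =>
        ⟨hscalar c (hcC c hc) (hQc c hc).1,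
          hscalar (star c) (star_mem (hcC c hc)) (hQc c hc).2⟩⟩
    refine ⟨l, ?_⟩
    rwa [← mul_assoc, ← mul_assoc, hQ.1.mul_self, mul_assoc _ (Q i) (Q i), hQ.1.mul_self] at hl
  refine ⟨key t, fun h => ?_⟩
  obtain ⟨u, hu⟩ := exists_hasLength (Z ⊓ centralizer ℂ C)
  rwa [h.eq (key u hu)]

end StarSubalgebra

/-! ### Transitive fibres, and classes on an exceptional fibre -/

namespace AlexanderSpanier

open Set

/-- A closed constant cochain is a coboundary. -/
theorem exists_cobd_eq_const {Y : Type} {k : ℕ} {a : ℂ} (y₀ : Y)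
    (h : cobd (fun _ : Fin (k + 1) → Y => a) (fun _ => y₀) = 0) :
    ∃ θ : Coch Y k, (fun _ => a) = cobd θ := by
  have h0 : cobd (fun _ : Fin (k + 1) → Y => a) = 0 := by
    funext y
    rw [cobd_apply] at h ⊢
    exact h
  refine ⟨freeze y₀ fun _ => a, ?_⟩
  have h1 := freeze_cobd (fun _ : Fin (k + 1) → Y => a) y₀
  rw [h0] at h1
  exact sub_eq_zero.mp h1.symm

/-- The invariant complex of a finite transitive action is acyclic. -/
theorem AcyclicOn.of_transitive {Γ Y : Type} [TopologicalSpace Y] [T2Space Y] {act : Γ → Y → Y}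
    {F : Set Y} (hF : F.Finite) {y₀ : Y} (hy₀ : y₀ ∈ F) (h : ∀ y ∈ F, ∃ γ, act γ y₀ = y) :
    AcyclicOn act F := by
  refine ⟨⟨y₀, hy₀⟩, fun m ψ hψ hψc => ?_⟩
  have hnhds : ∀ y ∈ F, {y} ∈ 𝓝[F] y := fun y hy => by
    have h1 : (F \ {y})ᶜ ∈ 𝓝 y :=
      (hF.subset sdiff_subset).isClosed.isOpen_compl.mem_nhds fun h => h.2 rfl
    filter_upwards [mem_nhdsWithin_of_mem_nhds h1, self_mem_nhdsWithin] with z hz hzF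
    by_contra hne
    exact hz ⟨hzF, hne⟩
  have hconst : ∀ y ∈ F, ψ (fun _ => y) = ψ fun _ => y₀ := fun y hy => by
    obtain ⟨γ, rfl⟩ := h y hy
    exact congrFun (hψ γ) fun _ => y₀
  obtain ⟨θ, hθ⟩ := exists_cobd_eq_const (k := m) (a := ψ fun _ => y₀) y₀ (by
    obtain ⟨U, hU, hc⟩ := hψc y₀ hy₀
    have := hc (fun _ => y₀) fun _ => mem_of_mem_nhdsWithin hy₀ hU
    rw [cobd_apply] at this ⊢
    exact this)
  refine ⟨θ, fun y hy => ⟨{y}, hnhds y hy, fun z hz => ?_⟩⟩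
  have hzy : z = fun _ => y := funext hz
  rw [← hθ, Pi.sub_apply, hzy, hconst y hy, sub_self]

/-- Suppose that a proper map `W → G` has acyclic fibres over `O`, and that `σ` acts trivially on
the cohomology of `G` and of `W`.  If an isolated point of the complement of `O` is moved by `σ`
within this complement, then the classes on `W` restrict to zero on its fibre. -/
theorem FibreAction.exists_primitive_on_fibre {Γ : Type} [Group Γ] [Fintype Γ] {X Y : Type}
    [TopologicalSpace X] [TopologicalSpace Y] [TopologicalSpace.MetrizableSpace Y] [T2Space X]
    [LocallyCompactSpace X] {q : Y → X} {W : Set Y} {G : Set X} (D : FibreAction Γ q W G)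
    (hG : IsCompact G) (hW : IsCompact W) {σ : X → X} {σ' : Y → Y} {N : ℕ} (hσ : Continuous σ)
    (hσ' : Continuous σ') (hqσ : q ∘ σ' = σ ∘ q) (hN : N ≠ 0) (hσN : σ^[N] = id)
    (hσN' : σ'^[N] = id) (hσG : MapsTo σ G G) (hσW : MapsTo σ' W W) (hG1 : TrivOn σ G)
    (hW1 : TrivOn σ' W) {O : Set X} (hO : IsOpen O)
    (hac : ∀ x ∈ G ∩ O, AcyclicOn D.act (W ∩ q ⁻¹' {x})) {x₀ : X} (hx₀ : x₀ ∈ G) (hx₀O : x₀ ∉ O)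
    (hσx₀ : σ x₀ ∉ O) {A : Set X} (hA : IsClosed A) (hAx₀ : A ∈ 𝓝 x₀)
    (hAO : ∀ x ∈ G, x ∉ O → x ∈ A → x = x₀) (hσA : σ x₀ ∉ A) {k : ℕ} {ψ : Coch Y (k + 1)}
    (hinv : ∀ γ, pull (D.act γ) ψ = ψ) (hψ : LocZero W (cobd ψ)) :
    ∃ θ : Coch Y k, LocZero (W ∩ q ⁻¹' {x₀}) (ψ - cobd θ) := by
  -- The class is concentrated near the fibre over `x₀`: cutting along `A` kills `ψ` near the fibre
  -- over `σ x₀` and leaves it unchanged near that over `x₀`. The defect `d c` is supported in `O`.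
  let c : D.cone.C (k + 2) := D.elt 0 (cut (q ⁻¹' A) ψ) (fun h => absurd h (Nat.succ_ne_zero k))
    (fun γ => by
      rw [pull_cut, hinv, ← preimage_comp]
      congr 2
      exact congrArg (· ⁻¹' A) (funext (D.q_act γ)))
  have hqA : ∀ {B : Set X} {x : X}, B ∈ 𝓝 x → ∀ y ∈ W, q y = x → q ⁻¹' B ∈ 𝓝[W] y :=
    fun {B x} hB y _ hyx => mem_nhdsWithin_of_mem_nhds
      (D.continuous_q.continuousAt.preimage_mem_nhds (hyx.symm ▸ hB))
  have hvan0 : ∀ x ∉ A, D.cone.van c x := fun x hx => (D.van_iff c x).mpr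
    ⟨fun _ => Van.zero, fun y hy hyx => van_cut (hqA (hA.isOpen_compl.mem_nhds hx) y hy hyx) _⟩
  have hdc : ∀ x ∉ O, D.cone.van (D.cone.d c) x := fun x hx => by
    by_cases hxG : x ∈ G
    · by_cases hxA : x ∈ A
      · obtain rfl := hAO x hxG hx hxA
        refine (D.van_d_iff c x).mpr ⟨fun _ => Van.zero.cobd, fun y hy hyx => ?_⟩
        change Van _ (pull q 0 - cobd (cut (q ⁻¹' A) ψ))
        rw [map_zero, zero_sub]
        have h := ((van_cut_sub (hqA hAx₀ y hy hyx) ψ).cobd.add (hψ y hy)).neg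
        rwa [map_sub, sub_add_cancel] at h
      · exact D.cone.van_d (hvan0 x hxA)
    · exact (D.van_iff _ x).mpr ⟨fun h => absurd h hxG, fun y hy hyx =>
        absurd (hyx ▸ D.mapsTo hy) hxG⟩
  have hKG : {x | ¬ D.cone.van (D.cone.d c) x} ⊆ G := fun x hx => by
    by_contra hxG
    exact hx ((D.van_iff _ x).mpr ⟨fun h => absurd h hxG, fun y hy hyx =>
        absurd (hyx ▸ D.mapsTo hy) hxG⟩)
  -- The cone is exact over `O`, so `d c = d v` with `v` supported in `O`. Then `c - v = (φ', ψ')`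
  -- is a cone cocycle with the same germs as `c` over the complement of `O`.
  obtain ⟨v, ⟨L, hLO, -, hvL⟩, hv⟩ := LocalComplex.exists_primitive_compact_support hO
    (fun x hx => D.exactAt_cone_of_acyclicOn hac hx) (D.cone.d c)
    (hG.of_isClosed_subset (D.cone.van_open (D.cone.d c)).isClosed_compl hKG)
    (fun x hx => by
      by_contra h
      exact hx (hdc x h))
    (fun x hx => not_not.mp hx) (fun x _ => D.cone.van_d_d c x)
  have hvO : ∀ x ∉ O, D.cone.van v x := fun x hx => hvL x fun h => hx (hLO h)
  set φ' : Coch X (k + 2) := D.base (c - v)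
  set ψ' : Coch Y (k + 1) := D.top (c - v)
  have hcl : ∀ x, D.cone.van (D.cone.d (c - v)) x := fun x => by
    rw [map_sub]
    exact hv x
  have hφ' : LocZero G (cobd φ') := fun x hx => ((D.van_d_iff (c - v) x).mp (hcl x)).1 hx
  have hψ' : LocZero W (pull q φ' - cobd ψ') := fun y hy =>
    ((D.van_d_iff (c - v) _).mp (hcl (q y))).2 y hy rfl
  have hφ'O : ∀ x ∈ G, x ∉ O → Van (𝓝[G] x) φ' := fun x hx hxO =>
    Van.zero.sub (((D.van_iff v x).mp (hvO x hxO)).1 hx)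
  have hψ'₀ : ∀ y ∈ W, q y = x₀ → Van (𝓝[W] y) (ψ' - ψ) := fun y hy hyx => by
    have h := (van_cut_sub (hqA hAx₀ y hy hyx) ψ).sub
      (((D.van_iff v x₀).mp (hvO x₀ hx₀O)).2 y hy hyx)
    rwa [sub_right_comm] at h
  have hψ'σ : ∀ y ∈ W, q y = σ x₀ → Van (𝓝[W] y) ψ' := fun y hy hyx =>
    ((D.van_iff _ _).mp (D.cone.van_sub (hvan0 _ hσA) (hvO _ hσx₀))).2 y hy hyx
  -- Triviality on `G` makes `φ' - σ^* φ'` a coboundary `cobd b'`. The correction `η` of `ψ' - σ'^*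
  -- ψ'` by `q^* b'` is then a cocycle on `W` without invariant part, hence a coboundary.
  obtain ⟨b, -, -, hb⟩ := hG1 (k + 1) φ' hφ' (CSupp.of_isCompact hG φ')
  have hqW : MapsTo q W G := D.mapsTo
  have hqc : ContinuousOn q W := D.continuous_q.continuousOn
  have hpq : ∀ {m : ℕ} (f : Coch X m), pull σ' (pull q f) = pull q (pull σ f) := fun f => by
    rw [pull_pull, pull_pull, hqσ]
  have hpqj : ∀ {m : ℕ} (f : Coch X m) (j : ℕ),
      pull (σ'^[j]) (pull q f) = pull q (pull (σ^[j]) f) := fun f j => by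
    rw [pull_pull, pull_pull, (Function.Semiconj.iterate_right (f := q) (ga := σ') (gb := σ)
      (fun y => congrFun hqσ y) j).comp_eq]
  have hb' : LocZero G (φ' - pull σ φ' - cobd (cycProj σ N b)) := by
    have h0 : cycSum σ N (φ' - pull σ φ') = 0 := by rw [map_sub, cycSum_pull hσN, sub_self]
    have h1 : φ' - pull σ φ' - cobd (cycProj σ N b) = cycProj σ N (φ' - pull σ φ' - cobd b) := by
      rw [map_sub, cobd_cycProj, cycProj_of_cycSum_eq_zero h0]
    rw [h1]
    exact fun x hx => Van.cycProj hσ hσG hx fun j => hb _ (hσG.iterate j hx)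
  set b' := cycProj σ N b
  set η := ψ' - pull σ' ψ' - pull q b'
  obtain ⟨a, -, -, ha⟩ := hW1.exactOn hσ' hN hσN' hσW (c := η) (by
    have h1 := (hψ'.sub (hψ'.pull hσ'.continuousOn hσW)).sub (hb'.pull hqc hqW)
    have h2 : cobd η = -(pull q φ' - cobd ψ' - pull σ' (pull q φ' - cobd ψ') -
        pull q (φ' - pull σ φ' - cobd b')) := by
      simp only [η, map_sub, cobd_pull, hpq]
      abel
    rw [h2]
    exact fun y hy => (h1 y hy).neg) (CSupp.of_isCompact hW η) (by
    have h1 : cycSum σ' N (pull q b') = pull q (cycSum σ N b') := by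
      rw [cycSum_apply, cycSum_apply, map_sum]
      exact Finset.sum_congr rfl fun j _ => hpqj b' j
    rw [map_sub, map_sub, cycSum_pull hσN', sub_self, h1, cycSum_cycProj hN hσN, map_zero,
      sub_zero])
  -- On the fibre over `x₀` the cochain `q^* b'` is constant, and it is closed because `φ'` vanishes
  -- near `x₀` and `σ x₀`.
  obtain ⟨θ₀, hθ₀⟩ : ∃ θ₀ : Coch Y k, (fun _ => b' fun _ => x₀) = cobd θ₀ := by
    by_cases hne : Nonempty Y
    · obtain ⟨y₀⟩ := hne
      refine exists_cobd_eq_const y₀ ?_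
      have h1 := hφ'O x₀ hx₀ hx₀O
      have h2 := Van.pull (l' := 𝓝[G] x₀) (hφ'O (σ x₀) (hσG hx₀) hσx₀)
        (tendsto_nhdsWithin_of_mapsTo hσ.continuousOn hσG hx₀)
      have h3 := (h1.sub h2).sub (hb' x₀ hx₀)
      rw [sub_sub_cancel] at h3
      obtain ⟨U, hU, h⟩ := h3
      have := h (fun _ => x₀) fun _ => mem_of_mem_nhdsWithin hx₀ hU
      rw [cobd_apply] at this ⊢
      exact this
    · refine ⟨0, funext fun y => (hne ⟨y 0⟩).elim⟩
  -- On this fibre `ψ' = ψ`, while `σ'^* ψ'` vanishes because it looks at the fibre over `σ x₀`. So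
  -- `ψ = η + q^* b'` is a coboundary.
  refine ⟨θ₀ + a, fun y hy => ?_⟩
  have hFW : 𝓝[W ∩ q ⁻¹' {x₀}] y ≤ 𝓝[W] y := nhdsWithin_mono y inter_subset_left
  have h1 := (hψ'₀ y hy.1 hy.2).mono hFW
  have hyσ : q (σ' y) = σ x₀ := by
    rw [← show q y = x₀ from hy.2]
    exact congrFun hqσ y
  have h2 := ((hψ'σ (σ' y) (hσW hy.1) hyσ).pull
    (tendsto_nhdsWithin_of_mapsTo hσ'.continuousOn hσW hy.1)).mono hFW
  have h3 := (ha y hy.1).mono hFW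
  have h4 : Van (𝓝[W ∩ q ⁻¹' {x₀}] y) (pull q b' - cobd θ₀) :=
    ⟨_, self_mem_nhdsWithin, fun z hz => by
      rw [← hθ₀, Pi.sub_apply, sub_eq_zero]
      exact congrArg b' (funext fun i => (hz i).2)⟩
  have h5 := ((h3.add h4).add h2).sub h1
  convert h5 using 1
  simp only [η, map_add]
  abel

end AlexanderSpanier

/-! ### Compactness, rotations and ranks of projections -/

namespace StarSubalgebra

open Matrix

instance metrizableSpace_matrix (n : ℕ) :
    TopologicalSpace.MetrizableSpace (Matrix (Fin n) (Fin n) ℂ) :=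
  inferInstanceAs (TopologicalSpace.MetrizableSpace (Fin n → Fin n → ℂ))

instance locallyCompactSpace_matrix (n : ℕ) : LocallyCompactSpace (Matrix (Fin n) (Fin n) ℂ) :=
  inferInstanceAs (LocallyCompactSpace (Fin n → Fin n → ℂ))

variable {n t : ℕ}

theorem isCompact_matrix {S : Set (Matrix (Fin n) (Fin n) ℂ)} (hS : IsClosed S)
    (hb : ∀ A ∈ S, ∀ i j, ‖A i j‖ ≤ 1) : IsCompact S := by
  have h : IsCompact (Set.univ.pi fun _ : Fin n => Set.univ.pi fun _ : Fin n =>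
      Metric.closedBall (0 : ℂ) 1) :=
    isCompact_univ_pi fun _ => isCompact_univ_pi fun _ => isCompact_closedBall 0 1
  refine IsCompact.of_isClosed_subset (X := Fin n → Fin n → ℂ) h hS fun A hA i _ j _ => ?_
  exact mem_closedBall_zero_iff.mpr (hb A hA i j)

theorem isCompact_specialUnitaryGroup (n : ℕ) :
    IsCompact (specialUnitaryGroup (Fin n) ℂ : Set (Matrix (Fin n) (Fin n) ℂ)) := by
  refine isCompact_matrix ?_ fun A hA => entry_norm_bound_of_unitary
    (mem_specialUnitaryGroup_iff.mp hA).1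
  have h : (specialUnitaryGroup (Fin n) ℂ : Set (Matrix (Fin n) (Fin n) ℂ)) =
      {A | A * star A = 1} ∩ {A | A.det = 1} := by
    ext A
    exact mem_specialUnitaryGroup_iff.trans (and_congr_left' mem_unitaryGroup_iff)
  rw [h]
  exact (isClosed_eq (by fun_prop) continuous_const).inter
    (isClosed_eq (Continuous.matrix_det continuous_id) continuous_const)

theorem isClosed_of_matrix (Z : StarSubalgebra ℂ (Matrix (Fin n) (Fin n) ℂ)) :
    IsClosed (Z : Set (Matrix (Fin n) (Fin n) ℂ)) :=
  Submodule.closed_of_finiteDimensional (Subalgebra.toSubmodule Z.toSubalgebra)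

/-- The reflection `1 - 2 P` is unitary, so its entries have norm at most `1`. -/
theorem norm_apply_le_of_projection {P : Matrix (Fin n) (Fin n) ℂ} (hs : star P = P)
    (hP : P * P = P) (i j : Fin n) : ‖P i j‖ ≤ 1 := by
  have hU : 1 - (2 : ℂ) • P ∈ unitaryGroup (Fin n) ℂ := by
    rw [mem_unitaryGroup_iff, star_sub, star_smul, hs, star_one, Complex.star_def,
      Complex.conj_ofNat, sub_mul, mul_sub, mul_sub, one_mul, mul_one, one_mul, smul_mul_smul_comm,
      hP]
    module
  have h := entry_norm_bound_of_unitary hU i j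
  rw [Matrix.sub_apply, Matrix.smul_apply, smul_eq_mul] at h
  have h1 : ‖(1 : Matrix (Fin n) (Fin n) ℂ) i j‖ ≤ 1 := by
    rw [one_apply]
    split_ifs <;> simp
  have h2 := norm_sub_norm_le (2 * P i j) ((1 : Matrix (Fin n) (Fin n) ℂ) i j)
  rw [norm_sub_rev, norm_mul, Complex.norm_ofNat] at h2
  linarith

theorem isCompact_setOf_isDecomp (n t : ℕ) :
    IsCompact {Q : Fin t → Matrix (Fin n) (Fin n) ℂ | IsDecomp Q} := by
  have hK : IsCompact {P : Matrix (Fin n) (Fin n) ℂ | star P = P ∧ P * P = P ∧ (1 - P).det = 0} := by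
    refine isCompact_matrix ?_ fun P hP => norm_apply_le_of_projection hP.1 hP.2.1
    exact (isClosed_eq continuous_star continuous_id).inter ((isClosed_eq (by fun_prop)
      continuous_id).inter (isClosed_eq (Continuous.matrix_det (by fun_prop)) continuous_const))
  -- For an idempotent, being nonzero amounts to the closed condition `det (1 - P) = 0`; this keeps
  -- the space of decompositions compact.
  have h0 : ∀ P : Matrix (Fin n) (Fin n) ℂ, P * P = P → (P ≠ 0 ↔ (1 - P).det = 0) := by
    intro P hP
    constructor
    · intro hne
      by_contra hdet
      have hu : IsUnit (1 - P) := (isUnit_iff_isUnit_det _).mpr (isUnit_iff_ne_zero.mpr hdet)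
      refine hne (hu.mul_left_cancel ?_)
      rw [sub_mul, one_mul, hP, sub_self, mul_zero]
    · rintro hdet rfl
      simp at hdet
  have h : {Q : Fin t → Matrix (Fin n) (Fin n) ℂ | IsDecomp Q} =
      (Set.univ.pi fun _ => {P | star P = P ∧ P * P = P ∧ (1 - P).det = 0}) ∩
      ({Q | ∀ i j, i ≠ j → Q i * Q j = 0} ∩ {Q | ∑ i, Q i = 1}) := by
    ext Q
    constructor
    · exact fun hQ => ⟨fun i _ => ⟨hQ.star_eq i, hQ.mul_self i, (h0 _ (hQ.mul_self i)).mp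
        (hQ.ne_zero i)⟩, hQ.mul_of_ne, hQ.sum_eq⟩
    · rintro ⟨h1, h2, h3⟩
      exact ⟨fun i => (h1 i trivial).1, fun i => (h1 i trivial).2.1, h2, h3, fun i =>
        (h0 _ (h1 i trivial).2.1).mpr (h1 i trivial).2.2⟩
  rw [h]
  refine (isCompact_univ_pi fun _ => hK).inter_right (IsClosed.inter ?_ ?_)
  · simp only [Set.ofPred_forall]
    exact isClosed_iInter fun i => isClosed_iInter fun j => isClosed_iInter fun _ =>
      isClosed_eq (by fun_prop) continuous_const
  · exact isClosed_eq (by fun_prop) continuous_const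

theorem isCompact_decomps (Z : StarSubalgebra ℂ (Matrix (Fin n) (Fin n) ℂ)) (t : ℕ) :
    IsCompact (decomps Z t) := by
  refine (isCompact_setOf_isDecomp n t).inter_right (t := {Q | ∀ i, Q i ∈ Z}) ?_
  rw [Set.ofPred_forall]
  exact isClosed_iInter fun i => (isClosed_of_matrix Z).preimage (continuous_apply i)

/-- The map which is multiplication by `c` on the range of a projection `e` and the identity on its
kernel. -/
def rot (e : Matrix (Fin n) (Fin n) ℂ) (c : ℂ) : Matrix (Fin n) (Fin n) ℂ := 1 + (c - 1) • e

variable {e a : Matrix (Fin n) (Fin n) ℂ} {c d : ℂ}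

theorem rot_one (e : Matrix (Fin n) (Fin n) ℂ) : rot e 1 = 1 := by simp [rot]

theorem one_rot (c : ℂ) : rot (1 : Matrix (Fin n) (Fin n) ℂ) c = c • 1 := by
  rw [rot, sub_smul, one_smul, add_sub_cancel]

theorem rot_mul_rot (he : e * e = e) : rot e c * rot e d = rot e (c * d) := by
  simp only [rot, mul_add, add_mul, one_mul, mul_one, smul_mul_smul_comm, he]
  module

theorem rot_pow (he : e * e = e) (k : ℕ) : rot e c ^ k = rot e (c ^ k) := by
  induction k with
  | zero => rw [pow_zero, pow_zero, rot_one]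
  | succ k ih => rw [pow_succ, ih, rot_mul_rot he, pow_succ]

theorem star_rot (he : star e = e) : star (rot e c) = rot e (star c) := by
  simp [rot, he]

theorem rot_mem {Z : StarSubalgebra ℂ (Matrix (Fin n) (Fin n) ℂ)} (he : e ∈ Z) : rot e c ∈ Z :=
  add_mem (one_mem Z) (Z.smul_mem he _)

theorem commute_rot (h : Commute a e) : Commute a (rot e c) :=
  (Commute.one_right a).add_right (h.smul_right _)

theorem continuous_rot (e : Matrix (Fin n) (Fin n) ℂ) : Continuous (rot e) := by
  unfold rot
  fun_prop

theorem rot_mul_self (he : e * e = e) : rot e c * e = c • e := by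
  rw [rot, add_mul, smul_mul_assoc, he, one_mul, sub_smul, one_smul, add_sub_cancel]

theorem rot_mem_unitaryGroup (hs : star e = e) (he : e * e = e) (hc : ‖c‖ = 1) :
    rot e c ∈ unitaryGroup (Fin n) ℂ := by
  rw [mem_unitaryGroup_iff, star_rot hs, rot_mul_rot he, Complex.star_def, Complex.mul_conj,
    Complex.normSq_eq_norm_sq, hc]
  simp [rot_one]

/-- The rank of a projection. -/
theorem exists_rank (hs : star e = e) (he : e * e = e) :
    ∃ k : ℕ, e.trace = k ∧ ∀ c, (rot e c).det = c ^ k := by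
  classical
  have hH : e.IsHermitian := hs
  set φ := Unitary.conjStarAlgAut ℂ (Matrix (Fin n) (Fin n) ℂ) hH.eigenvectorUnitary
  set D : Matrix (Fin n) (Fin n) ℂ := diagonal (RCLike.ofReal ∘ hH.eigenvalues)
  have hφ : e = φ D := hH.spectral_theorem
  have hdet : ∀ A, (φ A).det = A.det := fun A => by
    rw [Unitary.conjStarAlgAut_apply, det_mul_comm, ← mul_assoc, Unitary.coe_star_mul_self, one_mul]
  have hl : ∀ i, hH.eigenvalues i = 0 ∨ hH.eigenvalues i = 1 := fun i => by
    have hD : D * D = D := EquivLike.injective φ (by rw [map_mul, ← hφ, he])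
    rw [diagonal_mul_diagonal] at hD
    have h := congrFun (diagonal_injective hD) i
    have h' : hH.eigenvalues i * hH.eigenvalues i = hH.eigenvalues i := by
      have : ((hH.eigenvalues i : ℝ) : ℂ) * (hH.eigenvalues i : ℝ) = (hH.eigenvalues i : ℝ) := h
      exact_mod_cast this
    exact IsIdempotentElem.iff_eq_zero_or_one.mp h'
  refine ⟨(Finset.univ.filter fun i => hH.eigenvalues i = 1).card, ?_, fun c => ?_⟩
  · rw [hH.trace_eq_sum_eigenvalues, Finset.card_filter, Nat.cast_sum]
    refine Finset.sum_congr rfl fun i _ => ?_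
    rcases hl i with h | h <;> simp [h]
  · have hr : rot e c = φ (diagonal fun i => 1 + (c - 1) * (hH.eigenvalues i : ℝ)) := by
      have : (diagonal fun i => 1 + (c - 1) * ((hH.eigenvalues i : ℝ) : ℂ)) = 1 + (c - 1) • D := by
        rw [← diagonal_one, ← diagonal_smul, diagonal_add]
        rfl
      rw [this, map_add, map_one, map_smul, ← hφ, rot]
    rw [hr, hdet, det_diagonal, Finset.card_filter, ← Finset.prod_pow_eq_pow_sum]
    refine Finset.prod_congr rfl fun i _ => ?_
    rcases hl i with h | h <;> simp [h]

/-- The path `s ↦ exp (i s θ)` on the circle. -/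
noncomputable def circ (θ s : ℝ) : ℂ := Complex.exp ((s * θ : ℝ) * Complex.I)

theorem norm_circ (θ s : ℝ) : ‖circ θ s‖ = 1 := Complex.norm_exp_ofReal_mul_I _

theorem continuous_circ (θ : ℝ) : Continuous (circ θ) := by
  unfold circ
  fun_prop

theorem circ_zero (θ : ℝ) : circ θ 0 = 1 := by simp [circ]

theorem exists_circ_eq {c : ℂ} (hc : ‖c‖ = 1) : ∃ θ, circ θ 1 = c :=
  ⟨c.arg, by
    have h := Complex.norm_mul_exp_arg_mul_I c
    rwa [hc, Complex.ofReal_one, one_mul, ← one_mul c.arg] at h⟩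

end StarSubalgebra

/-! ### Linked corners, central blocks and circle paths -/

namespace StarSubalgebra

open Matrix AlexanderSpanier

section Algebra

variable {n t : ℕ} {Z : StarSubalgebra ℂ (Matrix (Fin n) (Fin n) ℂ)}

/-- The action of permutations on families. -/
def permAct {M : Type} (γ : Equiv.Perm (Fin t)) (Q : Fin t → M) : Fin t → M := fun i => Q (γ⁻¹ i)

theorem permAct_mem_decomps {Q : Fin t → Matrix (Fin n) (Fin n) ℂ} (hQ : Q ∈ decomps Z t)
    (γ : Equiv.Perm (Fin t)) : permAct γ Q ∈ decomps Z t :=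
  ⟨⟨fun _ => hQ.1.star_eq _, fun _ => hQ.1.mul_self _,
    fun _ _ hij => hQ.1.mul_of_ne _ _ fun h => hij (γ⁻¹.injective h),
    (Equiv.sum_comp γ⁻¹ Q).trans hQ.1.sum_eq, fun _ => hQ.1.ne_zero _⟩, fun _ => hQ.2 _⟩

theorem eq_one_of_smul_idem {p : Matrix (Fin n) (Fin n) ℂ} {c : ℂ} (hp : p * p = p) (h0 : p ≠ 0)
    (hc : (c • p) * (c • p) = c • p) (hc0 : c ≠ 0) : c = 1 := by
  rw [smul_mul_smul_comm, hp] at hc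
  exact mul_eq_left₀ hc0 |>.mp (smul_left_injective ℂ h0 hc)

/-- If the corners of a maximal decomposition are not linked, it is unique up to permutation. -/
theorem exists_permAct_eq (h : HasLength Z t) {Q R : Fin t → Matrix (Fin n) (Fin n) ℂ}
    (hQ : Q ∈ decomps Z t) (hR : R ∈ decomps Z t)
    (hZ : ∀ i j, i ≠ j → ∀ a ∈ Z, Q i * a * Q j = 0) : ∃ γ, permAct γ Q = R := by
  have hQm := fun i => IsMinProj.of_hasLength h hQ i
  have hRm := fun i => IsMinProj.of_hasLength h hR i
  have key : ∀ j, ∃ i, Q i = R j := by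
    intro j
    obtain ⟨i, hi⟩ : ∃ i, Q i * R j ≠ 0 := by
      by_contra! h0
      refine hR.1.ne_zero j ?_
      rw [← one_mul (R j), ← hQ.1.sum_eq, Finset.sum_mul]
      exact Finset.sum_eq_zero fun i _ => h0 i
    obtain ⟨c, hc⟩ := (hQm i).corner (R j) (hR.2 j)
    -- Inserting `1 = ∑ₖ Q k` on the left leaves only `k = i`, since distinct corners are not
    -- linked. Idempotency then forces `c = 1`, and minimality of `R j` turns `Q i ≤ R j` into
    -- equality.
    have h1 : R j * Q i = c • Q i := by
      rw [← hc, ← one_mul (R j * Q i), ← hQ.1.sum_eq, Finset.sum_mul, Finset.sum_eq_single i,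
        mul_assoc]
      · intro k _ hk
        rw [← mul_assoc]
        exact hZ k i hk (R j) (hR.2 j)
      · exact fun h => absurd (Finset.mem_univ i) h
    have h2 : Q i * R j = c • Q i := by
      rw [← hc, ← mul_one (Q i * R j), ← hQ.1.sum_eq, Finset.mul_sum, Finset.sum_eq_single i,
        mul_assoc _ (Q i) (Q i), hQ.1.mul_self]
      · intro k _ hk
        exact hZ i k (Ne.symm hk) (R j) (hR.2 j)
      · exact fun h => absurd (Finset.mem_univ i) h
    have hc0 : c ≠ 0 := fun h0 => hi (by rw [h2, h0, zero_smul])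
    have hc1 : c = 1 := by
      refine eq_one_of_smul_idem (hQ.1.mul_self i) (hQ.1.ne_zero i) ?_ hc0
      calc (c • Q i) * (c • Q i) = c • (R j * Q i) := by
            rw [h1, smul_mul_smul_comm, hQ.1.mul_self, smul_smul]
        _ = R j * (R j * Q i) := by rw [h1, mul_smul_comm, h1]
        _ = c • Q i := by rw [← mul_assoc, hR.1.mul_self, h1]
    rw [hc1, one_smul] at h1 h2
    obtain ⟨d, hd⟩ := (hRm j).corner (Q i) (hQ.2 i)
    rw [h1, h2] at hd
    have hd1 : d = 1 := by
      refine eq_one_of_smul_idem (hR.1.mul_self j) (hR.1.ne_zero j) ?_ fun h0 => ?_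
      · rw [← hd, hQ.1.mul_self]
      · exact hQ.1.ne_zero i (by rw [hd, h0, zero_smul])
    exact ⟨i, by rw [hd, hd1, one_smul]⟩
  choose f hf using key
  have hinj : Function.Injective f := fun j k hjk => by
    by_contra hne
    have h1 := hR.1.mul_of_ne j k hne
    rw [← hf j, ← hf k, hjk, hQ.1.mul_self] at h1
    exact hQ.1.ne_zero _ h1
  refine ⟨(Equiv.ofBijective f (Finite.injective_iff_bijective.mp hinj))⁻¹, funext fun j => ?_⟩
  rw [permAct, inv_inv]
  exact hf j

/-- Linked corners of a maximal decomposition yield a nontrivial isotypic block. -/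
theorem exists_central_projection (h : HasLength Z t) {Q : Fin t → Matrix (Fin n) (Fin n) ℂ}
    (hQ : Q ∈ decomps Z t) {i₀ j₀ : Fin t} (hij : i₀ ≠ j₀) {a₀ : Matrix (Fin n) (Fin n) ℂ}
    (ha₀ : a₀ ∈ Z) (h0 : Q i₀ * a₀ * Q j₀ ≠ 0) :
    ∃ z ∈ Z, star z = z ∧ z * z = z ∧ (∀ a ∈ Z, a * z = z * a) ∧
      ∃ m : ℕ, 2 ≤ m ∧ z.trace = m * (Q i₀).trace ∧
      (∀ R ∈ decomps Z t, ∃ i, R i * z = R i ∧ (R i).trace = (Q i₀).trace) ∧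
      ∀ u ∈ Z, (∀ a ∈ Z, u * a = a * u) → ∃ c : ℂ, u * z = c • z := by
  classical
  have hQm := fun i => IsMinProj.of_hasLength h hQ i
  -- The corners linked to `Q i₀` form one isotypic class; their sum `z` is the unit of a block of
  -- `Z`.
  set S : Finset (Fin t) := Finset.univ.filter fun j => ∃ a ∈ Z, Q i₀ * a * Q j ≠ 0 with hSdef
  have hS : ∀ j, j ∈ S ↔ ∃ a ∈ Z, Q i₀ * a * Q j ≠ 0 := fun j => by simp [hSdef]
  have hi₀ : i₀ ∈ S := (hS i₀).mpr ⟨1, one_mem Z, by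
    rw [mul_one, hQ.1.mul_self]
    exact hQ.1.ne_zero i₀⟩
  have hj₀ : j₀ ∈ S := (hS j₀).mpr ⟨a₀, ha₀, h0⟩
  set z : Matrix (Fin n) (Fin n) ℂ := ∑ j ∈ S, Q j with hz
  have hzmem : z ∈ Z := sum_mem fun j _ => hQ.2 j
  have hzs : star z = z := by
    rw [hz, star_sum]
    exact Finset.sum_congr rfl fun j _ => hQ.1.star_eq j
  have hQz : ∀ j ∈ S, Q j * z = Q j := fun j hj => by
    rw [hz, Finset.mul_sum, Finset.sum_eq_single_of_mem j hj fun k _ hk => hQ.1.mul_of_ne j k hk.symm,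
      hQ.1.mul_self]
  have hzz : z * z = z := by
    nth_rw 1 [hz]
    rw [Finset.sum_mul]
    exact Finset.sum_congr rfl hQz
  -- Linking is transitive: a link from `k` to `j` composed with one from `j` to `i₀` is nonzero,
  -- because `v* v` is a nonzero multiple of `Q j`.
  have hlink : ∀ j ∈ S, ∀ k ∉ S, ∀ a ∈ Z, Q k * a * Q j = 0 := by
    intro j hj k hk a ha
    by_contra hne
    obtain ⟨b, hb, hbne⟩ := (hS j).mp hj
    obtain ⟨c, hc0, -, hc⟩ := (hQm k).exists_mul_star_ne_zero (hQm j) ha hne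
    refine hk ((hS k).mpr ⟨b * Q j * star a, mul_mem (mul_mem hb (hQ.2 j)) (star_mem ha),
      fun h1 => hbne ?_⟩)
    have h2 : Q i₀ * b * (Q j * star a * Q k * a * Q j) = 0 := by
      have := congrArg (· * (a * Q j)) h1
      simp only [zero_mul, ← mul_assoc] at this
      simpa only [← mul_assoc] using this
    rw [hc, mul_smul_comm] at h2
    exact (smul_eq_zero.mp h2).resolve_left hc0
  have hcent1 : ∀ a ∈ Z, a * z = z * a * z := by
    intro a ha
    have h1 : (1 - z) * a * z = 0 := by
      have h2 : 1 - z = ∑ k ∈ Sᶜ, Q k := by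
        rw [sub_eq_iff_eq_add, hz, add_comm, Finset.sum_add_sum_compl, hQ.1.sum_eq]
      rw [h2, hz, Finset.mul_sum]
      refine Finset.sum_eq_zero fun j hj => ?_
      rw [Finset.sum_mul, Finset.sum_mul]
      exact Finset.sum_eq_zero fun k hk => hlink j hj k (Finset.mem_compl.mp hk) a ha
    rw [sub_mul, sub_mul, one_mul, sub_eq_zero] at h1
    exact h1
  have hcent : ∀ a ∈ Z, a * z = z * a := by
    intro a ha
    have h1 := congrArg star (hcent1 (star a) (star_mem ha))
    simp only [star_mul, star_star, hzs] at h1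
    exact (hcent1 a ha).trans ((mul_assoc _ _ _).trans h1.symm)
  refine ⟨z, hzmem, hzs, hzz, hcent, S.card, ?_, ?_, ?_, ?_⟩
  · exact Finset.one_lt_card.mpr ⟨i₀, hi₀, j₀, hj₀, hij⟩
  · rw [hz, trace_sum, Finset.sum_congr rfl fun j hj => ?_, Finset.sum_const, nsmul_eq_mul]
    obtain ⟨b, hb, hbne⟩ := (hS j).mp hj
    exact ((hQm i₀).trace_eq (hQm j) hb hbne).symm
  · intro R hR
    have hRm := fun i => IsMinProj.of_hasLength h hR i
    obtain ⟨i, hi⟩ : ∃ i, R i * z ≠ 0 := by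
      by_contra! h1
      have hz0 : z = 0 := by
        rw [← one_mul z, ← hR.1.sum_eq, Finset.sum_mul]
        exact Finset.sum_eq_zero fun i _ => h1 i
      refine hQ.1.ne_zero i₀ ?_
      rw [← hQz i₀ hi₀, hz0, mul_zero]
    obtain ⟨c, hc⟩ := (hRm i).corner z hzmem
    have hRz : R i * z = c • R i := by
      rw [← hc, mul_assoc, ← hcent _ (hR.2 i), ← mul_assoc, hR.1.mul_self]
    have hc1 : c = 1 := by
      refine eq_one_of_smul_idem (hR.1.mul_self i) (hR.1.ne_zero i) ?_ fun h1 => hi (by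
        rw [hRz, h1, zero_smul])
      rw [← hRz, mul_assoc, ← mul_assoc z, ← hcent _ (hR.2 i), mul_assoc, hzz, ← mul_assoc,
        hR.1.mul_self]
    rw [hc1, one_smul] at hRz
    obtain ⟨k, hk, hRk⟩ : ∃ k ∈ S, R i * Q k ≠ 0 := by
      by_contra! h1
      refine hi ?_
      rw [hz, Finset.mul_sum]
      exact Finset.sum_eq_zero h1
    obtain ⟨b, hb, hbne⟩ := (hS k).mp hk
    refine ⟨i, hRz, ?_⟩
    rw [(hQm i₀).trace_eq (hQm k) hb hbne]
    exact (hRm i).trace_eq (hQm k) (one_mem Z) (by rwa [mul_one])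
  · intro u hu hucent
    have hc : ∀ j, ∃ c : ℂ, u * Q j = c • Q j := fun j => by
      obtain ⟨c, hc⟩ := (hQm j).corner u hu
      refine ⟨c, ?_⟩
      rw [← hc, mul_assoc, hucent _ (hQ.2 j), ← mul_assoc, hQ.1.mul_self]
    choose c hc using hc
    refine ⟨c i₀, ?_⟩
    rw [hz, Finset.mul_sum, Finset.smul_sum]
    refine Finset.sum_congr rfl fun j hj => ?_
    -- A central `u` acts on both ends of the link `Q i₀ * b * Q j` by the same scalar.
    obtain ⟨b, hb, hbne⟩ := (hS j).mp hj
    have h1 : u * (Q i₀ * b * Q j) = c i₀ • (Q i₀ * b * Q j) := by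
      rw [← mul_assoc, ← mul_assoc, hc, smul_mul_assoc, smul_mul_assoc]
    have h2 : u * (Q i₀ * b * Q j) = c j • (Q i₀ * b * Q j) := by
      rw [← mul_assoc, hucent _ (mul_mem (hQ.2 i₀) hb), mul_assoc, hc, mul_smul_comm]
    rw [hc, smul_left_injective ℂ hbne (h2.symm.trans h1)]

end Algebra

section Path

variable {n : ℕ}

theorem circ_pow (θ s : ℝ) (k : ℕ) : circ θ s ^ k = circ (k * θ) s := by
  rw [circ, circ, ← Complex.exp_nat_mul]
  congr 1
  push_cast
  ring

theorem circ_mul_circ_neg (θ s : ℝ) : circ θ s * circ (-θ) s = 1 := by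
  rw [circ, circ, ← Complex.exp_add, mul_neg, Complex.ofReal_neg, neg_mul, add_neg_cancel,
    Complex.exp_zero]

theorem circ_two_pi_one : circ (2 * Real.pi) 1 = 1 := by
  rw [circ, one_mul]
  push_cast
  exact Complex.exp_two_pi_mul_I

theorem circ_neg_two_pi_one : circ (-(2 * Real.pi)) 1 = 1 := by
  have h := circ_mul_circ_neg (2 * Real.pi) 1
  rwa [circ_two_pi_one, one_mul] at h

theorem circ_root_ne_one {m : ℕ} (hm : 2 ≤ m) : circ (2 * Real.pi / m) 1 ≠ 1 := by
  have h := (Complex.isPrimitiveRoot_exp m (by omega)).ne_one hm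
  rw [circ, one_mul]
  push_cast
  rwa [div_mul_eq_mul_div]

theorem circ_root_pow {m : ℕ} (hm : m ≠ 0) (s : ℝ) :
    circ (2 * Real.pi / m) s ^ m = circ (2 * Real.pi) s := by
  rw [circ_pow, mul_div_cancel₀ _ (Nat.cast_ne_zero.mpr hm)]

theorem rot_mul_of_mul_eq_zero {e x : Matrix (Fin n) (Fin n) ℂ} {c : ℂ} (h : e * x = 0) :
    rot e c * x = x := by
  rw [rot, add_mul, one_mul, smul_mul_assoc, h, smul_zero, add_zero]

theorem trace_ne_zero {e : Matrix (Fin n) (Fin n) ℂ} (hs : star e = e) (he : e * e = e)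
    (h0 : e ≠ 0) : e.trace ≠ 0 := by
  obtain ⟨k, hk, hdet⟩ := exists_rank hs he
  rw [hk]
  rintro hk0
  rw [Nat.cast_eq_zero] at hk0
  subst hk0
  have hu : IsUnit (rot e 0) := (isUnit_iff_isUnit_det _).mpr (by
    rw [hdet]
    simp)
  refine h0 (hu.mul_left_cancel ?_)
  rw [rot_mul_self he, zero_smul, mul_zero]

end Path

end StarSubalgebra

/-! ### Acyclicity of the space of maximal decompositions -/

namespace StarSubalgebra

open Matrix AlexanderSpanier Set

section

variable {n t : ℕ}

/-- The special unitary elements of `Z` acting trivially outside a central projection `z`. -/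
def blockSU (Z : StarSubalgebra ℂ (Matrix (Fin n) (Fin n) ℂ)) (z : Matrix (Fin n) (Fin n) ℂ) :
    Set (Matrix (Fin n) (Fin n) ℂ) :=
  {u | u ∈ specialUnitaryGroup (Fin n) ℂ ∧ u ∈ Z ∧ u * (1 - z) = 1 - z}

/-- Pairs of an element of `blockSU Z z` and a decomposition commuting with it. -/
def blockPairs (Z : StarSubalgebra ℂ (Matrix (Fin n) (Fin n) ℂ)) (z : Matrix (Fin n) (Fin n) ℂ)
    (t : ℕ) : Set (Matrix (Fin n) (Fin n) ℂ × (Fin t → Matrix (Fin n) (Fin n) ℂ)) :=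
  {p | p.1 ∈ blockSU Z z ∧ p.2 ∈ decomps Z t ∧ ∀ i, p.1 * p.2 i = p.2 i * p.1}

variable {Z : StarSubalgebra ℂ (Matrix (Fin n) (Fin n) ℂ)} {z : Matrix (Fin n) (Fin n) ℂ}

theorem isCompact_blockSU (Z : StarSubalgebra ℂ (Matrix (Fin n) (Fin n) ℂ))
    (z : Matrix (Fin n) (Fin n) ℂ) : IsCompact (blockSU Z z) :=
  (isCompact_specialUnitaryGroup n).inter_right ((isClosed_of_matrix Z).inter
    (isClosed_eq (f := fun u => u * (1 - z)) (by fun_prop) continuous_const))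

theorem isCompact_blockPairs (Z : StarSubalgebra ℂ (Matrix (Fin n) (Fin n) ℂ))
    (z : Matrix (Fin n) (Fin n) ℂ) (t : ℕ) : IsCompact (blockPairs Z z t) := by
  have h : blockPairs Z z t = blockSU Z z ×ˢ decomps Z t ∩
      ⋂ i, {p | p.1 * p.2 i = p.2 i * p.1} := by
    ext p
    simp only [blockPairs, mem_ofPred_eq, mem_inter_iff, mem_prod, mem_iInter, and_assoc]
  rw [h]
  exact ((isCompact_blockSU Z z).prod (isCompact_decomps Z t)).inter_right
    (isClosed_iInter fun i => isClosed_eq (by fun_prop) (by fun_prop))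

theorem mul_mem_blockSU {u v : Matrix (Fin n) (Fin n) ℂ} (hu : u ∈ blockSU Z z)
    (hv : v ∈ blockSU Z z) : u * v ∈ blockSU Z z :=
  ⟨mul_mem hu.1 hv.1, mul_mem hu.2.1 hv.2.1, by rw [mul_assoc, hv.2.2, hu.2.2]⟩

/-- The resolution of `blockSU Z z` by pairs. -/
noncomputable def blockAction (Z : StarSubalgebra ℂ (Matrix (Fin n) (Fin n) ℂ))
    (z : Matrix (Fin n) (Fin n) ℂ) (t : ℕ) :
    FibreAction (Equiv.Perm (Fin t)) (Prod.fst : _ × (Fin t → Matrix (Fin n) (Fin n) ℂ) → _)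
      (blockPairs Z z t) (blockSU Z z) where
  act γ p := (p.1, permAct γ p.2)
  act_mul _ _ _ := rfl
  continuous_act γ := continuous_fst.prodMk (continuous_pi fun i =>
    (continuous_apply (γ⁻¹ i)).comp continuous_snd)
  mapsTo_act γ _ hp := ⟨hp.1, permAct_mem_decomps hp.2.1 γ, fun _ => hp.2.2 _⟩
  q_act _ _ := rfl
  continuous_q := continuous_fst
  isProperMap := isProperMap_restrict (isCompact_blockPairs Z z t) continuousOn_fst
  mapsTo _ hp := hp.1
  isClosed := (isCompact_blockSU Z z).isClosed

/-- The path `s ↦ exp (2 π i s (z / m - e))`. -/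
noncomputable def blockPath (z e : Matrix (Fin n) (Fin n) ℂ) (m : ℕ) (s : ℝ) :
    Matrix (Fin n) (Fin n) ℂ :=
  rot z (circ (2 * Real.pi / m) s) * rot e (circ (-(2 * Real.pi)) s)

theorem continuous_blockPath (z e : Matrix (Fin n) (Fin n) ℂ) (m : ℕ) :
    Continuous (blockPath z e m) :=
  ((continuous_rot z).comp (continuous_circ _)).mul ((continuous_rot e).comp (continuous_circ _))

theorem blockPath_zero (z e : Matrix (Fin n) (Fin n) ℂ) (m : ℕ) : blockPath z e m 0 = 1 := by
  rw [blockPath, circ_zero, circ_zero, rot_one, rot_one, one_mul]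

/-- The factor of `e` closes up at `s = 1`, so the end point does not depend on `e`. Paths built
from different projections all lead to the same central element. -/
theorem blockPath_one (z e : Matrix (Fin n) (Fin n) ℂ) (m : ℕ) :
    blockPath z e m 1 = rot z (circ (2 * Real.pi / m) 1) := by
  rw [blockPath, circ_neg_two_pi_one, rot_one, mul_one]

/-- The determinant is `exp (2 π i s (tr z / m - tr e))`, which is `1` by `htr`. -/
theorem blockPath_mem {e : Matrix (Fin n) (Fin n) ℂ} {m : ℕ} (hm : m ≠ 0) (hz : z ∈ Z)
    (hzs : star z = z) (hzz : z * z = z) (he : e ∈ Z) (hes : star e = e) (hee : e * e = e)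
    (hez : e * z = e) (htr : z.trace = m * e.trace) (s : ℝ) : blockPath z e m s ∈ blockSU Z z := by
  obtain ⟨k, hk, hkdet⟩ := exists_rank hes hee
  obtain ⟨l, hl, hldet⟩ := exists_rank hzs hzz
  have hlk : l = m * k := by
    rw [hl, hk] at htr
    exact_mod_cast htr
  refine ⟨mem_specialUnitaryGroup_iff.mpr ⟨mul_mem (rot_mem_unitaryGroup hzs hzz (norm_circ _ _))
    (rot_mem_unitaryGroup hes hee (norm_circ _ _)), ?_⟩, mul_mem (rot_mem hz) (rot_mem he), ?_⟩
  · rw [blockPath, det_mul, hkdet, hldet, hlk, pow_mul, circ_root_pow hm, ← mul_pow,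
      circ_mul_circ_neg, one_pow]
  · rw [blockPath, mul_assoc, rot_mul_of_mul_eq_zero (e := e) (by
      rw [mul_sub, mul_one, hez, sub_self]), rot_mul_of_mul_eq_zero (by
      rw [mul_sub, mul_one, hzz, sub_self])]

theorem commute_blockPath {a e : Matrix (Fin n) (Fin n) ℂ} {m : ℕ} (haz : Commute a z)
    (hae : Commute a e) (s : ℝ) : Commute a (blockPath z e m s) :=
  (commute_rot haz).mul_right (commute_rot hae)

/-- Only finitely many rotations `rot z c` have `c ^ k = 1`. The central elements of `blockSU Z z`
are of this form, with `k` the rank of `z`, so `1` is isolated among them. -/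
theorem exists_isClosed_nhds_one {k : ℕ} (hk : k ≠ 0) (z : Matrix (Fin n) (Fin n) ℂ) :
    ∃ A : Set (Matrix (Fin n) (Fin n) ℂ), IsClosed A ∧ A ∈ 𝓝 1 ∧
      ∀ c : ℂ, c ^ k = 1 → rot z c ∈ A → rot z c = 1 := by
  have hfin : (rot z '' {c | c ^ k = 1} \ {1}).Finite := by
    refine (Set.Finite.image _ ?_).subset sdiff_subset
    refine (Polynomial.nthRootsFinset k (1 : ℂ)).finite_toSet.subset fun c hc => ?_
    exact (Polynomial.mem_nthRootsFinset (Nat.pos_of_ne_zero hk) _).mpr hc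
  obtain ⟨A, ⟨hA, hAc⟩, hsub⟩ := (closed_nhds_basis (1 : Matrix (Fin n) (Fin n) ℂ)).mem_iff.mp
    (hfin.isClosed.isOpen_compl.mem_nhds fun h => h.2 rfl)
  refine ⟨A, hAc, hA, fun c hc hcA => ?_⟩
  by_contra hne
  exact hsub hcA ⟨⟨c, hc, rfl⟩, hne⟩

theorem finrank_inf_centralizer_lt {u a : Matrix (Fin n) (Fin n) ℂ} (ha : a ∈ Z)
    (hua : u * a ≠ a * u) :
    Module.finrank ℂ (Subalgebra.toSubmodule (Z ⊓ centralizer ℂ {u}).toSubalgebra) <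
      Module.finrank ℂ (Subalgebra.toSubmodule Z.toSubalgebra) := by
  refine Submodule.finrank_lt_finrank_of_lt (lt_of_le_of_ne (fun x hx => hx.1) fun h => ?_)
  have h1 : a ∈ Subalgebra.toSubmodule (Z ⊓ centralizer ℂ {u}).toSubalgebra := by
    rw [h]
    exact ha
  exact hua ((mem_centralizer_iff ℂ).mp h1.2 u rfl).1

theorem mem_decomps_inf_centralizer_iff {u : Matrix (Fin n) (Fin n) ℂ}
    {R : Fin t → Matrix (Fin n) (Fin n) ℂ} :
    R ∈ decomps (Z ⊓ centralizer ℂ {u}) t ↔ R ∈ decomps Z t ∧ ∀ i, u * R i = R i * u := by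
  constructor
  · exact fun h => ⟨⟨h.1, fun i => (h.2 i).1⟩, fun i =>
      ((mem_centralizer_iff ℂ).mp (h.2 i).2 u rfl).1⟩
  · refine fun h => ⟨h.1.1, fun i => ⟨h.1.2 i, (mem_centralizer_iff ℂ).mpr ?_⟩⟩
    rintro _ rfl
    refine ⟨h.2 i, ?_⟩
    have h1 := congrArg star (h.2 i)
    rwa [star_mul, star_mul, h.1.1.star_eq, eq_comm] at h1

/-- The space of maximal decompositions is acyclic for invariant cochains. -/
theorem acyclicOn_decomps {Z : StarSubalgebra ℂ (Matrix (Fin n) (Fin n) ℂ)} {t : ℕ}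
    (h : HasLength Z t) : AcyclicOn permAct (decomps Z t) := by
  induction hd : Module.finrank ℂ (Subalgebra.toSubmodule Z.toSubalgebra) using
    Nat.strong_induction_on generalizing Z with
  | _ d ih =>
  obtain ⟨Q, hQ⟩ := h.1
  by_cases hcomm : ∀ i j, i ≠ j → ∀ a ∈ Z, Q i * a * Q j = 0
  -- Without links, the maximal decompositions form a single finite orbit of the permutations.
  · have htrans : ∀ R ∈ decomps Z t, ∃ γ, permAct γ Q = R := fun R hR =>
      exists_permAct_eq h hQ hR hcomm
    refine AcyclicOn.of_transitive ?_ hQ htrans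
    exact (finite_range fun γ : Equiv.Perm (Fin t) => permAct γ Q).subset htrans
  push Not at hcomm
  obtain ⟨i₀, j₀, hij, a₀, ha₀, h0⟩ := hcomm
  obtain ⟨z, hz, hzs, hzz, hcent, m, hm, htr, hmin, hscal⟩ :=
    exists_central_projection h hQ hij ha₀ h0
  have hm0 : m ≠ 0 := by omega
  obtain ⟨k, hk, hkdet⟩ := exists_rank (hQ.1.star_eq i₀) (hQ.1.mul_self i₀)
  obtain ⟨l, hl, hldet⟩ := exists_rank hzs hzz
  have hlm : l ≠ 0 := by
    have h1 : z.trace ≠ 0 := by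
      rw [htr]
      exact mul_ne_zero (Nat.cast_ne_zero.mpr hm0)
        (trace_ne_zero (hQ.1.star_eq i₀) (hQ.1.mul_self i₀) (hQ.1.ne_zero i₀))
    rw [hl] at h1
    exact_mod_cast h1
  have hz0 : z ≠ 0 := by
    rintro rfl
    rw [trace_zero] at hl
    exact hlm (by exact_mod_cast hl.symm)
  -- The translation is by the central element `μ` acting on the block of `z` as a primitive `m`-th
  -- root of unity. It differs from `1` because `m ≥ 2`, and it is the end point of every
  -- `blockPath`.
  set ζ : ℂ := circ (2 * Real.pi / m) 1
  have hζ : ζ ^ m = 1 := by rw [circ_root_pow hm0, circ_two_pi_one]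
  set μ := rot z ζ
  have hμm : μ ^ m = 1 := by rw [rot_pow hzz, hζ, rot_one]
  have hμ1 : μ ≠ 1 := fun h1 => circ_root_ne_one hm <| by
    have h2 := rot_mul_self (c := ζ) hzz
    rw [show rot z ζ = 1 from h1, one_mul] at h2
    exact (smul_left_injective ℂ hz0 (by simpa using h2)).symm
  have hpath : ∀ R ∈ decomps Z t, ∃ i, ∀ s, blockPath z (R i) m s ∈ blockSU Z z := fun R hR => by
    obtain ⟨i, hi, hi'⟩ := hmin R hR
    exact ⟨i, blockPath_mem hm0 hz hzs hzz (hR.2 i) (hR.1.star_eq i) (hR.1.mul_self i) hi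
      (by rw [htr, hi'])⟩
  have hμG : μ ∈ blockSU Z z := by
    obtain ⟨i, hi⟩ := hpath Q hQ
    have h1 := hi 1
    rwa [blockPath_one] at h1
  have hμcent : ∀ a ∈ Z, μ * a = a * μ := fun a ha => (commute_rot (hcent a ha)).symm
  have h1G : (1 : Matrix (Fin n) (Fin n) ℂ) ∈ blockSU Z z := ⟨one_mem _, one_mem Z, one_mul _⟩
  set σ : Matrix (Fin n) (Fin n) ℂ → Matrix (Fin n) (Fin n) ℂ := fun u => μ * u
  have hσ : Continuous σ := by fun_prop
  have hσN : σ^[m] = id := by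
    funext u
    rw [mul_left_iterate, hμm]
    exact one_mul u
  have hσG : MapsTo σ (blockSU Z z) (blockSU Z z) := fun u hu => mul_mem_blockSU hμG hu
  set σ' : Matrix (Fin n) (Fin n) ℂ × (Fin t → Matrix (Fin n) (Fin n) ℂ) → _ := Prod.map σ id
  have hσ' : Continuous σ' := hσ.prodMap continuous_id
  have hσN' : σ'^[m] = id := by
    rw [Prod.map_iterate, hσN, Function.iterate_id, Prod.map_id]
  have hpairs : ∀ v ∈ blockSU Z z, ∀ p ∈ blockPairs Z z t, (∀ i, v * p.2 i = p.2 i * v) →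
      (v * p.1, p.2) ∈ blockPairs Z z t := fun v hv p hp hvp =>
    ⟨mul_mem_blockSU hv hp.1, hp.2.1, fun i => by
      rw [mul_assoc, hp.2.2, ← mul_assoc, hvp, mul_assoc]⟩
  have hσW : MapsTo σ' (blockPairs Z z t) (blockPairs Z z t) := fun p hp =>
    hpairs μ hμG p hp fun i => hμcent _ (hp.2.1.2 i)
  have hG1 : TrivOn σ (blockSU Z z) := by
    obtain ⟨i, hi⟩ := hpath Q hQ
    refine TrivOn.of_homotopy (isCompact_blockSU Z z) (fun s u => blockPath z (Q i) m s * u)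
      (((continuous_blockPath _ _ _).comp continuous_fst).mul continuous_snd)
      (fun s u hu => mul_mem_blockSU (hi s) hu) (fun u => ?_) fun u => ?_
    · rw [blockPath_zero, one_mul]
    · rw [blockPath_one]
  -- Over a fixed `R` the path is built from a projection `R i` below `z`. It commutes with all of
  -- `R`, so it acts within the fibre.
  have hW1 : TrivOn σ' (blockPairs Z z t) := by
    refine TrivOn.of_fibres hσ' hm0 hσN' hσW Prod.snd (fun _ => rfl)
      (isProperMap_restrict (isCompact_blockPairs Z z t) continuousOn_snd) fun R => ?_
    by_cases hR : R ∈ decomps Z t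
    · obtain ⟨i, hi⟩ := hpath R hR
      refine TrivOn.of_homotopy ((isCompact_blockPairs Z z t).inter_right
        (isClosed_singleton.preimage continuous_snd))
        (fun s p => (blockPath z (R i) m s * p.1, p.2))
        ((((continuous_blockPath _ _ _).comp continuous_fst).mul
          (continuous_fst.comp continuous_snd)).prodMk (continuous_snd.comp continuous_snd))
        (fun s p hp => ⟨hpairs _ (hi s) p hp.1 fun j => ?_, hp.2⟩) (fun u => ?_) fun u => ?_
      · obtain rfl : p.2 = R := hp.2
        refine (commute_blockPath (hcent _ (hR.2 j)) ?_ s).symm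
        by_cases hj : j = i
        · rw [hj]
        · exact (hR.1.mul_of_ne j i hj).trans (hR.1.mul_of_ne i j (Ne.symm hj)).symm
      · rw [blockPath_zero, one_mul]
      · rw [blockPath_one]
        rfl
    · have hemp : blockPairs Z z t ∩ Prod.snd ⁻¹' {R} = ∅ :=
        eq_empty_of_forall_notMem fun p hp => hR (hp.2 ▸ hp.1.2.1)
      rw [hemp]
      exact fun m c _ _ => ExactOn.of_locZero fun y hy => absurd hy (notMem_empty y)
  obtain ⟨A, hA, hA1, hAk⟩ := exists_isClosed_nhds_one hlm z
  -- `O` is the set of matrices not commuting with all of `Z`. Over `blockSU Z z ∩ O` the fibres are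
  -- the maximal decompositions of the strictly smaller algebra of elements commuting with `u`, to
  -- which the induction applies.
  set O : Set (Matrix (Fin n) (Fin n) ℂ) := {u | ∀ a ∈ Z, u * a = a * u}ᶜ
  have hO : IsOpen O := by
    rw [isOpen_compl_iff]
    simp only [ofPred_forall]
    exact isClosed_iInter fun a => isClosed_iInter fun _ => isClosed_eq (by fun_prop) (by fun_prop)
  have hmemO : ∀ u, u ∉ O ↔ ∀ a ∈ Z, u * a = a * u := fun u => notMem_compl_iff
  have hAO : ∀ u ∈ blockSU Z z, u ∉ O → u ∈ A → u = 1 := by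
    intro u hu huO huA
    obtain ⟨c, hc⟩ := hscal u hu.2.1 ((hmemO u).mp huO)
    have hur : u = rot z c := by
      have h1 := hu.2.2
      rw [mul_sub, mul_one, hc, sub_eq_iff_eq_add] at h1
      rw [h1, rot]
      module
    rw [hur] at huA hu ⊢
    refine hAk c ?_ huA
    rw [← hldet]
    exact (mem_specialUnitaryGroup_iff.mp hu.1).2
  have hac : ∀ u ∈ blockSU Z z ∩ O, AcyclicOn (blockAction Z z t).act
      (blockPairs Z z t ∩ Prod.fst ⁻¹' {u}) := by
    rintro u ⟨hu, huO⟩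
    have hu' : ¬ ∀ a ∈ Z, u * a = a * u := huO
    push Not at hu'
    obtain ⟨a, ha, hua⟩ := hu'
    have huu := (mem_specialUnitaryGroup_iff.mp hu.1).1
    have hlen : HasLength (Z ⊓ centralizer ℂ {u}) t := by
      refine (hasLength_inf_centralizer_iff (singleton_subset_iff.mpr hu.2.1) ?_).mpr h
      rintro _ rfl _ rfl
      exact ⟨Commute.refl _, (mem_unitaryGroup_iff.mp huu).trans (mem_unitaryGroup_iff'.mp huu).symm⟩
    refine (ih _ (hd ▸ finrank_inf_centralizer_lt ha hua) hlen rfl).of_retract (f := Prod.snd)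
      (g := fun R => (u, R)) continuousOn_snd (by fun_prop) ?_ ?_ ?_ fun γ R => rfl
    · rintro ⟨_, R⟩ ⟨hp, rfl⟩
      exact mem_decomps_inf_centralizer_iff.mpr hp.2
    · intro R hR
      exact ⟨⟨hu, mem_decomps_inf_centralizer_iff.mp hR⟩, rfl⟩
    · rintro ⟨_, R⟩ ⟨hp, rfl⟩
      rfl
  refine ⟨h.1, fun k ψ hψ hψc => ?_⟩
  have hμO : σ 1 ∉ O := (hmemO _).mpr fun a ha => by
    change μ * 1 * a = a * (μ * 1)
    rw [mul_one, hμcent a ha]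
  -- The cocycle `ψ` extends to all pairs by pull-back along `(u, R) ↦ R`. Its restriction to the
  -- fibre over `u = 1`, which is all of `decomps Z t`, is `ψ` again.
  obtain ⟨θ, hθ⟩ := (blockAction Z z t).exists_primitive_on_fibre (isCompact_blockSU Z z)
    (isCompact_blockPairs Z z t) hσ hσ' rfl hm0 hσN hσN' hσG hσW hG1 hW1 hO hac h1G
    ((hmemO 1).mpr fun a _ => by rw [one_mul, mul_one]) hμO hA hA1 hAO
    (fun h1 => hμ1 ((mul_one μ).symm.trans (hAO _ (hσG h1G) hμO h1)))
    (ψ := pull Prod.snd ψ) (fun γ => by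
      rw [pull_pull]
      exact congrArg (pull Prod.snd) (hψ γ))
    (hψc.pull continuousOn_snd fun p hp => hp.2.1)
  refine ⟨pull (fun R => (1, R)) θ, ?_⟩
  exact hθ.pull (f := fun R => ((1 : Matrix (Fin n) (Fin n) ℂ), R)) (by fun_prop) fun R hR =>
    ⟨⟨h1G, hR, fun i => by rw [one_mul, mul_one]⟩, rfl⟩

end

end StarSubalgebra

/-! ### Merging decompositions, and rank one projections -/

namespace StarSubalgebra

open Matrix AlexanderSpanier Set

section Merge

variable {n t u : ℕ}

/-- The sums of a family over the fibres of a map of index sets. -/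
def merge (f : Fin u → Fin t) (R : Fin u → Matrix (Fin n) (Fin n) ℂ) :
    Fin t → Matrix (Fin n) (Fin n) ℂ :=
  fun j => ∑ i, (if f i = j then (1 : ℂ) else 0) • R i

variable {R : Fin u → Matrix (Fin n) (Fin n) ℂ} {f : Fin u → Fin t}

theorem merge_mul (hR : IsDecomp R) (j : Fin t) (i : Fin u) :
    merge f R j * R i = if f i = j then R i else 0 := by
  rw [merge, Finset.sum_mul, Finset.sum_eq_single i]
  · rw [smul_mul_assoc, hR.mul_self]
    split_ifs <;> simp
  · intro k _ hk
    rw [smul_mul_assoc, hR.mul_of_ne k i hk, smul_zero]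
  · exact fun h => absurd (Finset.mem_univ i) h

theorem star_merge (hR : IsDecomp R) (j : Fin t) : star (merge f R j) = merge f R j := by
  rw [merge, star_sum]
  refine Finset.sum_congr rfl fun i _ => ?_
  rw [star_smul, hR.star_eq]
  split_ifs <;> simp

theorem mul_merge (hR : IsDecomp R) (j : Fin t) (i : Fin u) :
    R i * merge f R j = if f i = j then R i else 0 := by
  have h := congrArg star (merge_mul (f := f) hR j i)
  rw [star_mul, star_merge hR, hR.star_eq] at h
  rw [h]
  split_ifs <;> simp [hR.star_eq]

theorem IsDecomp.merge (hR : IsDecomp R) (hf : Function.Surjective f) :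
    IsDecomp (StarSubalgebra.merge f R) where
  star_eq := star_merge hR
  mul_self j := by
    nth_rw 2 [StarSubalgebra.merge]
    rw [Finset.mul_sum]
    refine Finset.sum_congr rfl fun i _ => ?_
    rw [mul_smul_comm, merge_mul hR]
    split_ifs <;> simp
  mul_of_ne j k hjk := by
    nth_rw 2 [StarSubalgebra.merge]
    rw [Finset.mul_sum]
    refine Finset.sum_eq_zero fun i _ => ?_
    rw [mul_smul_comm, merge_mul hR]
    split_ifs with h1 h2
    · exact absurd (h2.symm.trans h1) hjk
    · simp
    · simp
    · simp
  sum_eq := by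
    simp only [StarSubalgebra.merge]
    rw [Finset.sum_comm, ← hR.sum_eq]
    refine Finset.sum_congr rfl fun i _ => ?_
    rw [← Finset.sum_smul, Finset.sum_ite_eq, if_pos (Finset.mem_univ _), one_smul]
  ne_zero j h0 := by
    obtain ⟨i, rfl⟩ := hf j
    have h := merge_mul (f := f) hR (f i) i
    rw [h0, zero_mul, if_pos rfl] at h
    exact hR.ne_zero i h.symm

theorem merge_permAct (γ : Equiv.Perm (Fin u)) :
    merge (permAct γ f) (permAct γ R) = merge f R :=
  funext fun j => Equiv.sum_comp γ⁻¹ fun i => (if f i = j then (1 : ℂ) else 0) • R i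

theorem continuous_merge :
    Continuous fun p : (Fin u → Matrix (Fin n) (Fin n) ℂ) × (Fin u → Fin t) => merge p.2 p.1 := by
  refine continuous_pi fun j => continuous_finsetSum _ fun i _ => ?_
  have h : Continuous fun k : Fin t => if k = j then (1 : ℂ) else 0 := continuous_of_discreteTopology
  exact (h.comp ((continuous_apply i).comp continuous_snd)).smul
    ((continuous_apply i).comp continuous_fst)

open Classical in
/-- The index of the projection of the family `Q` above `P`. -/
noncomputable def indexAbove (Q : Fin t → Matrix (Fin n) (Fin n) ℂ) (j₀ : Fin t)
    (P : Matrix (Fin n) (Fin n) ℂ) : Fin t :=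
  if h : ∃ j, Q j * P = P then h.choose else j₀

variable {Q : Fin t → Matrix (Fin n) (Fin n) ℂ} {j₀ j : Fin t} {P : Matrix (Fin n) (Fin n) ℂ}

theorem indexAbove_eq (hP : P ≠ 0) (h : ∀ k, Q k * P = if j = k then P else 0) :
    indexAbove Q j₀ P = j := by
  have hex : ∃ j, Q j * P = P := ⟨j, by rw [h, if_pos rfl]⟩
  rw [indexAbove, dif_pos hex]
  by_contra hne
  have h1 := hex.choose_spec
  rw [h, if_neg (Ne.symm hne)] at h1
  exact hP h1.symm

/-- For `P` below `Q j`, the inequalities `Q k * P' ≠ P'` with `k ≠ j` are open conditions on `P'`.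
So the index is locally constant on projections lying below one member of `Q`. -/
theorem continuousOn_indexAbove (Q : Fin t → Matrix (Fin n) (Fin n) ℂ) (j₀ : Fin t) :
    ContinuousOn (indexAbove Q j₀)
      {P | P ≠ 0 ∧ ∃ j, ∀ k, Q k * P = if j = k then P else 0} := by
  rintro P ⟨hP, j, hj⟩
  have hU : {P' : Matrix (Fin n) (Fin n) ℂ | ∀ k, k ≠ j → Q k * P' ≠ P'} ∈ 𝓝 P := by
    refine IsOpen.mem_nhds ?_ fun k hk => ?_
    · simp only [ofPred_forall]
      exact isOpen_iInter_of_finite fun k => isOpen_iInter_of_finite fun _ =>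
        isOpen_ne_fun (by fun_prop) continuous_id
    · rw [hj, if_neg hk.symm]
      exact hP.symm
  refine Filter.Tendsto.congr' ?_ tendsto_const_nhds
  filter_upwards [mem_nhdsWithin_of_mem_nhds hU, self_mem_nhdsWithin] with P' hP' h
  obtain ⟨hP'0, k, hk⟩ := h
  have hkj : k = j := by
    by_contra hne
    exact hP' k hne (by rw [hk, if_pos rfl])
  rw [indexAbove_eq hP'0 hk, indexAbove_eq hP hj, hkj]

end Merge

section Rank

variable {n t : ℕ}

theorem IsDecomp.pos (hn : n ≠ 0) {Q : Fin t → Matrix (Fin n) (Fin n) ℂ} (hQ : IsDecomp Q) :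
    t ≠ 0 := by
  rintro rfl
  have h := congrArg Matrix.trace hQ.sum_eq
  simp only [Finset.univ_eq_empty, Finset.sum_empty, trace_zero, trace_one, Fintype.card_fin] at h
  exact hn (by exact_mod_cast h.symm)

theorem exists_mulVec_ne_zero {P : Matrix (Fin n) (Fin n) ℂ} (hP : P ≠ 0) :
    ∃ w, P *ᵥ w ≠ 0 := by
  by_contra! h
  refine hP (Matrix.ext_of_mulVec_single fun k => ?_)
  rw [h, zero_mulVec]

/-- The orthogonal projection onto a line. -/
theorem exists_projection_onto {v : Fin n → ℂ} (hv : v ≠ 0) :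
    ∃ e : Matrix (Fin n) (Fin n) ℂ, star e = e ∧ e * e = e ∧ e.trace = 1 ∧ e *ᵥ v = v ∧
      (∀ w, ∃ a : ℂ, e *ᵥ w = a • v) ∧ ∀ B : Matrix (Fin n) (Fin n) ℂ,
        (B *ᵥ v = v → B * e = e) ∧ (B *ᵥ v = 0 → B * e = 0) := by
  set c : ℂ := star v ⬝ᵥ v
  have hc : c ≠ 0 := fun h => hv (by
    open scoped ComplexOrder in exact dotProduct_star_self_eq_zero.mp h)
  have hcs : star c = c := by
    rw [← star_dotProduct_star, star_star]
  have hvv : vecMulVec v (star v) * vecMulVec v (star v) = c • vecMulVec v (star v) := by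
    rw [vecMulVec_mul_vecMulVec]
    ext a b
    simp [vecMulVec_apply, c]
    ring
  have hvw : ∀ w, vecMulVec v (star v) *ᵥ w = (star v ⬝ᵥ w) • v := fun w => by
    rw [vecMulVec_mulVec]
    ext a
    simp [mul_comm]
  refine ⟨c⁻¹ • vecMulVec v (star v), ?_, ?_, ?_, ?_, fun w => ⟨c⁻¹ * (star v ⬝ᵥ w), ?_⟩,
    fun B => ⟨fun h => ?_, fun h => ?_⟩⟩
  · rw [star_smul, star_inv₀, hcs, star_eq_conjTranspose, conjTranspose_vecMulVec, star_star]
  · rw [smul_mul_smul_comm, hvv, smul_smul, mul_assoc, inv_mul_cancel₀ hc, mul_one]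
  · rw [trace_smul, trace_vecMulVec, dotProduct_comm, smul_eq_mul, inv_mul_cancel₀ hc]
  · rw [smul_mulVec, hvw, smul_smul, inv_mul_cancel₀ hc, one_smul]
  · rw [smul_mulVec, hvw, smul_smul]
  · rw [mul_smul_comm, mul_vecMulVec, h]
  · rw [mul_smul_comm, mul_vecMulVec, h, zero_vecMulVec, smul_zero]

/-- A line inside the range of one `Q i` gives a projection below `Q i` and orthogonal to the other
members, hence commuting with all of them. -/
theorem IsDecomp.exists_rank_one (hn : n ≠ 0) {Q : Fin t → Matrix (Fin n) (Fin n) ℂ}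
    (hQ : IsDecomp Q) : ∃ e : Matrix (Fin n) (Fin n) ℂ, star e = e ∧ e * e = e ∧ e.trace = 1 ∧
      ∀ j, Commute (Q j) e := by
  let i : Fin t := ⟨0, Nat.pos_of_ne_zero (hQ.pos hn)⟩
  obtain ⟨w, hw⟩ := exists_mulVec_ne_zero (hQ.ne_zero i)
  obtain ⟨e, hes, hee, htr, -, -, he⟩ := exists_projection_onto hw
  refine ⟨e, hes, hee, htr, fun j => ?_⟩
  have hQe : Q j * e = if j = i then e else 0 := by
    split_ifs with h
    · refine (he _).1 ?_
      rw [mulVec_mulVec, h, hQ.mul_self]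
    · refine (he _).2 ?_
      rw [mulVec_mulVec, hQ.mul_of_ne j i h, zero_mulVec]
  have h := congrArg star hQe
  rw [star_mul, hes, hQ.star_eq] at h
  rw [commute_iff_eq, hQe, h]
  split_ifs <;> simp [hes]

end Rank

end StarSubalgebra

/-! ### Pairs of tuples and decompositions, and their strata -/

namespace StarSubalgebra

open Matrix AlexanderSpanier Set

variable {r n t u : ℕ}

/-- Tuples in `SU(n)` together with a decomposition of `ℂⁿ` into `t` invariant subspaces. -/
def pairSpace (r n t : ℕ) :
    Set ((Fin r → Matrix (Fin n) (Fin n) ℂ) × (Fin t → Matrix (Fin n) (Fin n) ℂ)) :=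
  {p | (∀ i, p.1 i ∈ specialUnitaryGroup (Fin n) ℂ) ∧ IsDecomp p.2 ∧
    ∀ i j, p.1 i * p.2 j = p.2 j * p.1 i}

theorem mem_decomps_centralizer_iff {A : Fin r → Matrix (Fin n) (Fin n) ℂ}
    {R : Fin t → Matrix (Fin n) (Fin n) ℂ} :
    R ∈ decomps (centralizer ℂ (range A)) t ↔ IsDecomp R ∧ ∀ i j, A i * R j = R j * A i := by
  constructor
  · exact fun h => ⟨h.1, fun i j => ((mem_centralizer_iff ℂ).mp (h.2 j) _ ⟨i, rfl⟩).1⟩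
  · refine fun h => ⟨h.1, fun j => (mem_centralizer_iff ℂ).mpr ?_⟩
    rintro _ ⟨i, rfl⟩
    refine ⟨h.2 i j, ?_⟩
    have h1 := congrArg star (h.2 i j)
    rwa [star_mul, star_mul, h.1.star_eq, eq_comm] at h1

theorem mem_pairSpace_iff {p : (Fin r → Matrix (Fin n) (Fin n) ℂ) ×
    (Fin t → Matrix (Fin n) (Fin n) ℂ)} : p ∈ pairSpace r n t ↔
    (∀ i, p.1 i ∈ specialUnitaryGroup (Fin n) ℂ) ∧ p.2 ∈ decomps (centralizer ℂ (range p.1)) t := by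
  rw [mem_decomps_centralizer_iff]
  rfl

theorem isCompact_pairSpace (r n t : ℕ) : IsCompact (pairSpace r n t) := by
  have h : pairSpace r n t = (univ.pi fun _ => (specialUnitaryGroup (Fin n) ℂ : Set _)) ×ˢ
      {Q | IsDecomp Q} ∩ ⋂ i, ⋂ j, {p | p.1 i * p.2 j = p.2 j * p.1 i} := by
    ext p
    simp only [pairSpace, mem_ofPred_eq, mem_inter_iff, mem_prod, mem_iInter, and_assoc, mem_pi,
      mem_univ, true_imp_iff, SetLike.mem_coe]
  rw [h]
  exact ((isCompact_univ_pi fun _ => isCompact_specialUnitaryGroup n).prod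
    (isCompact_setOf_isDecomp n t)).inter_right (isClosed_iInter fun i => isClosed_iInter fun j =>
      isClosed_eq (by fun_prop) (by fun_prop))

/-- The tuples whose commutant has length at least `v`. -/
def lengthGE (r n v : ℕ) : Set (Fin r → Matrix (Fin n) (Fin n) ℂ) :=
  ⋃ w ∈ Finset.Icc v (n * n), Prod.fst '' pairSpace r n w

theorem mem_lengthGE_iff {v : ℕ} {A : Fin r → Matrix (Fin n) (Fin n) ℂ} :
    A ∈ lengthGE r n v ↔ ∃ w, v ≤ w ∧ ∃ R, (A, R) ∈ pairSpace r n w := by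
  simp only [lengthGE, mem_iUnion, Finset.mem_Icc, mem_image, Prod.exists, exists_and_right,
    exists_eq_right, exists_prop]
  exact ⟨fun ⟨w, hw, h⟩ => ⟨w, hw.1, h⟩, fun ⟨w, hw, R, h⟩ => ⟨w, ⟨hw, h.2.1.le⟩, R, h⟩⟩

theorem isCompact_lengthGE (r n v : ℕ) : IsCompact (lengthGE r n v) :=
  (Finset.Icc v (n * n)).isCompact_biUnion fun w _ => (isCompact_pairSpace r n w).image continuous_fst

theorem hasLength_iff {A : Fin r → Matrix (Fin n) (Fin n) ℂ}
    (hA : ∀ i, A i ∈ specialUnitaryGroup (Fin n) ℂ) : HasLength (centralizer ℂ (range A)) u ↔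
    A ∈ lengthGE r n u ∧ A ∉ lengthGE r n (u + 1) := by
  have hp : ∀ {w} {R : Fin w → Matrix (Fin n) (Fin n) ℂ}, (A, R) ∈ pairSpace r n w ↔
      R ∈ decomps (centralizer ℂ (range A)) w := fun {w R} =>
    mem_pairSpace_iff.trans (and_iff_right hA)
  simp only [mem_lengthGE_iff, hp]
  constructor
  · rintro ⟨⟨R, hR⟩, h⟩
    refine ⟨⟨u, le_rfl, R, hR⟩, ?_⟩
    rintro ⟨w, hw, R', hR'⟩
    exact notMem_empty R' (h w hw ▸ hR')
  · rintro ⟨⟨w, hw, R, hR⟩, h⟩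
    have hwu : w = u := by
      by_contra hne
      exact h ⟨w, by omega, R, hR⟩
    subst hwu
    exact ⟨⟨R, hR⟩, fun v hv => eq_empty_of_forall_notMem fun R' hR' => h ⟨v, hv, R', hR'⟩⟩

/-- The pairs whose tuple has a commutant of length at least `v`. -/
def pairsGE (r n t v : ℕ) :
    Set ((Fin r → Matrix (Fin n) (Fin n) ℂ) × (Fin t → Matrix (Fin n) (Fin n) ℂ)) :=
  pairSpace r n t ∩ Prod.fst ⁻¹' lengthGE r n v

theorem isCompact_pairsGE (r n t v : ℕ) : IsCompact (pairsGE r n t v) :=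
  (isCompact_pairSpace r n t).inter_right
    ((isCompact_lengthGE r n v).isClosed.preimage continuous_fst)

theorem pairsGE_succ_subset (r n t v : ℕ) : pairsGE r n t (v + 1) ⊆ pairsGE r n t v :=
  inter_subset_inter_right _ fun p hp => by
    obtain ⟨w, hw, h⟩ := mem_lengthGE_iff.mp hp
    exact mem_lengthGE_iff.mpr ⟨w, by omega, h⟩

/-- Multiplication of a tuple by scalars. -/
def twist (ζ : Fin r → ℂ) (t : ℕ)
    (p : (Fin r → Matrix (Fin n) (Fin n) ℂ) × (Fin t → Matrix (Fin n) (Fin n) ℂ)) :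
    (Fin r → Matrix (Fin n) (Fin n) ℂ) × (Fin t → Matrix (Fin n) (Fin n) ℂ) :=
  (fun i => ζ i • p.1 i, p.2)

section Twist

variable {ζ : Fin r → ℂ}

theorem continuous_twist (ζ : Fin r → ℂ) (t : ℕ) : Continuous (twist (n := n) ζ t) := by
  unfold twist
  fun_prop

theorem twist_iterate (hζ : ∀ i, ζ i ^ n = 1) (t : ℕ) : (twist (n := n) ζ t)^[n] = id := by
  have h : ∀ (k : ℕ) p, (twist (n := n) ζ t)^[k] p = (fun i => ζ i ^ k • p.1 i, p.2) := by
    intro k p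
    induction k with
    | zero => simp
    | succ k ih =>
      rw [Function.iterate_succ_apply', ih]
      simp only [twist, smul_smul, pow_succ']
  funext p
  rw [h]
  simp [hζ]

theorem smul_mem_specialUnitaryGroup {c : ℂ} (hc : ‖c‖ = 1) (hcn : c ^ n = 1)
    {A : Matrix (Fin n) (Fin n) ℂ} (hA : A ∈ specialUnitaryGroup (Fin n) ℂ) :
    c • A ∈ specialUnitaryGroup (Fin n) ℂ := by
  rw [← one_mul A, ← smul_mul_assoc, ← one_rot]
  refine mul_mem (mem_specialUnitaryGroup_iff.mpr
    ⟨rot_mem_unitaryGroup (star_one _) (one_mul 1) hc, ?_⟩) hA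
  rw [one_rot, det_smul, det_one, mul_one, Fintype.card_fin, hcn]

theorem norm_eq_one_of_pow (hn : n ≠ 0) (hζ : ∀ i, ζ i ^ n = 1) (i : Fin r) : ‖ζ i‖ = 1 :=
  Complex.norm_eq_one_of_pow_eq_one (hζ i) hn

theorem mapsTo_twist_pairSpace (hn : n ≠ 0) (hζ : ∀ i, ζ i ^ n = 1) (t : ℕ) :
    MapsTo (twist ζ t) (pairSpace r n t) (pairSpace r n t) := fun p hp =>
  ⟨fun i => smul_mem_specialUnitaryGroup (norm_eq_one_of_pow hn hζ i) (hζ i) (hp.1 i), hp.2.1,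
    fun i j => by
      change ζ i • p.1 i * p.2 j = p.2 j * ζ i • p.1 i
      rw [smul_mul_assoc, hp.2.2, mul_smul_comm]⟩

theorem mapsTo_twist_pairsGE (hn : n ≠ 0) (hζ : ∀ i, ζ i ^ n = 1) (t v : ℕ) :
    MapsTo (twist ζ t) (pairsGE r n t v) (pairsGE r n t v) := by
  rintro ⟨A, Q⟩ ⟨hp, hA⟩
  refine ⟨mapsTo_twist_pairSpace hn hζ t hp, ?_⟩
  obtain ⟨w, hw, R, hR⟩ := mem_lengthGE_iff.mp (show A ∈ lengthGE r n v from hA)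
  have h := mapsTo_twist_pairSpace hn hζ w hR
  exact (mem_lengthGE_iff (A := fun i => ζ i • A i)).mpr ⟨w, hw, R, h⟩

/-- The path `s ↦ exp (i s θ (1 - n e))`. -/
noncomputable def tiltPath (e : Matrix (Fin n) (Fin n) ℂ) (θ s : ℝ) : Matrix (Fin n) (Fin n) ℂ :=
  circ θ s • rot e (circ (-(n * θ)) s)

/-- The scalar contributes `exp (i s n θ)` to the determinant, and the rotation contributes the
inverse because `e` has rank one. -/
theorem tiltPath_mem {e : Matrix (Fin n) (Fin n) ℂ} (hs : star e = e) (he : e * e = e)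
    (htr : e.trace = 1) (θ s : ℝ) : tiltPath e θ s ∈ specialUnitaryGroup (Fin n) ℂ := by
  obtain ⟨k, hk, hdet⟩ := exists_rank hs he
  have hk1 : k = 1 := by
    rw [htr] at hk
    exact_mod_cast hk.symm
  refine mem_specialUnitaryGroup_iff.mpr ⟨?_, ?_⟩
  · rw [tiltPath, ← one_mul (rot e _), ← smul_mul_assoc, ← one_rot]
    exact mul_mem (rot_mem_unitaryGroup (star_one _) (one_mul 1) (norm_circ _ _))
      (rot_mem_unitaryGroup hs he (norm_circ _ _))
  · rw [tiltPath, det_smul, hdet, hk1, pow_one, Fintype.card_fin, circ_pow, circ_mul_circ_neg]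

/-- Multiplication by roots of unity acts trivially on the cohomology of the space of pairs. -/
theorem trivOn_pairSpace (hn : n ≠ 0) (hζ : ∀ i, ζ i ^ n = 1) (t : ℕ) :
    TrivOn (twist ζ t) (pairSpace r n t) := by
  refine TrivOn.of_fibres (continuous_twist ζ t) hn (twist_iterate hζ t)
    (mapsTo_twist_pairSpace hn hζ t) Prod.snd (fun _ => rfl)
    (isProperMap_restrict (isCompact_pairSpace r n t) continuousOn_snd) fun Q => ?_
  by_cases hQ : IsDecomp Q
  · obtain ⟨e, hs, he, htr, hcomm⟩ := hQ.exists_rank_one hn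
    choose θ hθ using fun i => exists_circ_eq (norm_eq_one_of_pow hn hζ i)
    have hcont : ∀ i, Continuous (tiltPath e (θ i)) := fun i =>
      (continuous_circ _).smul ((continuous_rot e).comp (continuous_circ _))
    refine TrivOn.of_homotopy ((isCompact_pairSpace r n t).inter_right
      (isClosed_singleton.preimage continuous_snd))
      (fun s p => (fun i => tiltPath e (θ i) s * p.1 i, p.2)) ?_ ?_ (fun p => ?_) fun p => ?_
    · refine (continuous_pi fun i => ?_).prodMk (continuous_snd.comp continuous_snd)
      exact ((hcont i).comp continuous_fst).mul
        ((continuous_apply i).comp (continuous_fst.comp continuous_snd))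
    · rintro s ⟨A, Q⟩ ⟨hp, rfl⟩
      refine ⟨⟨fun i => mul_mem (tiltPath_mem hs he htr _ s) (hp.1 i), hp.2.1, fun i j => ?_⟩, rfl⟩
      have h1 : Commute (Q j) (tiltPath e (θ i) s) := (commute_rot (hcomm j)).smul_right _
      have h2 : Commute (Q j) (A i) := (hp.2.2 i j).symm
      exact (h1.mul_right h2).symm
    · simp only [tiltPath, circ_zero, rot_one, one_smul, one_mul]
    · refine Prod.ext (funext fun i => ?_) rfl
      -- As `ζ i` is an `n`-th root of unity, the rotation closes up at `s = 1` and the path ends at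
      -- the scalar `ζ i`.
      have h1 : circ (-(n * θ i)) 1 = 1 := by
        have h := circ_mul_circ_neg (n * θ i) 1
        rwa [← circ_pow, hθ, hζ, one_mul] at h
      change tiltPath e (θ i) 1 * p.1 i = ζ i • p.1 i
      rw [tiltPath, h1, hθ, rot_one, smul_mul_assoc, one_mul]
  · have hemp : pairSpace r n t ∩ Prod.snd ⁻¹' {Q} = ∅ :=
      eq_empty_of_forall_notMem fun p hp => hQ (hp.2 ▸ hp.1.2.1)
    rw [hemp]
    exact fun m c _ _ => ExactOn.of_locZero fun y hy => absurd hy (notMem_empty y)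

end Twist

/-- The decompositions into `t` blocks obtained by merging finer decompositions. -/
noncomputable def mergeAction (r n t u : ℕ) :
    FibreAction (Equiv.Perm (Fin u))
      (fun y : ((Fin r → Matrix (Fin n) (Fin n) ℂ) × (Fin u → Matrix (Fin n) (Fin n) ℂ)) ×
        (Fin u → Fin t) => (y.1.1, merge y.2 y.1.2))
      (pairSpace r n u ×ˢ {f | Function.Surjective f}) (pairsGE r n t u) where
  act γ y := ((y.1.1, permAct γ y.1.2), permAct γ y.2)
  act_mul _ _ _ := rfl
  continuous_act γ := by
    unfold permAct
    fun_prop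
  mapsTo_act γ y hy := by
    have h := mem_pairSpace_iff.mp hy.1
    exact ⟨mem_pairSpace_iff.mpr ⟨h.1, permAct_mem_decomps h.2 γ⟩, hy.2.comp γ⁻¹.surjective⟩
  q_act γ y := Prod.ext rfl (merge_permAct γ)
  continuous_q := (continuous_fst.comp continuous_fst).prodMk
    (continuous_merge.comp ((continuous_snd.comp continuous_fst).prodMk continuous_snd))
  isProperMap := isProperMap_restrict ((isCompact_pairSpace r n u).prod (toFinite _).isCompact)
    ((continuous_fst.comp continuous_fst).prodMk (continuous_merge.comp
      ((continuous_snd.comp continuous_fst).prodMk continuous_snd))).continuousOn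
  mapsTo y hy := ⟨⟨hy.1.1, hy.1.2.1.merge hy.2, fun i j => by
    change y.1.1 i * merge y.2 y.1.2 j = merge y.2 y.1.2 j * y.1.1 i
    rw [merge, Finset.mul_sum, Finset.sum_mul]
    refine Finset.sum_congr rfl fun k _ => ?_
    rw [mul_smul_comm, smul_mul_assoc, hy.1.2.2]⟩, mem_lengthGE_iff.mpr ⟨u, le_rfl, _, hy.1⟩⟩
  isClosed := (isCompact_pairsGE r n t u).isClosed

/-- The fibre over `(A, Q)` is the space of maximal decompositions `R` of the commutant of `A` and
`Q`. The grouping `f` is determined by `R`, since each `R i` lies below exactly one `Q j`. Adding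
the commuting projections `Q j` does not change the length of the commutant. -/
theorem acyclicOn_mergeAction (hn : n ≠ 0)
    {p : (Fin r → Matrix (Fin n) (Fin n) ℂ) × (Fin t → Matrix (Fin n) (Fin n) ℂ)}
    (hp : p ∈ pairsGE r n t u) (hpu : p.1 ∉ lengthGE r n (u + 1)) :
    AcyclicOn (mergeAction r n t u).act ((pairSpace r n u ×ˢ {f | Function.Surjective f}) ∩
      (fun y : ((Fin r → Matrix (Fin n) (Fin n) ℂ) × (Fin u → Matrix (Fin n) (Fin n) ℂ)) ×
        (Fin u → Fin t) => (y.1.1, merge y.2 y.1.2)) ⁻¹' {p}) := by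
  obtain ⟨A, Q⟩ := p
  have hA := hp.1.1
  have hQ : IsDecomp Q := hp.1.2.1
  have hlen := (hasLength_iff hA).mpr ⟨hp.2, hpu⟩
  have hQmem : Q ∈ decomps (centralizer ℂ (range A)) t := (mem_pairSpace_iff.mp hp.1).2
  set Z := centralizer ℂ (range A)
  have hlen' : HasLength (Z ⊓ centralizer ℂ (range Q)) u := by
    refine (hasLength_inf_centralizer_iff (range_subset_iff.mpr hQmem.2) ?_).mpr hlen
    rintro _ ⟨i, rfl⟩ _ ⟨j, rfl⟩
    rw [hQ.star_eq, and_self]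
    by_cases hij : i = j
    · rw [hij]
    · exact (hQ.mul_of_ne i j hij).trans (hQ.mul_of_ne j i (Ne.symm hij)).symm
  let j₀ : Fin t := ⟨0, Nat.pos_of_ne_zero (hQ.pos hn)⟩
  have hmem : ∀ R ∈ decomps (Z ⊓ centralizer ℂ (range Q)) u, R ∈ decomps Z u ∧
      ∀ i j, Q j * R i = R i * Q j := fun R hR => ⟨decomps_mono inf_le_left u hR, fun i j =>
    ((mem_centralizer_iff ℂ).mp (hR.2 i).2 _ ⟨j, rfl⟩).1⟩
  have habove : ∀ R ∈ decomps (Z ⊓ centralizer ℂ (range Q)) u, ∀ i, ∃ j, ∀ k,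
      Q k * R i = if j = k then R i else 0 := by
    intro R hR i
    have hcomm := (hmem R hR).2 i
    obtain ⟨j, hj⟩ : ∃ j, Q j * R i ≠ 0 := by
      by_contra! h
      refine hR.1.ne_zero i ?_
      rw [← one_mul (R i), ← hQ.sum_eq, Finset.sum_mul]
      exact Finset.sum_eq_zero fun j _ => h j
    -- `R i` is minimal in `Z` and commutes with `Q j`, so `Q j * R i` is an idempotent multiple of
    -- `R i`.
    obtain ⟨c, hc⟩ := (IsMinProj.of_hasLength hlen (hmem R hR).1 i).corner (Q j) (hQmem.2 j)
    have hQR : Q j * R i = c • R i := by rw [← hc, ← hcomm, mul_assoc, hR.1.mul_self]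
    have hc1 : c = 1 := by
      refine eq_one_of_smul_idem (hR.1.mul_self i) (hR.1.ne_zero i) ?_ fun h => hj (by
        rw [hQR, h, zero_smul])
      rw [← hQR, mul_assoc, ← mul_assoc (R i), ← hcomm, mul_assoc, hR.1.mul_self, ← mul_assoc,
        hQ.mul_self]
    rw [hc1, one_smul] at hQR
    refine ⟨j, fun k => ?_⟩
    split_ifs with h
    · rw [← h, hQR]
    · rw [← hQR, ← mul_assoc, hQ.mul_of_ne k j (Ne.symm h), zero_mul]
  refine (acyclicOn_decomps hlen').of_retract (f := fun y => y.1.2)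
    (g := fun R => ((A, R), fun i => indexAbove Q j₀ (R i))) (by fun_prop) ?_ ?_ ?_ ?_
    fun γ R => rfl
  · refine ContinuousOn.prodMk (by fun_prop) (continuousOn_pi.mpr fun i => ?_)
    exact (continuousOn_indexAbove Q j₀).comp (continuous_apply i).continuousOn fun R hR =>
      ⟨hR.1.ne_zero i, habove R hR i⟩
  · rintro ⟨⟨A', R⟩, f⟩ ⟨⟨hR, hf⟩, hy⟩
    obtain ⟨rfl, rfl⟩ := Prod.ext_iff.mp hy
    refine ⟨hR.2.1, fun i => ⟨(mem_pairSpace_iff.mp hR).2.2 i, (mem_centralizer_iff ℂ).mpr ?_⟩⟩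
    rintro _ ⟨j, rfl⟩
    have h1 : merge f R j * R i = R i * merge f R j := by rw [merge_mul hR.2.1, mul_merge hR.2.1]
    exact ⟨h1, by rw [star_merge hR.2.1]; exact h1⟩
  · intro R hR
    have hm : merge (fun i => indexAbove Q j₀ (R i)) R = Q := by
      funext j
      rw [merge, ← mul_one (Q j), ← hR.1.sum_eq, Finset.mul_sum]
      refine Finset.sum_congr rfl fun i _ => ?_
      obtain ⟨k, hk⟩ := habove R hR i
      rw [indexAbove_eq (hR.1.ne_zero i) hk, hk, ite_smul, one_smul, zero_smul]
    refine ⟨⟨mem_pairSpace_iff.mpr ⟨hA, (hmem R hR).1⟩, fun j => ?_⟩, Prod.ext rfl hm⟩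
    by_contra! h
    refine hQ.ne_zero j ?_
    rw [← hm, merge]
    refine Finset.sum_eq_zero fun i _ => ?_
    rw [if_neg (h i), zero_smul]
  · rintro ⟨⟨A', R⟩, f⟩ ⟨⟨hR, hf⟩, hy⟩
    obtain ⟨rfl, rfl⟩ := Prod.ext_iff.mp hy
    refine Prod.ext rfl (funext fun i => ?_)
    exact indexAbove_eq (hR.2.1.ne_zero i) fun k => merge_mul hR.2.1 k i

section Strata

variable {ζ : Fin r → ℂ}

/-- Multiplication by roots of unity acts trivially on the cohomology of the stratum of pairs
whose decomposition is maximal. -/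
theorem trivOn_pairsGE_diff (hn : n ≠ 0) (hζ : ∀ i, ζ i ^ n = 1) (t : ℕ) :
    TrivOn (twist ζ t) (pairSpace r n t \ pairsGE r n t (t + 1)) := by
  -- Descending induction on `t`: the strata of `pairSpace r n t` of length `v > t` are controlled
  -- by the maximal pairs with `v` projections.
  have hstep : ∀ t, (∀ u, t < u → TrivOn (twist ζ u) (pairSpace r n u \ pairsGE r n u (u + 1))) →
      TrivOn (twist ζ t) (pairSpace r n t \ pairsGE r n t (t + 1)) := by
    intro t ih
    -- The closed sets `pairsGE r n t v` are built up from large `v`, where they are empty because a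
    -- decomposition has at most `n * n` members. Each step adds the stratum of length exactly `v`.
    have hGE : ∀ k v, t < v → n * n < v + k → TrivOn (twist ζ t) (pairsGE r n t v) := by
      intro k
      induction k with
      | zero =>
        intro v _ hv
        have hemp : pairsGE r n t v = ∅ := eq_empty_of_forall_notMem fun p hp => by
          obtain ⟨w, hw, R, hR⟩ := mem_lengthGE_iff.mp hp.2
          have := hR.2.1.le
          omega
        rw [hemp]
        exact fun m c _ _ => ExactOn.of_locZero fun y hy => absurd hy (notMem_empty y)
      | succ k ihk =>
        intro v hv hvk
        refine TrivOn.of_closed_of_open (continuous_twist ζ t) hn (twist_iterate hζ t)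
          (isCompact_pairsGE r n t (v + 1)) (isCompact_pairsGE r n t v)
          (pairsGE_succ_subset r n t v) (mapsTo_twist_pairsGE hn hζ t _)
          (mapsTo_twist_pairsGE hn hζ t _) (ihk (v + 1) (by omega) (by omega)) ?_
        have hO : IsOpen (Prod.fst ⁻¹' (lengthGE r n (v + 1))ᶜ :
            Set ((Fin r → Matrix (Fin n) (Fin n) ℂ) × (Fin t → Matrix (Fin n) (Fin n) ℂ))) :=
          (isCompact_lengthGE r n (v + 1)).isClosed.isOpen_compl.preimage continuous_fst
        have heq : pairsGE r n t v \ pairsGE r n t (v + 1) =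
            pairsGE r n t v ∩ Prod.fst ⁻¹' (lengthGE r n (v + 1))ᶜ := by
          ext p
          exact and_congr_right fun hp => not_congr (and_iff_right hp.1)
        have hmaps : MapsTo (twist ζ t) (pairsGE r n t v ∩ Prod.fst ⁻¹' (lengthGE r n (v + 1))ᶜ)
            (pairsGE r n t v ∩ Prod.fst ⁻¹' (lengthGE r n (v + 1))ᶜ) := by
          rw [← heq]
          refine fun p hp => ⟨mapsTo_twist_pairsGE hn hζ t v hp.1, fun h => hp.2 ?_⟩
          have h1 := (mapsTo_twist_pairsGE hn hζ t (v + 1)).iterate (n - 1) h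
          rwa [← Function.iterate_succ_apply, Nat.succ_eq_add_one,
            Nat.sub_add_cancel (Nat.one_le_iff_ne_zero.mpr hn), twist_iterate hζ] at h1
        rw [heq]
        -- Over the stratum of length exactly `v` the merging map has acyclic fibres. Its total
        -- space is a finite disjoint union of copies of the maximal pairs with `v` projections.
        refine (mergeAction r n t v).trivOn_of_total hO (fun p hp => acyclicOn_mergeAction hn hp.1 hp.2)
          (σ' := Prod.map (twist ζ v) id) (continuous_twist ζ t) hn (twist_iterate hζ t) hmaps rfl ?_
        have htot : (pairSpace r n v ×ˢ {f : Fin v → Fin t | Function.Surjective f}) ∩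
            (fun y : ((Fin r → Matrix (Fin n) (Fin n) ℂ) × (Fin v → Matrix (Fin n) (Fin n) ℂ)) ×
              (Fin v → Fin t) => (y.1.1, merge y.2 y.1.2)) ⁻¹'
              (Prod.fst ⁻¹' (lengthGE r n (v + 1))ᶜ) =
            (pairSpace r n v \ pairsGE r n v (v + 1)) ×ˢ {f | Function.Surjective f} := by
          ext y
          constructor
          · exact fun ⟨⟨h1, h2⟩, h3⟩ => ⟨⟨h1, fun h => h3 h.2⟩, h2⟩
          · exact fun ⟨⟨h1, h3⟩, h2⟩ => ⟨⟨h1, h2⟩, fun h => h3 ⟨h1, h⟩⟩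
        rw [htot]
        exact (ih v hv).prod _
    refine TrivOn.diff (continuous_twist ζ t) hn (twist_iterate hζ t)
      (isCompact_pairsGE r n t (t + 1)) (isCompact_pairSpace r n t) inter_subset_left
      (mapsTo_twist_pairsGE hn hζ t _) (mapsTo_twist_pairSpace hn hζ t)
      (hGE (n * n) (t + 1) (by omega) (by omega)) (trivOn_pairSpace hn hζ t)
  have hall : ∀ k t, n * n < t + k →
      TrivOn (twist ζ t) (pairSpace r n t \ pairsGE r n t (t + 1)) := by
    intro k
    induction k with
    | zero =>
      intro t ht
      have hemp : pairSpace r n t \ pairsGE r n t (t + 1) = ∅ :=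
        eq_empty_of_forall_notMem fun p hp => by
          have := hp.1.2.1.le
          omega
      rw [hemp]
      exact fun m c _ _ => ExactOn.of_locZero fun y hy => absurd hy (notMem_empty y)
    | succ k ih => exact fun t ht => hstep t fun u hu => ih u (by omega)
  exact hall (n * n + 1) t (by omega)

end Strata

end StarSubalgebra

/-! ### Irreducibility in terms of commutants -/

namespace StarSubalgebra

open Matrix AlexanderSpanier Set

variable {r n : ℕ}

section Irreducible

/-- A central `g` commutes with the tilt along the line of `v` of angle `π / n`, which is a scalar
multiple of the reflection `1 - 2 e`. So `g` preserves the line. -/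
theorem exists_eigenvalue_of_mem_center {g : SU n} (hg : g ∈ Subgroup.center (SU n))
    (hn : n ≠ 0) (v : Fin n → ℂ) : ∃ c : ℂ, (g : Matrix (Fin n) (Fin n) ℂ) *ᵥ v = c • v := by
  by_cases hv : v = 0
  · exact ⟨0, by rw [hv, mulVec_zero, smul_zero]⟩
  obtain ⟨e, hes, hee, htr, hev, he, -⟩ := exists_projection_onto hv
  have hd : circ (-(n * (Real.pi / n))) 1 = -1 := by
    rw [mul_div_cancel₀ _ (Nat.cast_ne_zero.mpr hn), circ, one_mul, Complex.ofReal_neg, neg_mul,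
      Complex.exp_neg, Complex.exp_pi_mul_I]
    norm_num
  have hcomm := congrArg Subtype.val (Subgroup.mem_center_iff.mp hg
    ⟨_, tiltPath_mem hes hee htr (Real.pi / n) 1⟩)
  have hc0 : circ (Real.pi / n) 1 ≠ 0 := fun h => by
    have := norm_circ (Real.pi / n) 1
    rw [h, norm_zero] at this
    exact zero_ne_one this
  have hge : (g : Matrix (Fin n) (Fin n) ℂ) * e = e * g := by
    change tiltPath e _ 1 * (g : Matrix (Fin n) (Fin n) ℂ) = g * tiltPath e _ 1 at hcomm
    rw [tiltPath, hd, rot, smul_mul_assoc, mul_smul_comm] at hcomm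
    have h1 := smul_right_injective _ hc0 hcomm
    rw [add_mul, mul_add, one_mul, mul_one, smul_mul_assoc, mul_smul_comm] at h1
    exact (smul_right_injective _ (by norm_num : (-1 - 1 : ℂ) ≠ 0) (add_left_cancel h1)).symm
  obtain ⟨c, hc⟩ := he ((g : Matrix (Fin n) (Fin n) ℂ) *ᵥ v)
  refine ⟨c, ?_⟩
  rw [← hc, mulVec_mulVec, ← hge, ← mulVec_mulVec, hev]

/-- Otherwise `k` would be an integral multiple of `2 π`, against the irrationality of `π`. -/
theorem circ_natCast_ne_one {k : ℕ} (hk : k ≠ 0) : circ k 1 ≠ 1 := by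
  intro h
  rw [circ, one_mul, Complex.exp_eq_one_iff] at h
  obtain ⟨m, hm⟩ := h
  have h1 : (k : ℝ) = m * (2 * Real.pi) := by
    have h2 : ((k : ℝ) : ℂ) * Complex.I = ((m * (2 * Real.pi) : ℝ) : ℂ) * Complex.I := by
      rw [hm]
      push_cast
      ring
    exact_mod_cast mul_right_cancel₀ Complex.I_ne_zero h2
  have hm0 : m ≠ 0 := by
    rintro rfl
    rw [Int.cast_zero, zero_mul, Nat.cast_eq_zero] at h1
    exact hk h1
  refine irrational_pi ⟨(k : ℚ) / (2 * m), ?_⟩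
  have hm0' : (m : ℝ) ≠ 0 := Int.cast_ne_zero.mpr hm0
  push_cast
  rw [h1]
  field_simp

/-- A reducible tuple commutes with a special unitary matrix of infinite order modulo the
center. -/
theorem exists_commuting_of_mem_lengthGE (hn : n ≠ 0) {A : Fin r → Matrix (Fin n) (Fin n) ℂ}
    (hA : A ∈ lengthGE r n 2) : ∃ u : SU n, (∀ i, (u : Matrix (Fin n) (Fin n) ℂ) * A i = A i * u) ∧
      ∀ N : ℕ, N ≠ 0 → u ^ N ∉ Subgroup.center (SU n) := by
  obtain ⟨w, hw, R, hR⟩ := mem_lengthGE_iff.mp hA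
  let i : Fin w := ⟨0, by omega⟩
  let j : Fin w := ⟨1, by omega⟩
  have hij : i ≠ j := fun h => absurd (congrArg Fin.val h) (by simp [i, j])
  obtain ⟨-, hRd, hcomm⟩ := hR
  replace hRd : IsDecomp R := hRd
  obtain ⟨k, hk, hkdet⟩ := exists_rank (hRd.star_eq i) (hRd.mul_self i)
  obtain ⟨l, hl, hldet⟩ := exists_rank (hRd.star_eq j) (hRd.mul_self j)
  have hk0 : k ≠ 0 := by
    have h := trace_ne_zero (hRd.star_eq i) (hRd.mul_self i) (hRd.ne_zero i)
    rw [hk] at h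
    exact_mod_cast h
  -- With `k` and `l` the ranks of `R i` and `R j`, the angles `l` and `-k` give determinant `exp (i
  -- (l k - k l)) = 1`. A central power `N` would force `exp (i N (k + l)) = 1`.
  set c := circ l 1
  set d := circ (-k) 1
  set U := rot (R i) c * rot (R j) d
  have hU : U ∈ specialUnitaryGroup (Fin n) ℂ := by
    refine mem_specialUnitaryGroup_iff.mpr ⟨mul_mem
      (rot_mem_unitaryGroup (hRd.star_eq i) (hRd.mul_self i) (norm_circ _ _))
      (rot_mem_unitaryGroup (hRd.star_eq j) (hRd.mul_self j) (norm_circ _ _)), ?_⟩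
    rw [det_mul, hkdet, hldet, circ_pow, circ_pow, mul_neg, mul_comm (l : ℝ), circ_mul_circ_neg]
  have hUi : U * R i = c • R i := by
    rw [mul_assoc, rot_mul_of_mul_eq_zero (hRd.mul_of_ne j i hij.symm), rot_mul_self (hRd.mul_self i)]
  have hUj : U * R j = d • R j := by
    rw [mul_assoc, rot_mul_self (hRd.mul_self j), mul_smul_comm,
      rot_mul_of_mul_eq_zero (hRd.mul_of_ne i j hij)]
  have hpow : ∀ (N : ℕ) {P : Matrix (Fin n) (Fin n) ℂ} {a : ℂ}, U * P = a • P →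
      U ^ N * P = a ^ N • P := fun N P a h => by
    induction N with
    | zero => rw [pow_zero, pow_zero, one_mul, one_smul]
    | succ N ih => rw [pow_succ, mul_assoc, h, mul_smul_comm, ih, smul_smul, pow_succ']
  refine ⟨⟨U, hU⟩, fun a => ?_, fun N hN hcen => ?_⟩
  · exact ((commute_rot (hcomm a i)).mul_right (commute_rot (hcomm a j))).symm
  · obtain ⟨x, hx⟩ := exists_mulVec_ne_zero (hRd.ne_zero i)
    obtain ⟨y, hy⟩ := exists_mulVec_ne_zero (hRd.ne_zero j)
    obtain ⟨b, hb⟩ := exists_eigenvalue_of_mem_center hcen hn (R i *ᵥ x + R j *ᵥ y)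
    have hb' : U ^ N *ᵥ (R i *ᵥ x + R j *ᵥ y) = b • (R i *ᵥ x + R j *ᵥ y) := hb
    rw [mulVec_add, mulVec_mulVec, mulVec_mulVec, hpow N hUi, hpow N hUj, smul_mulVec,
      smul_mulVec, smul_add] at hb'
    have hi := congrArg (R i *ᵥ ·) hb'
    have hj := congrArg (R j *ᵥ ·) hb'
    simp only [mulVec_add, mulVec_smul, mulVec_mulVec, hRd.mul_self, hRd.mul_of_ne i j hij,
      hRd.mul_of_ne j i hij.symm, zero_mulVec, smul_zero, add_zero, zero_add] at hi hj
    have hcd : c ^ N = d ^ N := (smul_left_injective ℂ hx hi).trans (smul_left_injective ℂ hy hj).symm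
    have h1 : circ ((N * (l + k) : ℕ) : ℝ) 1 = 1 := by
      have h2 := circ_mul_circ_neg k 1
      have h3 : circ l 1 * circ k 1 = circ (l + k) 1 := by
        rw [circ, circ, circ, ← Complex.exp_add]
        congr 1
        push_cast
        ring
      rw [Nat.cast_mul, Nat.cast_add, ← circ_pow, ← h3, mul_pow]
      change c ^ N * _ = 1
      rw [hcd, ← mul_pow, mul_comm, h2, one_pow]
    exact circ_natCast_ne_one (mul_ne_zero hN (by omega)) h1

/-- The tuple of matrices of a representation. -/
def repTuple (ρ : FreeGroup (Fin r) →* SU n) : Fin r → Matrix (Fin n) (Fin n) ℂ :=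
  fun i => (ρ (FreeGroup.of i) : Matrix (Fin n) (Fin n) ℂ)

theorem mem_centralizer_range_of_generators {ρ : FreeGroup (Fin r) →* SU n} {u : SU n}
    (hu : ∀ i, u * ρ (FreeGroup.of i) = ρ (FreeGroup.of i) * u) (γ : FreeGroup (Fin r)) :
    ρ γ * u = u * ρ γ := by
  have hconj : (MulAut.conj u).toMonoidHom.comp ρ = ρ := by
    refine FreeGroup.ext_hom _ _ fun i => ?_
    change u * ρ (FreeGroup.of i) * u⁻¹ = ρ (FreeGroup.of i)
    rw [hu, mul_inv_cancel_right]
  have h : u * ρ γ * u⁻¹ = ρ γ := DFunLike.congr_fun hconj γ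
  exact (mul_inv_eq_iff_eq_mul.mp h).symm

/-- For a reducible tuple, take `u` commuting with it and of infinite order modulo the center.
Finite index would make the image of some `u ^ N` central in `PU(n)`. Then `u ^ N` commutes with
each `x` up to an `n`-th root of unity, so `u ^ (N * n)` is central, a contradiction. -/
theorem notMem_lengthGE_of_isIrreducibleRep_mk (hn : n ≠ 0) {ρ : FreeGroup (Fin r) →* SU n}
    (hρ : IsIrreducibleRep ((QuotientGroup.mk' (scalarSU n).range).comp ρ)) :
    repTuple ρ ∉ lengthGE r n 2 := by
  intro hA
  obtain ⟨u, hu, hucen⟩ := exists_commuting_of_mem_lengthGE hn hA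
  set q := QuotientGroup.mk' (scalarSU n).range
  have huc := mem_centralizer_range_of_generators (ρ := ρ) (u := u) fun i => Subtype.ext (hu i)
  have hq : q u ∈ Subgroup.centralizer (range (q.comp ρ)) := by
    refine Subgroup.mem_centralizer_iff.mpr ?_
    rintro _ ⟨γ, rfl⟩
    change q (ρ γ) * q u = q u * q (ρ γ)
    rw [← map_mul, huc, map_mul]
  obtain ⟨N, hN, -, hNmem⟩ := Subgroup.exists_pow_mem_of_index_ne_zero hρ.index_ne_zero ⟨q u, hq⟩
  have hcen : q (u ^ N) ∈ Subgroup.center (PU n) := by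
    rw [map_pow]
    exact hNmem
  refine hucen (N * n) (mul_ne_zero hN.ne' hn) (Subgroup.mem_center_iff.mpr fun x => ?_)
  have h1 := Subgroup.mem_center_iff.mp hcen (q x)
  rw [← map_mul, ← map_mul] at h1
  obtain ⟨ω, hω⟩ := QuotientGroup.eq.mp h1
  have h2 : u ^ N * x = x * u ^ N * scalarSU n ω := by rw [hω, mul_inv_cancel_left]
  have hωc := Subgroup.mem_center_iff.mp (scalarSU_mem_center n ω)
  have h3 : ∀ k : ℕ, (u ^ N) ^ k * x = x * (u ^ N) ^ k * scalarSU n ω ^ k := by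
    intro k
    induction k with
    | zero => simp
    | succ k ih =>
      rw [pow_succ, mul_assoc _ _ x, h2, ← mul_assoc, ← mul_assoc, ih, mul_assoc _ _ (u ^ N),
        ← (Commute.pow_right (hωc (u ^ N)) k).eq, pow_succ (scalarSU n ω)]
      simp only [mul_assoc]
  have h4 : scalarSU n ω ^ n = 1 := by
    rw [← map_pow, show ω ^ n = 1 from Subtype.ext ((mem_rootsOfUnity _ _).mp ω.2), map_one]
  have h5 := h3 n
  rw [h4, mul_one, ← pow_mul] at h5
  exact h5.symm

/-- The commutant has length one, so `1` is a minimal projection and its corner, the whole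
commutant, consists of scalars. The centralizer is therefore contained in the center. -/
theorem isIrreducibleRep_of_notMem_lengthGE (hn : n ≠ 0) {ρ : FreeGroup (Fin r) →* SU n}
    (hρ : repTuple ρ ∉ lengthGE r n 2) : IsIrreducibleRep ρ := by
  have hSU : ∀ i, repTuple ρ i ∈ specialUnitaryGroup (Fin n) ℂ := fun i => (ρ _).2
  have hone : ((fun _ => 1) : Fin 1 → Matrix (Fin n) (Fin n) ℂ) ∈
      decomps (centralizer ℂ (range (repTuple ρ))) 1 := by
    refine ⟨⟨fun _ => star_one _, fun _ => one_mul _, fun i j hij => ?_, by simp, fun _ h => ?_⟩,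
      fun _ => one_mem _⟩
    · exact absurd (Subsingleton.elim i j) hij
    · have h1 := congrArg Matrix.trace h
      rw [trace_one, trace_zero, Fintype.card_fin, Nat.cast_eq_zero] at h1
      exact hn h1
  have hlen : HasLength (centralizer ℂ (range (repTuple ρ))) 1 := (hasLength_iff hSU).mpr
    ⟨mem_lengthGE_iff.mpr ⟨1, le_rfl, _, mem_pairSpace_iff.mpr ⟨hSU, hone⟩⟩, hρ⟩
  have hle : Subgroup.centralizer (range ρ) ≤ Subgroup.center (SU n) := by
    intro g hg
    have hgc : ∀ i, repTuple ρ i * (g : Matrix (Fin n) (Fin n) ℂ) = g * repTuple ρ i := fun i =>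
      congrArg Subtype.val (Subgroup.mem_centralizer_iff.mp hg _ ⟨FreeGroup.of i, rfl⟩)
    have hginv : ∀ i, star (repTuple ρ i) * (g : Matrix (Fin n) (Fin n) ℂ) =
        g * star (repTuple ρ i) := fun i => by
      have hU := (mem_specialUnitaryGroup_iff.mp (hSU i)).1
      have h1 := congrArg (star (repTuple ρ i) * · * star (repTuple ρ i)) (hgc i)
      simp only [← mul_assoc] at h1
      rw [mem_unitaryGroup_iff'.mp hU, one_mul, mul_assoc _ (repTuple ρ i),
        mem_unitaryGroup_iff.mp hU, mul_one] at h1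
      exact h1.symm
    obtain ⟨c, hc⟩ := (IsMinProj.of_hasLength hlen hone 0).corner g ((mem_centralizer_iff ℂ).mpr (by
      rintro _ ⟨i, rfl⟩
      exact ⟨hgc i, hginv i⟩))
    rw [one_mul, mul_one] at hc
    refine Subgroup.mem_center_iff.mpr fun x => Subtype.ext ?_
    change (x : Matrix (Fin n) (Fin n) ℂ) * g = g * x
    rw [hc, mul_smul_comm, smul_mul_assoc, one_mul, mul_one]
  unfold IsIrreducibleRep
  rw [Subgroup.subgroupOf_eq_top.mpr hle]
  infer_instance

theorem isIrreducibleRep_mk (ρ : FreeGroup (Fin r) →* SU n) (hρ : IsIrreducibleRep ρ) :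
    IsIrreducibleRep ((QuotientGroup.mk' (scalarSU n).range).comp ρ) :=
  hρ.mk _ <| by
    rintro _ ⟨ζ, rfl⟩
    exact scalarSU_mem_center n ζ

theorem isIrreducibleRep_iff (hn : n ≠ 0) {ρ : FreeGroup (Fin r) →* SU n} :
    IsIrreducibleRep ρ ↔ repTuple ρ ∉ lengthGE r n 2 :=
  ⟨fun h => notMem_lengthGE_of_isIrreducibleRep_mk hn (isIrreducibleRep_mk ρ h),
    isIrreducibleRep_of_notMem_lengthGE hn⟩

/-- This identifies `SU_{r,n}^*` with the full preimage of `PU_{r,n}^*`, from which properness and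
surjectivity of `π` follow. -/
theorem isIrreducibleRep_mk_iff (hn : n ≠ 0) {ρ : FreeGroup (Fin r) →* SU n} :
    IsIrreducibleRep ((QuotientGroup.mk' (scalarSU n).range).comp ρ) ↔ IsIrreducibleRep ρ :=
  ⟨fun h => isIrreducibleRep_of_notMem_lengthGE hn (notMem_lengthGE_of_isIrreducibleRep_mk hn h),
    isIrreducibleRep_mk ρ⟩

end Irreducible

end StarSubalgebra

/-! ### Topology of the representation spaces and the map `π` -/

namespace StarSubalgebra

open Matrix AlexanderSpanier Set

variable {r n : ℕ}

section Topology

theorem isInducing_eval (r : ℕ) (K : Type) [Group K] [TopologicalSpace K] :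
    IsInducing fun (ρ : FreeGroup (Fin r) →* K) (i : Fin r) => ρ (FreeGroup.of i) := ⟨rfl⟩

/-- Evaluation at the generators. -/
noncomputable def evalHomeo (r : ℕ) (K : Type) [Group K] [TopologicalSpace K] :
    (FreeGroup (Fin r) →* K) ≃ₜ (Fin r → K) :=
  FreeGroup.lift.symm.toHomeomorphOfIsInducing (isInducing_eval r K)

instance isTopologicalGroup_SU (n : ℕ) : IsTopologicalGroup (SU n) where
  continuous_inv := by
    refine Continuous.subtype_mk (f := fun g : SU n => star (g : Matrix (Fin n) (Fin n) ℂ)) ?_ _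
    exact continuous_star.comp continuous_subtype_val

instance compactSpace_SU (n : ℕ) : CompactSpace (SU n) :=
  isCompact_iff_compactSpace.mp (isCompact_specialUnitaryGroup n)

instance metrizableSpace_SU (n : ℕ) : TopologicalSpace.MetrizableSpace (SU n) :=
  inferInstanceAs (TopologicalSpace.MetrizableSpace
    (specialUnitaryGroup (Fin n) ℂ : Set (Matrix (Fin n) (Fin n) ℂ)))

instance t2Space_rep (r : ℕ) (K : Type) [Group K] [TopologicalSpace K] [T2Space K] :
    T2Space (FreeGroup (Fin r) →* K) :=
  (evalHomeo r K).symm.t2Space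

instance compactSpace_rep (r : ℕ) (K : Type) [Group K] [TopologicalSpace K] [CompactSpace K] :
    CompactSpace (FreeGroup (Fin r) →* K) :=
  (evalHomeo r K).symm.compactSpace

instance metrizableSpace_irrSU (r n : ℕ) : TopologicalSpace.MetrizableSpace (IrrSU r n) :=
  ((evalHomeo r (SU n)).isEmbedding.comp IsEmbedding.subtypeVal).metrizableSpace

/-- Composition of representations with `SU(n) → PU(n)`. -/
def projRep (r n : ℕ) (ρ : FreeGroup (Fin r) →* SU n) : FreeGroup (Fin r) →* PU n :=
  (QuotientGroup.mk' (scalarSU n).range).comp ρ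

theorem continuous_projRep (r n : ℕ) : Continuous (projRep r n) := by
  refine (isInducing_eval r (PU n)).continuous_iff.mpr (continuous_pi fun i => ?_)
  exact QuotientGroup.continuous_mk.comp
    ((continuous_apply i).comp (isInducing_eval r (SU n)).continuous)

theorem surjective_projRep (r n : ℕ) : Function.Surjective (projRep r n) := fun ρ => by
  choose g hg using fun i => QuotientGroup.mk'_surjective (scalarSU n).range (ρ (FreeGroup.of i))
  refine ⟨FreeGroup.lift g, FreeGroup.ext_hom _ _ fun i => ?_⟩
  change QuotientGroup.mk' (scalarSU n).range (FreeGroup.lift g (FreeGroup.of i)) = _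
  rw [FreeGroup.lift_apply_of, hg]

theorem isProperMap_projIrr (hn : n ≠ 0) : IsProperMap (projIrr r n) := by
  have h1 : IsProperMap (projRep r n) := (continuous_projRep r n).isProperMap
  have h2 : {ρ : FreeGroup (Fin r) →* SU n | IsIrreducibleRep ρ} =
      projRep r n ⁻¹' {ρ | IsIrreducibleRep ρ} :=
    Set.ext fun ρ => (isIrreducibleRep_mk_iff hn).symm
  exact (h1.restrictPreimage {ρ | IsIrreducibleRep ρ}).comp (Homeomorph.setCongr h2).isProperMap

theorem surjective_projIrr (hn : n ≠ 0) : Function.Surjective (projIrr r n) := fun ⟨ρ', hρ'⟩ => by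
  obtain ⟨ρ, rfl⟩ := surjective_projRep r n ρ'
  exact ⟨⟨ρ, (isIrreducibleRep_mk_iff hn).mp hρ'⟩, rfl⟩

theorem projIrr_eq_iff (ρ ρ' : IrrSU r n) :
    projIrr r n ρ = projIrr r n ρ' ↔ ∃ σ : CGroup r n, σ • ρ = ρ' := by
  constructor
  · intro h
    have h1 : ∀ i, ∃ ζ, scalarSU n ζ = (ρ.1 (FreeGroup.of i))⁻¹ * ρ'.1 (FreeGroup.of i) := fun i =>
      QuotientGroup.eq.mp (DFunLike.congr_fun (congrArg Subtype.val h) (FreeGroup.of i))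
    choose ζ hζ using h1
    refine ⟨FreeGroup.lift ζ, Subtype.ext (FreeGroup.ext_hom _ _ fun i => ?_)⟩
    change scalarSU n (FreeGroup.lift ζ (FreeGroup.of i)) * ρ.1 (FreeGroup.of i) = _
    rw [FreeGroup.lift_apply_of, ← Subgroup.mem_center_iff.mp (scalarSU_mem_center n (ζ i)), hζ,
      mul_inv_cancel_left]
  · rintro ⟨σ, rfl⟩
    refine Subtype.ext (MonoidHom.ext fun γ => QuotientGroup.eq.mpr ?_)
    change _ * (scalarSU n (σ γ) * ρ.1 γ) ∈ _
    rw [← Subgroup.mem_center_iff.mp (scalarSU_mem_center n (σ γ)), inv_mul_cancel_left]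
    exact ⟨σ γ, rfl⟩

theorem continuous_repTuple (r n : ℕ) : Continuous (repTuple (r := r) (n := n)) :=
  continuous_pi fun i => continuous_subtype_val.comp
    ((continuous_apply i).comp (isInducing_eval r (SU n)).continuous)

instance t2Space_irrPU (r n : ℕ) : T2Space (IrrPU r n) :=
  inferInstanceAs (T2Space {ρ : FreeGroup (Fin r) →* PU n // IsIrreducibleRep ρ})

/-- The reducible representations form the image of a compact set of tuples, so the irreducible ones
are open in a compact Hausdorff space. -/
theorem locallyCompactSpace_irrPU (hn : n ≠ 0) : LocallyCompactSpace (IrrPU r n) := by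
  have h1 : IsClosed (projRep r n '' (repTuple ⁻¹' lengthGE r n 2)) :=
    (((isCompact_lengthGE r n 2).isClosed.preimage (continuous_repTuple r n)).isCompact.image
      (continuous_projRep r n)).isClosed
  have h2 : {ρ : FreeGroup (Fin r) →* PU n | IsIrreducibleRep ρ} =
      (projRep r n '' (repTuple ⁻¹' lengthGE r n 2))ᶜ := by
    ext ρ'
    constructor
    · rintro hρ' ⟨ρ, hρ, rfl⟩
      exact notMem_lengthGE_of_isIrreducibleRep_mk hn hρ' hρ
    · intro hρ'
      obtain ⟨ρ, rfl⟩ := surjective_projRep r n ρ'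
      exact (isIrreducibleRep_mk_iff hn).mpr (isIrreducibleRep_of_notMem_lengthGE hn fun hρ =>
        hρ' ⟨ρ, hρ, rfl⟩)
  have h3 : IsOpen {ρ : FreeGroup (Fin r) →* PU n | IsIrreducibleRep ρ} := by
    rw [h2]
    exact h1.isOpen_compl
  exact h3.locallyCompactSpace

end Topology

/-! ### The action of `C_{r,n}` on irreducible representations -/

section Action

/-- The irreducible representations as pairs of a tuple and the trivial decomposition. -/
noncomputable def irrPair (ρ : IrrSU r n) :
    (Fin r → Matrix (Fin n) (Fin n) ℂ) × (Fin 1 → Matrix (Fin n) (Fin n) ℂ) :=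
  (repTuple ρ.1, fun _ => 1)

theorem isEmbedding_irrPair : IsEmbedding (irrPair (r := r) (n := n)) := by
  have h1 : IsEmbedding fun ρ : IrrSU r n => repTuple ρ.1 :=
    (IsEmbedding.piMap fun _ : Fin r => IsEmbedding.subtypeVal
      (p := fun A => A ∈ specialUnitaryGroup (Fin n) ℂ)).comp
      ((evalHomeo r (SU n)).isEmbedding.comp IsEmbedding.subtypeVal)
  exact IsEmbedding.of_comp (h1.continuous.prodMk continuous_const) continuous_fst h1

/-- A decomposition into one piece is `1`, so the maximal pairs with `t = 1` are exactly the
irreducible tuples. -/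
theorem range_irrPair (hn : n ≠ 0) :
    range (irrPair (r := r) (n := n)) = pairSpace r n 1 \ pairsGE r n 1 2 := by
  ext ⟨A, Q⟩
  constructor
  · rintro ⟨ρ, hρ⟩
    obtain ⟨rfl, rfl⟩ := Prod.ext_iff.mp hρ.symm
    refine ⟨⟨fun i => (ρ.1 _).2, ⟨fun _ => star_one _, fun _ => one_mul _, fun i j hij => ?_,
      by simp [irrPair], fun _ h => ?_⟩, fun i j => ?_⟩, fun h =>
      (isIrreducibleRep_iff hn).mp ρ.2 h.2⟩
    · exact absurd (Subsingleton.elim i j) hij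
    · have h1 := congrArg Matrix.trace h
      change trace 1 = _ at h1
      rw [trace_one, trace_zero, Fintype.card_fin, Nat.cast_eq_zero] at h1
      exact hn h1
    · change _ * 1 = 1 * _
      rw [mul_one, one_mul]
  · rintro ⟨hp, hp2⟩
    obtain ⟨hA, hQ, hAQ⟩ := hp
    let ρ : FreeGroup (Fin r) →* SU n := FreeGroup.lift fun i => ⟨A i, hA i⟩
    have hρ : repTuple ρ = A := funext fun i => by
      change ((FreeGroup.lift _ (FreeGroup.of i) : SU n) : Matrix (Fin n) (Fin n) ℂ) = A i
      rw [FreeGroup.lift_apply_of]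
    refine ⟨⟨ρ, (isIrreducibleRep_iff hn).mpr fun h => hp2 ⟨⟨hA, hQ, hAQ⟩, ?_⟩⟩, Prod.ext hρ ?_⟩
    · rwa [hρ] at h
    · funext j
      have h1 : ∑ i, Q i = 1 := hQ.sum_eq
      rw [Fin.sum_univ_one] at h1
      rw [Subsingleton.elim j 0]
      exact h1.symm

/-- The group `C_{r,n}` acts trivially on the cohomology of the space of irreducible
representations. -/
theorem trivOn_smul (hn : n ≠ 0) (σ : CGroup r n) :
    TrivOn (fun ρ : IrrSU r n => σ • ρ) univ := by
  set ζ : Fin r → ℂ := fun i => ((σ (FreeGroup.of i) : ℂˣ) : ℂ)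
  have hζ : ∀ i, ζ i ^ n = 1 := fun i => by
    have h := (mem_rootsOfUnity n (σ (FreeGroup.of i) : ℂˣ)).mp (σ (FreeGroup.of i)).2
    simpa using congrArg Units.val h
  refine TrivOn.of_isEmbedding isEmbedding_irrPair (σ' := twist ζ 1) ?_ ?_
  · funext ρ
    refine Prod.ext (funext fun i => ?_) rfl
    change (ζ i • 1) * repTuple ρ.1 i = ζ i • repTuple ρ.1 i
    rw [smul_mul_assoc, one_mul]
  · rw [range_irrPair hn]
    exact trivOn_pairsGE_diff hn hζ 1

instance finite_CGroup (r n : ℕ) [NeZero n] : Finite (CGroup r n) :=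
  Finite.of_equiv _ (FreeGroup.lift (α := Fin r) (β := rootsOfUnity n ℂ))

/-- The projection to `PU(n)`-representations with the action of `C_{r,n}` on its fibres. -/
noncomputable def projAction (r n : ℕ) [NeZero n] [Fintype (CGroup r n)] :
    FibreAction (CGroup r n) (projIrr r n) univ univ where
  act σ ρ := σ • ρ
  act_mul σ τ ρ := mul_smul σ τ ρ
  continuous_act σ := continuous_const_smul σ
  mapsTo_act _ := mapsTo_univ _ _
  q_act σ ρ := ((projIrr_eq_iff ρ (σ • ρ)).mpr ⟨σ, rfl⟩).symm
  continuous_q := (isProperMap_projIrr (NeZero.ne n)).continuous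
  isProperMap := (isProperMap_projIrr (NeZero.ne n)).comp
    (Homeomorph.Set.univ (IrrSU r n)).isProperMap
  mapsTo := mapsTo_univ _ _
  isClosed := isClosed_univ

theorem acyclicOn_projAction [NeZero n] [Fintype (CGroup r n)] (x : IrrPU r n) :
    AcyclicOn (projAction r n).act (univ ∩ projIrr r n ⁻¹' {x}) := by
  obtain ⟨ρ, rfl⟩ := surjective_projIrr (NeZero.ne n) x
  have htrans : ∀ ρ' ∈ univ ∩ projIrr r n ⁻¹' {projIrr r n ρ}, ∃ σ : CGroup r n, σ • ρ = ρ' :=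
    fun ρ' hρ' => (projIrr_eq_iff ρ ρ').mp hρ'.2.symm
  refine AcyclicOn.of_transitive ?_ ⟨mem_univ ρ, rfl⟩ htrans
  exact (finite_range fun σ : CGroup r n => σ • ρ).subset htrans

end Action

end StarSubalgebra

/-! ### From cochains to cohomology classes -/

namespace CompactCohomology

open AlexanderSpanier

section Homology

variable (K : CochainComplex (ModuleCat ℂ) ℕ)

theorem exists_iCycles_eq {k : ℕ} (x : K.X k) (hx : (K.d k (k + 1)).hom x = 0) :
    ∃ z : K.cycles k, (K.iCycles k).hom z = x := by
  have hex : (ShortComplex.mk (K.iCycles k) (K.d k (k + 1)) (K.iCycles_d k (k + 1))).Exact :=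
    ShortComplex.exact_of_f_is_kernel _ (K.cyclesIsKernel k (k + 1) (by simp))
  exact (ShortComplex.moduleCat_exact_iff _).mp hex x hx

theorem exists_homologyπ_eq {k : ℕ} (h : K.homology k) :
    ∃ z : K.cycles k, (K.homologyπ k).hom z = h :=
  (ModuleCat.epi_iff_surjective _).mp inferInstance h

theorem injective_iCycles (k : ℕ) : Function.Injective (K.iCycles k).hom :=
  (ModuleCat.mono_iff_injective _).mp inferInstance

theorem homologyπ_eq_zero_iff {i k : ℕ} (hi : (ComplexShape.up ℕ).prev k = i) (z : K.cycles k) :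
    (K.homologyπ k).hom z = 0 ↔ ∃ y : K.X i, (K.d i k).hom y = (K.iCycles k).hom z := by
  have hex : (ShortComplex.mk (K.toCycles i k) (K.homologyπ k) (K.toCycles_comp_homologyπ i k)).Exact :=
    ShortComplex.exact_of_g_is_cokernel _ (K.homologyIsCokernel i k hi)
  have hd : ∀ y : K.X i, (K.iCycles k).hom ((K.toCycles i k).hom y) = (K.d i k).hom y := fun y => by
    rw [← K.toCycles_i i k]
    rfl
  constructor
  · intro hz
    obtain ⟨y, hy⟩ := (ShortComplex.moduleCat_exact_iff _).mp hex z hz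
    exact ⟨y, by rw [← hd]; exact congrArg (K.iCycles k).hom hy⟩
  · rintro ⟨y, hy⟩
    rw [← hd] at hy
    rw [← injective_iCycles K k hy]
    exact congrArg (fun f => f.hom y) (K.toCycles_comp_homologyπ i k)

end Homology

variable {X Y : Type} [TopologicalSpace X] [TopologicalSpace Y] {k : ℕ}

theorem mem_compactlySupported_iff {φ : Cochain X k} :
    φ ∈ compactlySupported X k ↔ CSupp Set.univ (m := k + 1) φ := by
  constructor
  · rintro ⟨K, hK, h⟩
    exact ⟨K, Set.subset_univ K, hK, fun x _ hx => by
      rw [nhdsWithin_univ]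
      exact h x hx⟩
  · rintro ⟨K, -, hK, h⟩
    refine ⟨K, hK, fun x hx => ?_⟩
    have h1 := h x trivial hx
    rwa [nhdsWithin_univ] at h1

theorem mem_locallyZero_iff {φ : Cochain X k} :
    φ ∈ locallyZero X k ↔ LocZero Set.univ (m := k + 1) φ := by
  simp only [LocZero, nhdsWithin_univ]
  exact ⟨fun h x _ => h x, fun h x => h x trivial⟩

/-- The class of a compactly supported cochain modulo locally zero ones. -/
def toCochain (φ : Cochain X k) (hφ : φ ∈ compactlySupported X k) : (cochainComplex X).X k :=
  Submodule.Quotient.mk (p := (locallyZero X k).submoduleOf (compactlySupported X k)) ⟨φ, hφ⟩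

theorem toCochain_eq_zero_iff {φ : Cochain X k} {hφ : φ ∈ compactlySupported X k} :
    toCochain φ hφ = 0 ↔ φ ∈ locallyZero X k :=
  (Submodule.Quotient.mk_eq_zero _).trans Iff.rfl

theorem d_toCochain {φ : Cochain X k} (hφ : φ ∈ compactlySupported X k) :
    ((cochainComplex X).d k (k + 1)).hom (toCochain φ hφ) =
      toCochain (coboundary X k φ) (coboundary_mem X k φ hφ) := by
  simp only [cochainComplex, CochainComplex.of_d]
  rfl

theorem exists_toCochain_eq (x : (cochainComplex X).X k) : ∃ φ hφ, toCochain (X := X) φ hφ = x := by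
  obtain ⟨⟨φ, hφ⟩, h⟩ := Submodule.Quotient.mk_surjective
    ((locallyZero X k).submoduleOf (compactlySupported X k)) x
  exact ⟨φ, hφ, h⟩

/-- The cochain `φ` is a cocycle of class `h`. -/
def IsClass (φ : Coch X (k + 1)) (h : Hc X k) : Prop :=
  ∃ (hφ : φ ∈ compactlySupported X k) (z : (cochainComplex X).cycles k),
    ((cochainComplex X).iCycles k).hom z = toCochain φ hφ ∧
      ((cochainComplex X).homologyπ k).hom z = h

theorem IsClass.csupp {φ : Coch X (k + 1)} {h : Hc X k} (hφ : IsClass φ h) : CSupp Set.univ φ :=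
  mem_compactlySupported_iff.mp hφ.1

theorem IsClass.locZero {φ : Coch X (k + 1)} {h : Hc X k} (hφ : IsClass φ h) :
    LocZero Set.univ (cobd φ) := by
  obtain ⟨hφs, z, hz, -⟩ := hφ
  suffices h0 : toCochain (coboundary X k φ) (coboundary_mem X k φ hφs) = 0 from
    mem_locallyZero_iff.mp (toCochain_eq_zero_iff.mp h0)
  rw [← d_toCochain hφs, ← hz]
  exact congrArg (fun f => f.hom z) ((cochainComplex X).iCycles_d k (k + 1))

theorem exists_isClass (h : Hc X k) : ∃ φ : Coch X (k + 1), IsClass φ h := by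
  obtain ⟨z, hz⟩ := exists_homologyπ_eq _ h
  obtain ⟨φ, hφ, hφz⟩ := exists_toCochain_eq (((cochainComplex X).iCycles k).hom z)
  exact ⟨φ, hφ, z, hφz.symm, hz⟩

theorem exists_class {φ : Coch X (k + 1)} (hφs : CSupp Set.univ φ)
    (hφ : LocZero Set.univ (cobd φ)) : ∃ h : Hc X k, IsClass φ h := by
  have hmem := mem_compactlySupported_iff.mpr hφs
  obtain ⟨z, hz⟩ := exists_iCycles_eq _ (toCochain φ hmem) (by
    rw [d_toCochain, toCochain_eq_zero_iff]
    exact mem_locallyZero_iff.mpr hφ)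
  exact ⟨_, hmem, z, hz, rfl⟩

theorem IsClass.map {f : X → Y} (hf : IsProperMap f) {φ : Coch Y (k + 1)} {h : Hc Y k}
    (hφ : IsClass φ h) : IsClass (pull f φ) ((HcMap hf k).hom h) := by
  obtain ⟨hφs, z, hz, rfl⟩ := hφ
  refine ⟨pullback_mem hf k φ hφs, (HomologicalComplex.cyclesMap (cochainMap hf) k).hom z, ?_, ?_⟩
  · have h1 := congrArg (fun g => g.hom z) (HomologicalComplex.cyclesMap_i (cochainMap hf) k)
    refine h1.trans ?_
    change ((cochainMap hf).f k).hom (((cochainComplex Y).iCycles k).hom z) = _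
    rw [hz]
    rfl
  · exact (congrArg (fun g => g.hom z)
      (HomologicalComplex.homologyπ_naturality (cochainMap hf) k)).symm

theorem IsClass.eq_iff {φ φ' : Coch X (k + 1)} {h h' : Hc X k} (hφ : IsClass φ h)
    (hφ' : IsClass φ' h') : h = h' ↔ ExactOn Set.univ (φ - φ') := by
  obtain ⟨hφs, z, hz, rfl⟩ := hφ
  obtain ⟨hφs', z', hz', rfl⟩ := hφ'
  have hsub : toCochain φ hφs - toCochain φ' hφs' = toCochain (φ - φ') (sub_mem hφs hφs') := rfl
  have hz0 : ((cochainComplex X).homologyπ k).hom z = ((cochainComplex X).homologyπ k).hom z' ↔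
      ((cochainComplex X).homologyπ k).hom (z - z') = 0 := by
    rw [map_sub, sub_eq_zero]
  refine hz0.trans ?_
  cases k with
  | zero =>
    -- In degree `0` the predecessor index is `0` itself, with zero differential. This matches the
    -- clause `m = 0 → b = 0` of `ExactOn`.
    rw [homologyπ_eq_zero_iff _ (i := 0) (by simp), map_sub, hz, hz', hsub]
    have hd : (cochainComplex X).d 0 0 = 0 := (cochainComplex X).shape 0 0 (by simp)
    constructor
    · rintro ⟨y, hy⟩
      rw [hd] at hy
      exact ExactOn.of_locZero (mem_locallyZero_iff.mp (toCochain_eq_zero_iff.mp hy.symm))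
    · rintro ⟨b, hb0, -, hb⟩
      rw [hb0 rfl, map_zero, sub_zero] at hb
      refine ⟨0, ?_⟩
      rw [map_zero]
      exact (toCochain_eq_zero_iff.mpr (mem_locallyZero_iff.mpr hb)).symm
  | succ k =>
    rw [homologyπ_eq_zero_iff _ (i := k) (by simp), map_sub, hz, hz', hsub]
    have key : ∀ (b : Coch X (k + 1)) (hb : b ∈ compactlySupported X k),
        ((cochainComplex X).d k (k + 1)).hom (toCochain b hb) =
          toCochain (φ - φ') (sub_mem hφs hφs') ↔ LocZero Set.univ (φ - φ' - cobd b) := by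
      intro b hb
      rw [d_toCochain, eq_comm, ← sub_eq_zero]
      exact (toCochain_eq_zero_iff (φ := φ - φ' - cobd b)
        (hφ := sub_mem (sub_mem hφs hφs') (coboundary_mem X k b hb))).trans mem_locallyZero_iff
    constructor
    · rintro ⟨y, hy⟩
      obtain ⟨b, hb, rfl⟩ := exists_toCochain_eq y
      exact ⟨b, fun h => absurd h (Nat.succ_ne_zero k), mem_compactlySupported_iff.mp hb,
        (key b hb).mp hy⟩
    · rintro ⟨b, -, hbs, hb⟩
      have hmem := mem_compactlySupported_iff.mpr hbs
      exact ⟨_, (key b hmem).mpr hb⟩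

/-- A proper self-map acting trivially on cohomology, in terms of cochains. -/
theorem HcMap_eq_id {f : X → X} (hf : IsProperMap f) (h : TrivOn f Set.univ) (k : ℕ) :
    HcMap hf k = 𝟙 (Hc X k) := by
  refine ModuleCat.hom_ext (LinearMap.ext fun x => ?_)
  obtain ⟨φ, hφ⟩ := exists_isClass x
  exact (((hφ.eq_iff (hφ.map hf)).mpr (h k φ hφ.locZero hφ.csupp))).symm

/-- If a finite group acts trivially on the cohomology of `Y` and `q : Y → X` is its quotient with
acyclic fibres, then `q` is an isomorphism on cohomology with compact supports. -/
theorem isIso_HcMap {Γ : Type} [Group Γ] [Fintype Γ] [TopologicalSpace.MetrizableSpace Y] [T2Space X]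
    [LocallyCompactSpace X] {q : Y → X} (hq : IsProperMap q)
    (D : FibreAction Γ q Set.univ Set.univ)
    (hac : ∀ x, AcyclicOn D.act (Set.univ ∩ q ⁻¹' {x}))
    (htriv : ∀ γ, TrivOn (D.act γ) Set.univ) (k : ℕ) : IsIso (HcMap hq k) := by
  have hqact : ∀ γ, IsProperMap (q ∘ D.act γ) := fun γ => by
    rwa [show q ∘ D.act γ = q from funext (D.q_act γ)]
  rw [ConcreteCategory.isIso_iff_bijective]
  constructor
  · refine (injective_iff_map_eq_zero (HcMap hq k).hom).mpr fun x hx => ?_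
    obtain ⟨φ, hφ⟩ := exists_isClass x
    have h0 : ∀ {Z : Type} [TopologicalSpace Z], IsClass (0 : Coch Z (k + 1)) (0 : Hc Z k) :=
      ⟨zero_mem _, 0, by rw [map_zero]; exact (toCochain_eq_zero_iff.mpr (zero_mem _)).symm,
        map_zero _⟩
    refine (hφ.eq_iff h0).mpr ?_
    have h1 := ((hφ.map hq).eq_iff h0).mp hx
    rw [sub_zero] at h1 ⊢
    have h2 := D.exactOn_of_exactOn_pull isOpen_univ (fun x _ => hac x) (c := φ)
    rw [Set.preimage_univ, Set.univ_inter, Set.univ_inter] at h2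
    exact h2 hφ.locZero hφ.csupp h1
  · intro y
    obtain ⟨ψ, hψ⟩ := exists_isClass y
    -- Since every `γ` acts trivially, `ψ` is cohomologous to its average, and invariant cocycles
    -- come from the base.
    have havg : ExactOn Set.univ (ψ - D.avg ψ) := by
      have hN : (Fintype.card Γ : ℂ) ≠ 0 := Nat.cast_ne_zero.mpr Fintype.card_ne_zero
      have heq : ψ - D.avg ψ = (Fintype.card Γ : ℂ)⁻¹ • ∑ γ, (ψ - pull (D.act γ) ψ) := by
        rw [D.avg_apply, Finset.sum_sub_distrib, smul_sub, Finset.sum_const, Finset.card_univ,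
          ← Nat.cast_smul_eq_nsmul ℂ, smul_smul, inv_mul_cancel₀ hN, one_smul]
      rw [heq]
      exact ExactOn.smul _ (ExactOn.sum fun γ _ => htriv γ k ψ hψ.locZero hψ.csupp)
    obtain ⟨b, hb0, hbs, hb⟩ := havg
    have havgs : CSupp Set.univ (D.avg ψ) := by
      rw [D.avg_apply]
      refine CSupp.smul _ (CSupp.sum fun γ _ => ?_)
      exact mem_compactlySupported_iff.mp (pullback_mem
        (isProperMap_of_comp_of_t2 (D.continuous_act γ) hq.continuous (hqact γ)) k ψ
        (mem_compactlySupported_iff.mpr hψ.csupp))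
    have havgc : LocZero Set.univ (cobd (D.avg ψ)) := by
      have h1 := hψ.locZero.sub hb.cobd
      rwa [map_sub, map_sub, cobd_cobd, sub_zero, sub_sub_cancel] at h1
    obtain ⟨c, hc, hcs, hcψ⟩ := D.exists_cocycle_of_invariant (fun x _ => hac x)
      (D.pull_act_avg ψ) havgc havgs
    obtain ⟨x, hx⟩ := exists_class hcs hc
    refine ⟨x, (((hψ.eq_iff (hx.map hq)).mpr ?_)).symm⟩
    have h2 := ExactOn.add (⟨b, hb0, hbs, hb⟩ : ExactOn Set.univ (ψ - D.avg ψ)) hcψ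
    rwa [sub_add_sub_cancel] at h2

end CompactCohomology

open CompactCohomology in
theorem mainTheorem4 (r n : ℕ) (hr : 1 ≤ r) (hn : 1 ≤ n) :
    (∀ (σ : CGroup r n) (k : ℕ), HcMap σ.isProperMap_smul k = 𝟙 (Hc (IrrSU r n) k)) ∧
    (Function.Surjective (projIrr r n) ∧
      ∀ ρ ρ' : IrrSU r n, projIrr r n ρ = projIrr r n ρ' ↔ ∃ σ : CGroup r n, σ • ρ = ρ') ∧
    ∃ hπ : IsProperMap (projIrr r n), ∀ k : ℕ, IsIso (HcMap hπ k) := by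
  have hn0 : n ≠ 0 := by omega
  have : NeZero n := ⟨hn0⟩
  let _ : Fintype (CGroup r n) := Fintype.ofFinite _
  have := StarSubalgebra.locallyCompactSpace_irrPU (r := r) hn0
  exact ⟨fun σ k => HcMap_eq_id _ (StarSubalgebra.trivOn_smul hn0 σ) k,
    ⟨StarSubalgebra.surjective_projIrr hn0, StarSubalgebra.projIrr_eq_iff⟩,
    StarSubalgebra.isProperMap_projIrr hn0,
    fun k => isIso_HcMap _ (StarSubalgebra.projAction r n) StarSubalgebra.acyclicOn_projAction
      (fun σ => StarSubalgebra.trivOn_smul hn0 σ) k⟩
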